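/- Let $S^2\subset\mathbb R^3$ be the unit sphere with its round metric $g_{S^2}$, and let $g_t=dr^2+2|t|\,g_{S^2}$, $t<0$, be the shrinking round cylinder on $S^2\times\mathbb R$. Let $I\subset(-\infty,0)$ be an interval and let $(h_t)_{t\in I}$ be a linearized Ricci–DeTurck flow on this background, i.e. a family of symmetric $2$-tensor fields on $S^2\times\mathbb R$, smooth on $S^2\times\mathbb R\times I$, with $$\nabla_{\partial_t}h_t=\Delta_{g_t}h_t+2\,\mathrm{Rm}_{g_t}(h_t),$$ where $\Delta_{g_t}$ is the connection Laplacian, $(\nabla_{\partial_t}h)_{ij}=\partial_t h_{ij}-\tfrac12 g^{pq}\big(h_{pj}\,\partial_t g_{qi}+h_{ip}\,\partial_t g_{qj}\big)$ and $(\mathrm{Rm}(h))_{ij}=g^{pq}R_{pij}{}^{u}h_{qu}$ (with the sign convention $\mathrm{Rm}_g(g)=\mathrm{Ric}_g$). For $t\in I$, $r\in\mathbb R$ let $$\|h_t\|_{L^2(S^2\times\{r\})}=\Big(\frac1{|S^2\times\{r\}|}\int_{S^2\times\{r\}}|h_t|^2\,dV\Big)^{1/2},$$ with the area, the measure $dV$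 and the norm $|\cdot|$ induced by $g_t$. Let $O(3)$ act on $S^2\times\mathbb R$ in the standard way on $S^2$ and trivially on $\mathbb R$, and assume that for every $t\in I$ the average $\int_{O(3)}\phi_A^*h_t\,dA$ of $h_t$ over $O(3)$ (with respect to Haar measure) vanishes. Then: (a) If $\sup_{(r,t)\in\mathbb R\times J}\|h_t\|_{L^2(S^2\times\{r\})}<\infty$ for every compact interval $J\subset I$, then $\sup_{r\in\mathbb R}\|h_t\|_{L^2(S^2\times\{r\})}$ is a non-increasing function of $t\in I$. (b) If $\inf I=-\infty$ and $\sup_{(r,t)\in\mathbb R\times I}\|h_t\|_{L^2(S^2\times\{r\})}<\infty$, then there are $a_1,a_2,a_3\in\mathbb R$ such that for all $t\in I$ $$h_t=(a_1u_1+a_2u_2+a_3u_3)\cdot 2|t|\,g_{S^2},$$ where $u_1,u_2,u_3$ are the coordinate functions on $S^2\subset\mathbb R^3$, i.e. $h_t$ is a time-independent combination of the $u_i$ times the $S^2$-part of $g_t$. -/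

import Mathlib

noncomputable section

open MeasureTheory Set

/-! ## Tensor calculus in local coordinates

Tensor fields of type (0,2) on (an open subset of) `ℝⁿ` are given by their coefficient matrices. -/

namespace LocalCoords

variable {n : ℕ}

/-- Coefficients `h_{ij}` of a (0,2)-tensor field in coordinates `y ∈ ℝⁿ`. -/
abbrev TensorField (n : ℕ) : Type := (Fin n → ℝ) → Matrix (Fin n) (Fin n) ℝ

/-- The partial derivative `∂_k f`. -/
def pd (k : Fin n) (f : (Fin n → ℝ) → ℝ) (y : Fin n → ℝ) : ℝ :=
  fderiv ℝ f y (Pi.single k 1)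

/-- Christoffel symbols of the Levi-Civita connection: `christoffel g k i j = Γ^k_{ij}`. -/
def christoffel (g : TensorField n) (k i j : Fin n) (y : Fin n → ℝ) : ℝ :=
  (1 / 2) * ∑ l, (g y)⁻¹ k l *
    (pd i (fun z => g z j l) y + pd j (fun z => g z i l) y - pd l (fun z => g z i j) y)

/-- First covariant derivative: `covDeriv g h k i j = ∇_k h_{ij}`. -/
def covDeriv (g h : TensorField n) (k i j : Fin n) (y : Fin n → ℝ) : ℝ :=
  pd k (fun z => h z i j) y
    - ∑ p, christoffel g p k i y * h y p j
    - ∑ p, christoffel g p k j y * h y i p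

/-- Second covariant derivative: `covDeriv₂ g h l k i j = ∇²_{l,k} h_{ij}`. -/
def covDeriv₂ (g h : TensorField n) (l k i j : Fin n) (y : Fin n → ℝ) : ℝ :=
  pd l (covDeriv g h k i j) y
    - ∑ p, christoffel g p l k y * covDeriv g h p i j y
    - ∑ p, christoffel g p l i y * covDeriv g h k p j y
    - ∑ p, christoffel g p l j y * covDeriv g h k i p y

/-- The connection Laplacian: `(Δ_g h)_{ij} = g^{lk} ∇²_{l,k} h_{ij}`. -/
def laplacian (g h : TensorField n) (i j : Fin n) (y : Fin n → ℝ) : ℝ :=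
  ∑ l, ∑ k, (g y)⁻¹ l k * covDeriv₂ g h l k i j y

/-- The curvature tensor: `riemann g i j k l = R_{ijk}^l`, where
`∇_{∂_i} ∇_{∂_j} ∂_k - ∇_{∂_j} ∇_{∂_i} ∂_k = R_{ijk}^l ∂_l`. -/
def riemann (g : TensorField n) (i j k l : Fin n) (y : Fin n → ℝ) : ℝ :=
  pd i (christoffel g l j k) y - pd j (christoffel g l i k) y
    + ∑ m, (christoffel g m j k y * christoffel g l i m y
      - christoffel g m i k y * christoffel g l j m y)

/-- The curvature action: `(Rm_g(h))_{ij} = g^{pq} R_{pij}^u h_{qu}` (so `Rm_g(g) = Ric_g`). -/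
def rmAction (g h : TensorField n) (i j : Fin n) (y : Fin n → ℝ) : ℝ :=
  ∑ p, ∑ q, ∑ u, (g y)⁻¹ p q * riemann g p i j u y * h y q u

/-- The time derivative with Uhlenbeck's trick,
`(∇_{∂_t} h)_{ij} = ∂_t h_{ij} - ½ g^{pq} (h_{pj} ∂_t g_{qi} + h_{ip} ∂_t g_{qj})`;
at an endpoint of the time interval `I`, time derivatives are one-sided. -/
def uhlenbeckDeriv (I : Set ℝ) (g h : ℝ → TensorField n) (i j : Fin n) (t : ℝ)
    (y : Fin n → ℝ) : ℝ :=
  derivWithin (fun s => h s y i j) I t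
    - (1 / 2) * ∑ p, ∑ q, (g t y)⁻¹ p q *
      (h t y p j * derivWithin (fun s => g s y q i) I t
        + h t y i p * derivWithin (fun s => g s y q j) I t)

/-- The linearized Ricci–DeTurck equation `∇_{∂_t} h = Δ_g h + 2 Rm_g(h)` at time `t` and
point `y`. -/
def LinearizedRDTEquation (I : Set ℝ) (g h : ℝ → TensorField n) (t : ℝ) (y : Fin n → ℝ) : Prop :=
  ∀ i j, uhlenbeckDeriv I g h i j t y = laplacian (g t) (h t) i j y + 2 * rmAction (g t) (h t) i j y

end LocalCoords

/-! ## The shrinking round cylinder -/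

namespace RoundCylinder

/-- `ℝ³`. -/
abbrev R3 : Type := EuclideanSpace ℝ (Fin 3)

/-- `ℝ³ × ℝ`, which contains the cylinder `S² × ℝ`. -/
abbrev Amb : Type := R3 × ℝ

/-- The cylinder `S² × ℝ` inside `ℝ³ × ℝ`. -/
def cyl : Set Amb := {p | ‖p.1‖ = 1}

/-- The tangent space of `S² × ℝ` at `p = (x, r)`: vectors `(v, s)` with `v ⊥ x`. -/
def tangent (p : Amb) : Submodule ℝ Amb where
  carrier := {v | inner ℝ p.1 v.1 = 0}
  add_mem' := by
    intro a b ha hb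
    simp only [mem_ofPred_eq, Prod.fst_add, inner_add_right] at *
    rw [ha, hb, add_zero]
  zero_mem' := by simp
  smul_mem' := by
    intro c a ha
    simp only [mem_ofPred_eq, Prod.smul_fst, inner_smul_right] at *
    rw [ha, mul_zero]

/-- A (0,2)-tensor field on `S² × ℝ`. The value at `p ∈ cyl` is a bilinear form on
`tangent p`, represented by a bilinear form on `ℝ³ × ℝ` that restricts to it; nothing below
depends on the values at points off the cylinder or on non-tangent vectors. -/
abbrev Tensor₂ : Type := Amb → LinearMap.BilinForm ℝ Amb

/-- The metric `g_{S²}` of the unit sphere, pulled back to `S² × ℝ`, on tangent vectors. -/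
def sphereMetric (v w : Amb) : ℝ := inner ℝ v.1 w.1

/-- The metric `g_t = dr² + 2|t| g_{S²}` on tangent vectors. -/
def metric (t : ℝ) (v w : Amb) : ℝ := v.2 * w.2 + 2 * |t| * sphereMetric v w

/-- `ψ` is a smooth local parametrization (an immersion between equidimensional manifolds) of
`S² × ℝ`, defined on the open set `U ⊆ ℝ³`. -/
structure IsLocalParam (U : Set (Fin 3 → ℝ)) (ψ : (Fin 3 → ℝ) → Amb) : Prop where
  isOpen : IsOpen U
  smooth : ContDiffOn ℝ (⊤ : ℕ∞) ψ U
  mapsTo : MapsTo ψ U cyl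
  immersion : ∀ y ∈ U, Function.Injective (fderiv ℝ ψ y)

/-- The coordinate vector field `∂_i ψ`. -/
def coordVec (ψ : (Fin 3 → ℝ) → Amb) (i : Fin 3) (y : Fin 3 → ℝ) : Amb :=
  fderiv ℝ ψ y (Pi.single i 1)

/-- The coefficients of `g_t` in the coordinates given by `ψ`. -/
def metricCoeff (ψ : (Fin 3 → ℝ) → Amb) (t : ℝ) : LocalCoords.TensorField 3 :=
  fun y => Matrix.of fun i j => metric t (coordVec ψ i y) (coordVec ψ j y)

/-- The coefficients of a tensor field in the coordinates given by `ψ`. -/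
def tensorCoeff (ψ : (Fin 3 → ℝ) → Amb) (h : Tensor₂) : LocalCoords.TensorField 3 :=
  fun y => Matrix.of fun i j => h (ψ y) (coordVec ψ i y) (coordVec ψ j y)

/-- `(h_t)_{t ∈ I}` is a linearized Ricci–DeTurck flow on the shrinking round cylinder: a family of
symmetric 2-tensor fields, smooth on `S² × ℝ × I`, which solves
`∇_{∂_t} h_t = Δ_{g_t} h_t + 2 Rm_{g_t}(h_t)` in local coordinates. -/
structure IsLinearizedRicciDeTurckFlow (I : Set ℝ) (h : ℝ → Tensor₂) : Prop where
  symm : ∀ t ∈ I, ∀ p ∈ cyl, ∀ v ∈ tangent p, ∀ w ∈ tangent p, h t p v w = h t p w v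
  smooth : ∀ U ψ, IsLocalParam U ψ → ∀ i j, ContDiffOn ℝ (⊤ : ℕ∞)
    (fun z : (Fin 3 → ℝ) × ℝ => tensorCoeff ψ (h z.2) z.1 i j) (U ×ˢ I)
  equation : ∀ U ψ, IsLocalParam U ψ → ∀ t ∈ I, ∀ y ∈ U,
    LocalCoords.LinearizedRDTEquation I (metricCoeff ψ) (fun s => tensorCoeff ψ (h s)) t y

/-! ### The `O(3)`-action and the average -/

/-- The orthogonal group `O(3)`. -/
abbrev O3 : Type := Matrix.orthogonalGroup (Fin 3) ℝ

instance : MeasurableSpace O3 := borel O3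

instance : BorelSpace O3 := ⟨rfl⟩

instance : CompactSpace O3 := by
  refine (isCompact_iff_compactSpace
    (s := (Matrix.orthogonalGroup (Fin 3) ℝ : Set (Matrix (Fin 3) (Fin 3) ℝ)))).mp ?_
  have hK : IsCompact (Set.pi univ fun _ : Fin 3 => Set.pi univ fun _ : Fin 3 =>
      Metric.closedBall (0 : ℝ) 1) :=
    isCompact_univ_pi fun _ => isCompact_univ_pi fun _ => isCompact_closedBall 0 1
  refine IsCompact.of_isClosed_subset (s := (Set.pi univ fun _ : Fin 3 => Set.pi univ
    fun _ : Fin 3 => Metric.closedBall (0 : ℝ) 1 : Set (Matrix (Fin 3) (Fin 3) ℝ))) hK ?_ ?_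
  · have : (Matrix.orthogonalGroup (Fin 3) ℝ : Set (Matrix (Fin 3) (Fin 3) ℝ))
        = {A | star A * A = 1} ∩ {A | A * star A = 1} := by
      ext A
      exact Unitary.mem_iff
    change IsClosed (Matrix.orthogonalGroup (Fin 3) ℝ : Set (Matrix (Fin 3) (Fin 3) ℝ))
    rw [this]
    exact (isClosed_eq (by fun_prop) continuous_const).inter
      (isClosed_eq (by fun_prop) continuous_const)
  · intro A hA i _ j _
    simpa using entry_norm_bound_of_unitary hA i j

/-- The Haar probability measure on `O(3)`. -/
def haarO3 : Measure O3 := Measure.haarMeasure (⊤ : TopologicalSpace.PositiveCompacts O3)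

/-- The standard action of `A ∈ O(3)`, `(x, r) ↦ (A x, r)`; it is linear on `ℝ³ × ℝ`, so it is
also its own differential. -/
def act (A : O3) (p : Amb) : Amb := (Matrix.toEuclideanLin A.1 p.1, p.2)

/-- The average of `h` under the `O(3)`-action, `∫ φ_A^* h dA`, evaluated at `p` on `v`, `w`. -/
def o3Average (h : Tensor₂) (p v w : Amb) : ℝ :=
  ∫ A : O3, h (act A p) (act A v) (act A w) ∂haarO3

/-! ### The fiberwise `L²`-norm -/

/-- The orthogonal projection of `e_i` to the tangent space of the unit sphere at `x`. -/
def sphereProj (x : R3) (i : Fin 3) : R3 :=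
  EuclideanSpace.single i 1 - x i • x

/-- The orthogonal projections to the tangent space at `p` of the vectors `∂_r` and
`e_i / √(2|t|)`, which form a `g_t`-orthonormal basis of `ℝ³ × ℝ`. -/
def projFrame (t : ℝ) (p : Amb) : Option (Fin 3) → Amb
  | none => (0, 1)
  | some i => ((Real.sqrt (2 * |t|))⁻¹ • sphereProj p.1 i, 0)

/-- The square `|B|²` of the norm with respect to `g_t` of a 2-tensor at `p`. By
`normSq_eq_of_orthonormal` it is `∑ B(e_i, e_j)²` for every `g_t`-orthonormal basis `(e_i)` of
the tangent space. -/
def normSq (t : ℝ) (p : Amb) (B : LinearMap.BilinForm ℝ Amb) : ℝ :=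
  ∑ a, ∑ b, (B (projFrame t p a) (projFrame t p b)) ^ 2

/-- `normSq` is the usual squared norm, computed in any `g_t`-orthonormal basis of the tangent
space. -/
theorem normSq_eq_of_orthonormal {t : ℝ} (ht : t < 0) {p : Amb} (hp : p ∈ cyl)
    (B : LinearMap.BilinForm ℝ Amb) (e : Fin 3 → Amb) (he : ∀ i, e i ∈ tangent p)
    (hon : ∀ i j, metric t (e i) (e j) = if i = j then 1 else 0) :
    normSq t p B = ∑ i, ∑ j, (B (e i) (e j)) ^ 2 := by
  have hs : 0 < 2 * |t| := by have := abs_pos.2 ht.ne; positivity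
  set s := Real.sqrt (2 * |t|) with hsdef
  have hs0 : 0 < s := Real.sqrt_pos.2 hs
  have hss : s * s = 2 * |t| := Real.mul_self_sqrt hs.le
  -- coordinates with respect to the orthonormal basis of the ambient space
  let c : Option (Fin 3) → Fin 3 → ℝ := fun a i => a.elim (e i).2 (fun k => s * (e i).1 k)
  let M : Matrix (Option (Fin 3)) (Option (Fin 3)) ℝ :=
    Matrix.of fun a i => i.elim (a.elim 0 (fun k => p.1 k)) (fun i => c a i)
  have hx : ∑ k, p.1 k * p.1 k = 1 := by
    have h1 : inner ℝ p.1 p.1 = (1 : ℝ) := by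
      rw [real_inner_self_eq_norm_sq]
      have : ‖p.1‖ = 1 := hp
      rw [this]; norm_num
    rw [PiLp.inner_apply] at h1
    simpa only [RCLike.inner_apply, conj_trivial] using h1
  have hxe : ∀ i, ∑ k, p.1 k * (e i).1 k = 0 := by
    intro i
    have h1 : inner ℝ p.1 (e i).1 = (0 : ℝ) := he i
    simpa [PiLp.inner_apply, mul_comm] using h1
  have hcc : ∀ i j, ∑ a, c a i * c a j = if i = j then 1 else 0 := by
    intro i j
    rw [← hon i j, metric, sphereMetric, ← hss]
    simp only [Fintype.sum_option, c, Option.elim, PiLp.inner_apply, Finset.mul_sum]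
    congr 1
    refine Finset.sum_congr rfl fun k _ => ?_
    simp only [RCLike.inner_apply, conj_trivial]
    ring
  have hMM : M.transpose * M = 1 := by
    ext i j
    rw [Matrix.mul_apply]
    rcases i with _ | i <;> rcases j with _ | j
    · simpa [M, Fintype.sum_option] using hx
    · have := hxe j
      have h2 : ∑ k, p.1 k * (s * (e j).1 k) = s * ∑ k, p.1 k * (e j).1 k := by
        rw [Finset.mul_sum]; exact Finset.sum_congr rfl fun k _ => by ring
      simp [M, c, Fintype.sum_option, h2, this]
    · have := hxe i
      have h2 : ∑ k, s * (e i).1 k * p.1 k = s * ∑ k, p.1 k * (e i).1 k := by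
        rw [Finset.mul_sum]; exact Finset.sum_congr rfl fun k _ => by ring
      simp [M, c, Fintype.sum_option, h2, this]
    · have := hcc i j
      simpa [M, Matrix.one_apply] using this
  have hMM' : M * M.transpose = 1 := mul_eq_one_comm.mp hMM
  have hrow : ∀ a b, ∑ i, c a i * c b i
      = (if a = b then 1 else 0) - (a.elim 0 (fun k => p.1 k)) * (b.elim 0 (fun k => p.1 k)) := by
    intro a b
    have h1 := congrFun (congrFun hMM' a) b
    rw [Matrix.mul_apply, Fintype.sum_option, Matrix.one_apply] at h1
    simp only [M, Matrix.transpose_apply, Matrix.of_apply, Option.elim] at h1 ⊢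
    linarith
  have hframe : ∀ a, projFrame t p a = ∑ i, c a i • e i := by
    intro a
    refine Prod.ext ?_ ?_
    · ext l
      have h1 := hrow a (some l)
      have h2 : ∑ i, c a i * c (some l) i = s * ∑ i, c a i * (e i).1 l := by
        rw [Finset.mul_sum]; exact Finset.sum_congr rfl fun i _ => by simp only [c, Option.elim]; ring
      rw [h2] at h1
      have h3 : (∑ i, c a i • e i).1 l = ∑ i, c a i * (e i).1 l := by
        simp [Prod.fst_sum]
      rw [h3]
      apply mul_left_cancel₀ hs0.ne'
      rw [h1]
      rcases a with _ | k
      · simp [projFrame]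
      · simp only [projFrame, ← hsdef, sphereProj, PiLp.smul_apply, PiLp.sub_apply, smul_eq_mul,
          Option.elim, Option.some.injEq, PiLp.single_apply]
        rw [← mul_assoc, mul_inv_cancel₀ hs0.ne', one_mul]
        simp only [eq_comm]
    · have h1 := hrow a none
      have h3 : (∑ i, c a i • e i).2 = ∑ i, c a i * c none i := by
        simp [Prod.snd_sum, c]
      rw [h3, h1]
      rcases a with _ | k <;> simp [projFrame]
  let C : Matrix (Option (Fin 3)) (Fin 3) ℝ := Matrix.of c
  let b : Matrix (Fin 3) (Fin 3) ℝ := Matrix.of fun i j => B (e i) (e j)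
  have hC : C.transpose * C = 1 := by
    ext i j
    rw [Matrix.mul_apply, Matrix.one_apply, ← hcc i j]
    rfl
  have hN : ∀ x y, B (projFrame t p x) (projFrame t p y) = (C * b * C.transpose) x y := by
    intro x y
    rw [hframe, hframe, Matrix.mul_apply]
    simp only [map_sum, LinearMap.sum_apply, map_smul, LinearMap.smul_apply, smul_eq_mul,
      Matrix.mul_apply, Matrix.transpose_apply, C, b, Matrix.of_apply, Finset.sum_mul]
    refine Finset.sum_congr rfl fun i _ => ?_
    rw [Finset.mul_sum]
    exact Finset.sum_congr rfl fun j _ => by ring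
  have htr : ∀ {m : Type} [Fintype m] (A : Matrix m m ℝ),
      ∑ x, ∑ y, (A x y) ^ 2 = (A * A.transpose).trace := by
    intro m _ A
    simp [Matrix.trace, Matrix.mul_apply, pow_two]
  have e1 : normSq t p B = ∑ x, ∑ y, ((C * b * C.transpose) x y) ^ 2 := by
    simp only [normSq, hN]
  have e2 : ∑ i, ∑ j, (B (e i) (e j)) ^ 2 = ∑ i, ∑ j, (b i j) ^ 2 := rfl
  rw [e1, e2, htr, htr]
  have h1 : (C * b * C.transpose) * (C * b * C.transpose).transpose
      = C * (b * b.transpose * C.transpose) := by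
    rw [Matrix.transpose_mul, Matrix.transpose_mul, Matrix.transpose_transpose]
    calc C * b * C.transpose * (C * (b.transpose * C.transpose))
        = C * b * (C.transpose * C) * (b.transpose * C.transpose) := by
          simp only [Matrix.mul_assoc]
      _ = _ := by rw [hC]; simp only [Matrix.mul_assoc, Matrix.mul_one]
  rw [h1, Matrix.trace_mul_comm, Matrix.mul_assoc, hC, Matrix.mul_one]

/-- The Riemannian measure of `g_t` on a fiber `S² × {r}`, that is `2|t|` times the area measure
of the unit sphere. -/
def fiberMeasure (t : ℝ) : Measure (Metric.sphere (0 : R3) 1) :=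
  ENNReal.ofReal (2 * |t|) • (volume : Measure R3).toSphere

/-- The normalized fiberwise `L²`-norm `‖h‖_{L²(S² × {r})}` with respect to `g_t`. -/
def fiberL2 (t : ℝ) (h : Tensor₂) (r : ℝ) : ℝ :=
  Real.sqrt ((1 / (fiberMeasure t).real univ) *
    ∫ x : Metric.sphere (0 : R3) 1, normSq t (x.1, r) (h (x.1, r)) ∂(fiberMeasure t))

end RoundCylinder

end

open RoundCylinder

/-! A tensor on the cylinder is read as a function on orthonormal frames, that is on O(3) × ℝ × I:
columns 0 and 1 of an orthogonal matrix are tangent to the unit sphere at column 2. In this picture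
the rough Laplacian of the sphere is `hLap`, a sum of squares of two infinitesimal right
translations without connection terms. After passing to the trace and the difference of the two
diagonal spherical components, the flow decouples into scalar equations (`frame_equation`,
`isSol_field`). Rescaled to `g_t`-unit length, the six resulting fields solve ∂ₜY = ∂ᵣ²Y + (ΔY +
κY)/(-2t), with κ = 0 for the axial and the two mixed components, κ = 2 for the trace of the
spherical part and κ = -2 for its two traceless components. The squared fiber norm is a positive
combination F(r, t) of the frame averages of their squares (`fiberL2_eq`).

Part (a). Right invariance of Haar measure gives integration by parts on frames, hence ∂ₜF ≤ ∂ᵣ²F +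
(-t)⁻¹ · Σ w (⟨Y, ΔY⟩ + κ⟨Y, Y⟩). Only the trace has a reaction term of the wrong sign. The
vanishing O(3)-average makes the trace mean-free on every sphere, and the first nonzero eigenvalue 2
of the sphere compensates κ = 2 exactly (`dissipation_nonpos`). So F is a subsolution of the heat
equation on ℝ, and the maximum principle for bounded subsolutions applies
(`le_of_bounded_subsolution`).

Part (b). The pairing of the trace with a coordinate function solves the heat equation on ℝ, because
the eigenvalue -2 balances κ = 2. It is bounded and ancient, hence constant
(`const_of_ancient_solution`). These constants determine the linear function to subtract. The
remaining trace is orthogonal to polynomials of degree at most 1 and has gap 6; the mean-free axial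
component has gap 2, the mixed components have gap 1 (`mixed_gap`), and the traceless ones are
damped by κ = -2. The energy of the difference therefore satisfies ∂ₜF ≤ ∂ᵣ²F - F/|t|. Now F/|t| is
a subsolution of the heat equation which is O(1/|t₀|) at time t₀; letting t₀ → -∞ gives F = 0
(`nonpos_of_ancient_subsolution`).

The eigenvalue estimates need no spectral theorem. On polynomials filtered by degree the spherical
Laplacian is symmetric and triangular with diagonal -N(N + 1), which gives the gap on each
finite-dimensional step (`spectral_gap_of_mem`). Density of polynomials extends it to all functions
needed (`poincare`). -/

noncomputable section
open MeasureTheory Set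

/-! ## Maximum principles for the heat equation on the line -/

namespace HeatEquation

/-- The second derivative at an interior local maximum is non-positive. -/
theorem second_deriv_nonpos_of_isLocalMax {f f' : ℝ → ℝ} {f'' x : ℝ} (hmax : IsLocalMax f x)
    (h1 : ∀ᶠ y in nhds x, HasDerivAt f (f' y) y) (h2 : HasDerivAt f' f'' x) : f'' ≤ 0 := by
  by_contra! hpos
  have hd : deriv f =ᶠ[nhds x] f' := h1.mono fun y hy => hy.deriv
  have hdd : deriv (deriv f) x = f'' := by rw [hd.deriv_eq]; exact h2.deriv
  have h0 : deriv f x = 0 := hmax.deriv_eq_zero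
  -- A positive second derivative would make the point a local minimum as well, so `f` would be
  -- locally constant and the second derivative zero.
  have hmin : IsLocalMin f x :=
    isLocalMin_of_deriv_deriv_pos (by rw [hdd]; exact hpos) h0 h1.self_of_nhds.continuousAt
  have hconst : f =ᶠ[nhds x] fun _ => f x := by
    filter_upwards [hmax, hmin] with y h3 h4 using le_antisymm h3 h4
  have hd0 : deriv f =ᶠ[nhds x] fun _ => 0 := by
    have := hconst.deriv
    simpa using this
  have : deriv (deriv f) x = 0 := by rw [hd0.deriv_eq]; simp
  linarith

/-- The maximum principle on a rectangle for functions with `∂ₜ G < ∂ᵣ² G`. -/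
theorem nonpos_of_strict_subsolution {G Gt Gr Grr : ℝ → ℝ → ℝ} {a b t₀ T : ℝ}
    (hc : ContinuousOn (fun z : ℝ × ℝ => G z.1 z.2) (Icc a b ×ˢ Icc t₀ T))
    (ht : ∀ r ∈ Ioo a b, ∀ t ∈ Ioo t₀ T, HasDerivAt (fun s => G r s) (Gt r t) t)
    (hr : ∀ r ∈ Ioo a b, ∀ t ∈ Ioo t₀ T, HasDerivAt (fun x => G x t) (Gr r t) r)
    (hrr : ∀ r ∈ Ioo a b, ∀ t ∈ Ioo t₀ T, HasDerivAt (fun x => Gr x t) (Grr r t) r)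
    (hlt : ∀ r ∈ Ioo a b, ∀ t ∈ Ioo t₀ T, Gt r t < Grr r t)
    (hbot : ∀ r ∈ Icc a b, G r t₀ ≤ 0)
    (hside : ∀ t ∈ Icc t₀ T, G a t ≤ 0 ∧ G b t ≤ 0) :
    ∀ r ∈ Icc a b, ∀ t ∈ Icc t₀ T, G r t ≤ 0 := by
  -- The derivatives exist only for times before `T`; the value at `T` is recovered by continuity at
  -- the end.
  have key : ∀ r ∈ Icc a b, ∀ t ∈ Ico t₀ T, G r t ≤ 0 := by
    intro r hr' t ht'
    by_contra! hpos
    -- The maximum is taken over times up to `t` only. It may lie on the top face, but `t < T`, so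
    -- the time derivative exists there, and comparison with earlier times makes it nonnegative.
    have hsub : Icc a b ×ˢ Icc t₀ t ⊆ Icc a b ×ˢ Icc t₀ T :=
      prod_mono le_rfl (Icc_subset_Icc_right ht'.2.le)
    obtain ⟨z, hz, hzmax⟩ := (isCompact_Icc.prod isCompact_Icc).exists_isMaxOn
      ⟨(r, t), hr', ⟨ht'.1, le_rfl⟩⟩ (hc.mono hsub)
    obtain ⟨x, u⟩ := z
    obtain ⟨hx, hu⟩ := hz
    have hxu : G r t ≤ G x u := hzmax (show (r, t) ∈ _ from ⟨hr', ⟨ht'.1, le_rfl⟩⟩)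
    have hxupos : 0 < G x u := hpos.trans_le hxu
    simp only at hx hu
    have huT : u < T := hu.2.trans_lt ht'.2
    have hu0 : t₀ < u := by
      rcases hu.1.eq_or_lt with h | h
      · subst h; exact absurd (hbot x hx) (not_le.2 hxupos)
      · exact h
    have hxa : a < x := by
      rcases hx.1.eq_or_lt with h | h
      · subst h; exact absurd (hside u ⟨hu.1, huT.le⟩).1 (not_le.2 hxupos)
      · exact h
    have hxb : x < b := by
      rcases hx.2.eq_or_lt with h | h
      · subst h; exact absurd (hside u ⟨hu.1, huT.le⟩).2 (not_le.2 hxupos)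
      · exact h
    have hxI : x ∈ Ioo a b := ⟨hxa, hxb⟩
    have huI : u ∈ Ioo t₀ T := ⟨hu0, huT⟩
    have hGrr : Grr x u ≤ 0 := by
      refine second_deriv_nonpos_of_isLocalMax (f := fun y => G y u) (f' := fun y => Gr y u) ?_ ?_
        (hrr x hxI u huI)
      · filter_upwards [Ioo_mem_nhds hxa hxb] with y hy
        exact hzmax (show (y, u) ∈ _ from ⟨Ioo_subset_Icc_self hy, hu⟩)
      · filter_upwards [Ioo_mem_nhds hxa hxb] with y hy using hr y hy u huI
    have hGt : 0 ≤ Gt x u := by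
      have h1 := (ht x hxI u huI).hasDerivWithinAt (s := Iio u)
      rw [hasDerivWithinAt_iff_tendsto_slope] at h1
      have h2 : Iio u \ {u} = Iio u := by simp
      rw [h2] at h1
      refine ge_of_tendsto h1 ?_
      filter_upwards [self_mem_nhdsWithin, mem_nhdsWithin_of_mem_nhds (Ioi_mem_nhds hu0)]
        with y hy1 hy2
      rw [slope_def_field]
      have h3 : G x y ≤ G x u :=
        hzmax (show (x, y) ∈ _ from ⟨hx, ⟨le_of_lt hy2, (le_of_lt hy1).trans hu.2⟩⟩)
      exact div_nonneg_of_nonpos (by linarith) (by have : y < u := hy1; linarith)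
    linarith [hlt x hxI u huI]
  intro r hr' t ht'
  rcases ht'.2.lt_or_eq with h | h
  · exact key r hr' t ⟨ht'.1, h⟩
  rcases ht'.1.eq_or_lt with h0 | h0
  · subst h0; exact hbot r hr'
  subst h
  have hct : ContinuousWithinAt (fun s => G r s) (Ico t₀ t) t := by
    have h1 : ContinuousOn (fun s => G r s) (Icc t₀ t) :=
      hc.comp (f := fun s => (r, s)) (by fun_prop) fun s hs => ⟨hr', hs⟩
    exact (h1 t ht').mono Ico_subset_Icc_self
  have hne : (nhdsWithin t (Ico t₀ t)).NeBot := by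
    rw [← mem_closure_iff_nhdsWithin_neBot, closure_Ico h0.ne]
    exact ht'
  exact le_of_tendsto hct (by filter_upwards [self_mem_nhdsWithin] with s hs using key r hr' s hs)

/-- The maximum principle for bounded subsolutions on `ℝ`. -/
theorem le_of_bounded_subsolution {F Ft Fr Frr : ℝ → ℝ → ℝ} {t₀ T C M : ℝ}
    (hc : ContinuousOn (fun z : ℝ × ℝ => F z.1 z.2) (univ ×ˢ Icc t₀ T))
    (ht : ∀ r, ∀ t ∈ Ioo t₀ T, HasDerivAt (fun s => F r s) (Ft r t) t)
    (hr : ∀ r, ∀ t ∈ Ioo t₀ T, HasDerivAt (fun x => F x t) (Fr r t) r)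
    (hrr : ∀ r, ∀ t ∈ Ioo t₀ T, HasDerivAt (fun x => Fr x t) (Frr r t) r)
    (hle : ∀ r, ∀ t ∈ Ioo t₀ T, Ft r t ≤ Frr r t)
    (hC : ∀ r, ∀ t ∈ Icc t₀ T, F r t ≤ C) (hM : ∀ r, F r t₀ ≤ M) :
    ∀ r, ∀ t ∈ Icc t₀ T, F r t ≤ M := by
  intro r t htt
  -- The penalty has time derivative 3ε against second space derivative 2ε, so subtracting it makes
  -- the subsolution strict. At |r| = R it exceeds the gap C - M between the a priori bound and the
  -- initial bound.
  have key : ∀ ε > 0, F r t - M - ε * (r ^ 2 + 3 * (t - t₀)) ≤ 0 := by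
    intro ε hε
    obtain ⟨R, hR⟩ : ∃ R : ℝ, |r| ≤ R ∧ C - M ≤ ε * R ^ 2 := by
      refine ⟨|r| + 1 + |C - M| / ε, ?_, ?_⟩
      · have : 0 ≤ |C - M| / ε := by positivity
        linarith
      · have h1 : 0 ≤ |C - M| / ε := by positivity
        have h2 : ε * (|C - M| / ε) = |C - M| := by field_simp
        have h3 : |C - M| / ε ≤ (|r| + 1 + |C - M| / ε) ^ 2 := by
          nlinarith [abs_nonneg r, mul_nonneg (abs_nonneg r) h1]
        calc C - M ≤ |C - M| := le_abs_self _
          _ = ε * (|C - M| / ε) := h2.symm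
          _ ≤ _ := by gcongr
    refine nonpos_of_strict_subsolution (a := -R) (b := R) (t₀ := t₀) (T := T)
      (G := fun r t => F r t - M - ε * (r ^ 2 + 3 * (t - t₀)))
      (Gt := fun r t => Ft r t - ε * 3) (Gr := fun r t => Fr r t - ε * (2 * r))
      (Grr := fun r t => Frr r t - ε * 2) ?_ ?_ ?_ ?_ ?_ ?_ ?_ r (abs_le.1 hR.1) t htt
    · refine ((hc.mono (prod_mono (subset_univ _) le_rfl)).sub continuousOn_const).sub ?_
      fun_prop
    · intro x _ u hu
      refine ((ht x u hu).sub_const M).sub ?_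
      have h1 : HasDerivAt (fun s : ℝ => x ^ 2 + 3 * (s - t₀)) (3 * 1) u :=
        (((hasDerivAt_id u).sub_const t₀).const_mul 3).const_add _
      simpa using h1.const_mul ε
    · intro x _ u hu
      refine ((hr x u hu).sub_const M).sub ?_
      have h1 : HasDerivAt (fun s : ℝ => s ^ 2 + 3 * (u - t₀)) (2 * x) x := by
        simpa using (hasDerivAt_pow 2 x).add_const (3 * (u - t₀))
      exact h1.const_mul ε
    · intro x _ u hu
      refine (hrr x u hu).sub ?_
      simpa using ((hasDerivAt_id x).const_mul 2).const_mul ε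
    · intro x _ u hu
      have := hle x u hu
      linarith
    · intro x _
      have := hM x
      have h1 : 0 ≤ ε * x ^ 2 := by positivity
      simp only [sub_self, mul_zero, add_zero]
      linarith
    · intro u hu
      have h1 := hC R u hu
      have h2 := hC (-R) u hu
      have h3 : 0 ≤ ε * (u - t₀) := mul_nonneg hε.le (by linarith [hu.1])
      simp only [neg_sq]
      constructor <;> nlinarith [hR.2]
  have h0 : 0 ≤ r ^ 2 + 3 * (t - t₀) := by nlinarith [htt.1, sq_nonneg r]
  refine le_of_forall_pos_le_add fun δ hδ => ?_
  have h1 := key (δ / (r ^ 2 + 3 * (t - t₀) + 1)) (by positivity)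
  have h2 : δ / (r ^ 2 + 3 * (t - t₀) + 1) * (r ^ 2 + 3 * (t - t₀)) ≤ δ := by
    rw [div_mul_eq_mul_div, div_le_iff₀ (by positivity)]
    nlinarith
  linarith

/-- Bounded ancient subsolutions of `∂ₜ F ≤ ∂ᵣ² F - F / |t|` are non-positive. -/
theorem nonpos_of_ancient_subsolution {F Ft Fr Frr : ℝ → ℝ → ℝ} {T C : ℝ} (hT : T ≤ 0)
    (ht : ∀ r, ∀ t < T, HasDerivAt (fun s => F r s) (Ft r t) t)
    (hc : ContinuousOn (fun z : ℝ × ℝ => F z.1 z.2) (univ ×ˢ Iio T))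
    (hr : ∀ r, ∀ t < T, HasDerivAt (fun x => F x t) (Fr r t) r)
    (hrr : ∀ r, ∀ t < T, HasDerivAt (fun x => Fr x t) (Frr r t) r)
    (hle : ∀ r, ∀ t < T, Ft r t ≤ Frr r t - F r t / (-t))
    (hC : ∀ r, ∀ t < T, F r t ≤ C) :
    ∀ r, ∀ t < T, F r t ≤ 0 := by
  intro r t htT
  have ht0 : t < 0 := htT.trans_le hT
  -- Differentiating the factor 1/(-t) produces +F/t², which cancels the damping term, so F/(-t) is
  -- a subsolution of the plain heat equation. Its value at the initial time `t₀` is at most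
  -- |C|/(-t₀).
  have key : ∀ t₀ < t, F r t / (-t) ≤ |C| / (-t₀) := by
    intro t₀ ht₀
    have hneg : ∀ u ∈ Icc t₀ t, 0 < -u := fun u hu => by linarith [hu.2]
    refine le_of_bounded_subsolution (t₀ := t₀) (T := t) (C := |C| / (-t)) (M := |C| / (-t₀))
      (F := fun r t => F r t / (-t)) (Ft := fun r t => (Ft r t * (-t) - F r t * (-1)) / (-t) ^ 2)
      (Fr := fun r t => Fr r t / (-t)) (Frr := fun r t => Frr r t / (-t))
      ?_ ?_ ?_ ?_ ?_ ?_ ?_ r t ⟨ht₀.le, le_rfl⟩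
    · refine ContinuousOn.div (hc.mono (prod_mono le_rfl fun u hu => hu.2.trans_lt htT))
        (by fun_prop) ?_
      rintro ⟨x, u⟩ ⟨_, hu⟩
      exact (hneg u hu).ne'
    · intro x u hu
      exact (ht x u (hu.2.trans htT)).div (hasDerivAt_neg u) (hneg u ⟨hu.1.le, hu.2.le⟩).ne'
    · intro x u hu
      exact (hr x u (hu.2.trans htT)).div_const _
    · intro x u hu
      exact (hrr x u (hu.2.trans htT)).div_const _
    · intro x u hu
      have h1 := hle x u (hu.2.trans htT)
      have h2 := hneg u ⟨hu.1.le, hu.2.le⟩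
      rw [div_le_div_iff₀ (by positivity) h2]
      have h3 : F x u / (-u) * (-u) = F x u := div_mul_cancel₀ _ h2.ne'
      have h4 : Ft x u * (-u) - F x u * (-1) ≤ Frr x u * (-u) := by nlinarith
      nlinarith [mul_le_mul_of_nonneg_right h4 h2.le]
    · intro x u hu
      have h1 := hC x u (hu.2.trans_lt htT)
      have h2 := hneg u hu
      rw [div_le_div_iff₀ h2 (by linarith)]
      nlinarith [le_abs_self C, abs_nonneg C, hu.2]
    · intro x
      have h1 := hC x t₀ (ht₀.trans htT)
      have h2 := hneg t₀ ⟨le_rfl, ht₀.le⟩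
      gcongr
      exact h1.trans (le_abs_self C)
  have hlim : Filter.Tendsto (fun t₀ : ℝ => |C| / (-t₀)) Filter.atBot (nhds 0) :=
    Filter.Tendsto.const_div_atTop Filter.tendsto_neg_atBot_atTop _
  have h1 : F r t / (-t) ≤ 0 :=
    ge_of_tendsto hlim (by filter_upwards [Filter.eventually_lt_atBot t] with u hu using key u hu)
  by_contra! h2
  have : 0 < F r t / (-t) := div_pos h2 (by linarith)
  linarith

/-- Bounded ancient solutions of the heat equation on `ℝ` are antitone in space. -/
theorem antitone_of_ancient_solution {b bt br brr : ℝ → ℝ → ℝ} {T C : ℝ}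
    (hc : ContinuousOn (fun z : ℝ × ℝ => b z.1 z.2) (univ ×ˢ Iio T))
    (ht : ∀ r, ∀ t < T, HasDerivAt (fun s => b r s) (bt r t) t)
    (hr : ∀ r, ∀ t < T, HasDerivAt (fun x => b x t) (br r t) r)
    (hrr : ∀ r, ∀ t < T, HasDerivAt (fun x => br x t) (brr r t) r)
    (heq : ∀ r, ∀ t < T, bt r t = brr r t)
    (hC : ∀ r, ∀ t < T, |b r t| ≤ C) :
    ∀ t < T, ∀ x y, x < y → b y t ≤ b x t := by
  -- Adding 1 makes the bound `K` positive, which the strict inequality for the barrier below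
  -- requires.
  have hC' : ∀ r, ∀ t < T, |b r t| ≤ |C| + 1 := fun r t h =>
    (hC r t h).trans ((le_abs_self C).trans (by linarith))
  set K := |C| + 1 with hK
  have hKpos : 0 < K := by positivity
  -- Reflection at x: the difference b(x + z) - b(x - z) solves the heat equation, vanishes at z = 0
  -- and is at most 2K. The quadratic barrier equals 2K at z = L and has second derivative -4K/L²;
  -- the exponential equals 2K at t₀ and has time derivative at least -2K/L². Hence the sum is a
  -- strict supersolution that dominates the boundary data. Letting t₀ → -∞ and then L → ∞ makes it
  -- vanish.
  have key : ∀ x z : ℝ, 0 < z → ∀ t < T, ∀ L > z, ∀ t₀ < t,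
      b (x + z) t - b (x - z) t
        ≤ 2 * K * (2 * z / L - z ^ 2 / L ^ 2) + 2 * K * Real.exp (-(t - t₀) / L ^ 2) := by
    intro x z hz t htT L hL t₀ ht₀
    have hL0 : 0 < L := hz.trans hL
    have := nonpos_of_strict_subsolution (a := 0) (b := L) (t₀ := t₀) (T := t)
      (G := fun z t => b (x + z) t - b (x - z) t
        - (2 * K * (2 * z / L - z ^ 2 / L ^ 2) + 2 * K * Real.exp (-(t - t₀) / L ^ 2)))
      (Gt := fun z t => bt (x + z) t - bt (x - z) t
        - (2 * K * (Real.exp (-(t - t₀) / L ^ 2) * (-1 / L ^ 2))))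
      (Gr := fun z t => br (x + z) t * 1 - br (x - z) t * (-1)
        - (2 * K * (2 / L - 2 * z / L ^ 2)))
      (Grr := fun z t => brr (x + z) t * 1 * 1 - brr (x - z) t * (-1) * (-1)
        - (2 * K * (- (2 / L ^ 2)))) ?_ ?_ ?_ ?_ ?_ ?_ ?_ z ⟨hz.le, hL.le⟩ t ⟨ht₀.le, le_rfl⟩
    · linarith
    · have hbc : ∀ g : ℝ → ℝ, Continuous g →
          ContinuousOn (fun z : ℝ × ℝ => b (g z.1) z.2) (Icc 0 L ×ˢ Icc t₀ t) := by
        intro g hg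
        refine hc.comp (f := fun z : ℝ × ℝ => (g z.1, z.2)) (by fun_prop) ?_
        rintro ⟨y, u⟩ ⟨_, hu⟩
        exact ⟨mem_univ _, hu.2.trans_lt htT⟩
      refine ((hbc (fun z => x + z) (by fun_prop)).sub (hbc (fun z => x - z) (by fun_prop))).sub ?_
      fun_prop
    · intro y _ u hu
      have hu' := hu.2.trans htT
      refine ((ht (x + y) u hu').sub (ht (x - y) u hu')).sub ?_
      have h1 : HasDerivAt (fun s : ℝ => -(s - t₀) / L ^ 2) (-1 / L ^ 2) u :=
        (((hasDerivAt_id u).sub_const t₀).neg).div_const _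
      exact (h1.exp.const_mul (2 * K)).const_add _
    · intro y _ u hu
      have hu' := hu.2.trans htT
      have e1 : HasDerivAt (fun z => x + z) 1 y := (hasDerivAt_id y).const_add x
      have e2 : HasDerivAt (fun z => x - z) (-1) y := (hasDerivAt_id y).const_sub x
      refine (((hr (x + y) u hu').comp y e1).sub ((hr (x - y) u hu').comp y e2)).sub ?_
      have h1 : HasDerivAt (fun s : ℝ => 2 * s / L - s ^ 2 / L ^ 2) (2 / L - 2 * y / L ^ 2) y := by
        have := (((hasDerivAt_id y).const_mul 2).div_const L).sub
          ((hasDerivAt_pow 2 y).div_const (L ^ 2))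
        exact this.congr_deriv (by simp)
      exact (h1.const_mul (2 * K)).add_const _
    · intro y _ u hu
      have hu' := hu.2.trans htT
      have e1 : HasDerivAt (fun z => x + z) 1 y := (hasDerivAt_id y).const_add x
      have e2 : HasDerivAt (fun z => x - z) (-1) y := (hasDerivAt_id y).const_sub x
      refine ((((hrr (x + y) u hu').comp y e1).mul_const 1).sub
        (((hrr (x - y) u hu').comp y e2).mul_const (-1))).sub ?_
      have h1 : HasDerivAt (fun s : ℝ => 2 / L - 2 * s / L ^ 2) (- (2 / L ^ 2)) y := by
        have := (((hasDerivAt_id y).const_mul 2).div_const (L ^ 2)).const_sub (2 / L)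
        simpa using this
      exact h1.const_mul (2 * K)
    · intro y _ u hu
      have hu' := hu.2.trans htT
      have h1 := heq (x + y) u hu'
      have h2 := heq (x - y) u hu'
      have h3 : Real.exp (-(u - t₀) / L ^ 2) ≤ 1 := by
        rw [Real.exp_le_one_iff]
        apply div_nonpos_of_nonpos_of_nonneg <;> [linarith [hu.1]; positivity]
      rw [h1, h2]
      have h4 : 0 < K / L ^ 2 := by positivity
      have e1 : 2 * K * (Real.exp (-(u - t₀) / L ^ 2) * (-1 / L ^ 2))
          = -(2 * (K / L ^ 2)) * Real.exp (-(u - t₀) / L ^ 2) := by ring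
      have e2 : 2 * K * (- (2 / L ^ 2)) = -(4 * (K / L ^ 2)) := by ring
      rw [e1, e2]
      nlinarith
    · intro y hy
      have h1 := abs_le.1 (hC' (x + y) t₀ (ht₀.trans htT))
      have h2 := abs_le.1 (hC' (x - y) t₀ (ht₀.trans htT))
      have h3 : 0 ≤ 2 * y / L - y ^ 2 / L ^ 2 := by
        have e1 : 2 * y / L - y ^ 2 / L ^ 2 = y * (2 * L - y) / L ^ 2 := by field_simp
        rw [e1]
        exact div_nonneg (mul_nonneg hy.1 (by linarith [hy.2])) (by positivity)
      simp only [sub_self, neg_zero, zero_div, Real.exp_zero]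
      nlinarith [mul_nonneg hKpos.le h3]
    · intro u hu
      have hu' := hu.2.trans_lt htT
      have h1 := abs_le.1 (hC' (x + L) u hu')
      have h2 := abs_le.1 (hC' (x - L) u hu')
      have h3 := (Real.exp_pos (-(u - t₀) / L ^ 2)).le
      constructor
      · simp only [add_zero, sub_zero, sub_self, mul_zero, zero_div, zero_sub]
        simp only [ne_eq, OfNat.ofNat_ne_zero, not_false_eq_true, zero_pow, zero_div,
          neg_nonpos]
        positivity
      · have e1 : 2 * L / L - L ^ 2 / L ^ 2 = 1 := by field_simp; norm_num
        simp only [e1]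
        nlinarith [mul_nonneg hKpos.le h3]
  have key2 : ∀ x z : ℝ, 0 < z → ∀ t < T, b (x + z) t ≤ b (x - z) t := by
    intro x z hz t htT
    have h1 : ∀ L > z, b (x + z) t - b (x - z) t ≤ 2 * K * (2 * z / L - z ^ 2 / L ^ 2) := by
      intro L hL
      have hlim : Filter.Tendsto (fun t₀ : ℝ => 2 * K * (2 * z / L - z ^ 2 / L ^ 2)
          + 2 * K * Real.exp (-(t - t₀) / L ^ 2)) Filter.atBot
          (nhds (2 * K * (2 * z / L - z ^ 2 / L ^ 2) + 2 * K * 0)) := by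
        refine tendsto_const_nhds.add (Filter.Tendsto.const_mul _ ?_)
        refine Real.tendsto_exp_atBot.comp ?_
        refine Filter.Tendsto.atBot_div_const (by have := hz.trans hL; positivity) ?_
        simp only [neg_sub]
        exact Filter.tendsto_atBot_add_const_right _ _ Filter.tendsto_id
      have := ge_of_tendsto hlim (by
        filter_upwards [Filter.eventually_lt_atBot t] with u hu using key x z hz t htT L hL u hu)
      simpa using this
    have hlim : Filter.Tendsto (fun L : ℝ => 2 * K * (2 * z / L - z ^ 2 / L ^ 2)) Filter.atTop
        (nhds (2 * K * (0 - 0))) := by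
      refine Filter.Tendsto.const_mul _ (Filter.Tendsto.sub ?_ ?_)
      · exact Filter.Tendsto.const_div_atTop Filter.tendsto_id _
      · exact Filter.Tendsto.const_div_atTop (Filter.tendsto_pow_atTop (by norm_num)) _
    have := ge_of_tendsto hlim (by
      filter_upwards [Filter.eventually_gt_atTop z] with u hu using h1 u hu)
    linarith
  intro t htT x y hxy
  have := key2 ((x + y) / 2) ((y - x) / 2) (by linarith) t htT
  rwa [show (x + y) / 2 + (y - x) / 2 = y by ring,
    show (x + y) / 2 - (y - x) / 2 = x by ring] at this

/-- Bounded ancient solutions of the heat equation on `ℝ` are constant. -/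
theorem const_of_ancient_solution {b bt br brr : ℝ → ℝ → ℝ} {T C : ℝ}
    (hc : ContinuousOn (fun z : ℝ × ℝ => b z.1 z.2) (univ ×ˢ Iio T))
    (ht : ∀ r, ∀ t < T, HasDerivAt (fun s => b r s) (bt r t) t)
    (hr : ∀ r, ∀ t < T, HasDerivAt (fun x => b x t) (br r t) r)
    (hrr : ∀ r, ∀ t < T, HasDerivAt (fun x => br x t) (brr r t) r)
    (heq : ∀ r, ∀ t < T, bt r t = brr r t)
    (hC : ∀ r, ∀ t < T, |b r t| ≤ C) :
    ∃ a, ∀ r, ∀ t < T, b r t = a := by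
  have h1 := antitone_of_ancient_solution hc ht hr hrr heq hC
  have h2 := antitone_of_ancient_solution (b := fun r t => -b r t) hc.neg
    (fun r t h => (ht r t h).neg) (fun r t h => (hr r t h).neg) (fun r t h => (hrr r t h).neg)
    (fun r t h => by rw [heq r t h]) (fun r t h => by rw [abs_neg]; exact hC r t h)
  have h3 : ∀ t < T, ∀ x y, b x t = b y t := by
    intro t htT x y
    rcases lt_trichotomy x y with h | h | h
    · exact le_antisymm (neg_le_neg_iff.1 (h2 t htT x y h)) (h1 t htT x y h)
    · rw [h]
    · exact le_antisymm (h1 t htT y x h) (neg_le_neg_iff.1 (h2 t htT y x h))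
  have hbr : ∀ t < T, ∀ x, br x t = 0 := by
    intro t htT x
    have e : (fun y => b y t) = fun _ => b x t := funext fun y => h3 t htT y x
    have := hr x t htT
    rw [e] at this
    exact this.unique (hasDerivAt_const _ _)
  have hbt : ∀ t < T, ∀ x, bt x t = 0 := by
    intro t htT x
    rw [heq x t htT]
    have e : (fun y => br y t) = fun _ => 0 := funext fun y => hbr t htT y
    have := hrr x t htT
    rw [e] at this
    exact this.unique (hasDerivAt_const _ _)
  refine ⟨b 0 (T - 1), fun r t htT => ?_⟩
  rw [h3 t htT r 0]
  refine isOpen_Iio.is_const_of_deriv_eq_zero (s := Iio T) (f := fun s => b 0 s)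
    isPreconnected_Iio (fun s hs => (ht 0 s hs).differentiableAt.differentiableWithinAt)
    (fun s hs => ?_) htT (by simp : T - 1 ∈ Iio T)
  rw [(ht 0 s hs).deriv, hbt s hs]
  rfl

end HeatEquation
end

noncomputable section
open MeasureTheory Set

/-! ## A spectral gap from a triangular filtration -/

section SpectralGap

variable {E M : Type*} [NormedAddCommGroup E] [InnerProductSpace ℝ E] [AddCommGroup M] [Module ℝ M]

/-- Orthogonal projection to the image of a finite dimensional subspace. -/
theorem exists_orthogonal_projection (ι : M →ₗ[ℝ] E) (P : Submodule ℝ M) [FiniteDimensional ℝ P]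
    (u : E) : ∃ p ∈ P, (∀ q ∈ P, inner ℝ (u - ι p) (ι q) = 0) ∧
      ∀ q ∈ P, ‖u - ι p‖ ≤ ‖u - ι q‖ := by
  have hfin : FiniteDimensional ℝ (P.map ι) := inferInstance
  set K := P.map ι with hK
  obtain ⟨p, hp, hpe⟩ : ∃ p ∈ P, ι p = K.starProjection u :=
    Submodule.mem_map.1 (Submodule.starProjection_apply_mem K u)
  have horth : ∀ q ∈ P, inner ℝ (u - ι p) (ι q) = 0 := by
    intro q hq
    rw [hpe]
    exact Submodule.starProjection_inner_eq_zero u (ι q) (Submodule.mem_map_of_mem hq)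
  refine ⟨p, hp, horth, fun q hq => ?_⟩
  have h1 : inner ℝ (u - ι p) (ι p - ι q) = 0 := by
    rw [← map_sub]
    exact horth _ (P.sub_mem hp hq)
  have h2 : ‖u - ι q‖ ^ 2 = ‖u - ι p‖ ^ 2 + ‖ι p - ι q‖ ^ 2 := by
    rw [show u - ι q = (u - ι p) + (ι p - ι q) by abel, norm_add_sq_real, h1]
    ring
  exact le_of_sq_le_sq (by nlinarith [sq_nonneg ‖ι p - ι q‖]) (norm_nonneg _)

variable (ι : M →ₗ[ℝ] E) (D : M →ₗ[ℝ] M) (P : ℕ → Submodule ℝ M) (lam : ℕ → ℝ)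

/-- The spectral gap on the filtration. -/
theorem spectral_gap_of_mem [∀ N, FiniteDimensional ℝ (P N)] (hmono : Monotone P)
    (hlam : Monotone lam) (hD0 : ∀ p ∈ P 0, D p = -lam 0 • p)
    (hD : ∀ N, ∀ p ∈ P (N + 1), D p + lam (N + 1) • p ∈ P N)
    (hsymm : ∀ p q, inner ℝ (ι (D p)) (ι q) = inner ℝ (ι p) (ι (D q)))
    (k : ℕ) (N : ℕ) : ∀ p ∈ P N, (∀ j < k, ∀ q ∈ P j, inner ℝ (ι p) (ι q) = 0) →
      lam k * ‖ι p‖ ^ 2 ≤ -inner ℝ (ι (D p)) (ι p) := by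
  have hDP : ∀ N, ∀ p ∈ P N, D p ∈ P N := by
    intro N p hp
    rcases N with _ | N
    · rw [hD0 p hp]; exact (P 0).smul_mem _ hp
    · have h1 := hmono (Nat.le_succ N) (hD N p hp)
      have h2 := (P (N + 1)).sub_mem h1 ((P (N + 1)).smul_mem (lam (N + 1)) hp)
      simpa using h2
  -- Below level `k` the hypothesis makes `ι p` orthogonal to itself.
  have htriv : ∀ N < k, ∀ p ∈ P N, (∀ j < k, ∀ q ∈ P j, inner ℝ (ι p) (ι q) = 0) →
      lam k * ‖ι p‖ ^ 2 ≤ -inner ℝ (ι (D p)) (ι p) := by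
    intro N hN p hp h
    have h0 : ι p = 0 := inner_self_eq_zero.1 (h N hN p hp)
    simp [h0]
  induction N with
  | zero =>
    intro p hp h
    rcases Nat.eq_zero_or_pos k with rfl | hk
    · rw [hD0 p hp, map_smul, inner_smul_left, real_inner_self_eq_norm_sq]
      simp
    · exact htriv 0 hk p hp h
  | succ N ih =>
    intro p hp h
    rcases lt_or_ge (N + 1) k with hk | hk
    · exact htriv _ hk p hp h
    -- Write p = w + q with `ι w` orthogonal to the image of `P N`. Modulo `P N` the operator acts
    -- on w as the scalar -lam (N + 1), and by symmetry the cross terms vanish, so the quadratic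
    -- form splits.
    obtain ⟨q, hq, hort, -⟩ := exists_orthogonal_projection ι (P N) (ι p)
    set w := p - q with hw
    have hwP : w ∈ P (N + 1) := (P _).sub_mem hp (hmono (Nat.le_succ N) hq)
    have hort' : ∀ x ∈ P N, inner ℝ (ι w) (ι x) = 0 := by
      intro x hx; rw [hw, map_sub]; exact hort x hx
    have hpw : p = w + q := by simp [hw]
    have hq2 : lam k * ‖ι q‖ ^ 2 ≤ -inner ℝ (ι (D q)) (ι q) := by
      refine ih q hq fun j hj x hx => ?_
      have h1 := h j hj x hx
      have h2 := hort' x (hmono (by omega) hx)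
      rw [hpw, map_add, inner_add_left, h2, zero_add] at h1
      exact h1
    have hww : inner ℝ (ι (D w)) (ι w) = -(lam (N + 1) * ‖ι w‖ ^ 2) := by
      have h1 : D w = (D w + lam (N + 1) • w) - lam (N + 1) • w := by abel
      have h2 := hort' _ (hD N w hwP)
      rw [h1, map_sub, inner_sub_left, real_inner_comm, h2, map_smul, inner_smul_left,
        real_inner_self_eq_norm_sq]
      simp
    have h3 : inner ℝ (ι (D w)) (ι q) = 0 := by rw [hsymm]; exact hort' _ (hDP N q hq)
    have h4 : inner ℝ (ι (D q)) (ι w) = 0 := by rw [real_inner_comm]; exact hort' _ (hDP N q hq)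
    have h5 : ‖ι p‖ ^ 2 = ‖ι w‖ ^ 2 + ‖ι q‖ ^ 2 := by
      rw [hpw, map_add, norm_add_sq_real, hort' q hq]; ring
    have h6 : inner ℝ (ι (D p)) (ι p) = inner ℝ (ι (D w)) (ι w) + inner ℝ (ι (D q)) (ι q) := by
      rw [hpw]
      simp only [map_add, inner_add_left, inner_add_right]
      rw [h3, h4]; ring
    rw [h5, h6, hww]
    have h7 := mul_le_mul_of_nonneg_right (hlam hk) (sq_nonneg ‖ι w‖)
    linarith

/-- The spectral gap for elements of the closure. -/
theorem spectral_gap_of_mem_closure [∀ N, FiniteDimensional ℝ (P N)] (hmono : Monotone P)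
    (hexh : ∀ p, ∃ N, p ∈ P N)
    (hlam : Monotone lam) (hD0 : ∀ p ∈ P 0, D p = -lam 0 • p)
    (hD : ∀ N, ∀ p ∈ P (N + 1), D p + lam (N + 1) • p ∈ P N)
    (hsymm : ∀ p q, inner ℝ (ι (D p)) (ι q) = inner ℝ (ι p) (ι (D q)))
    (k : ℕ) {u v : E} (hu : u ∈ closure (range ι))
    (hv : ∀ p, inner ℝ v (ι p) = inner ℝ u (ι (D p)))
    (hk : ∀ j < k, ∀ q ∈ P j, inner ℝ u (ι q) = 0) :
    lam k * ‖u‖ ^ 2 ≤ -inner ℝ v u := by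
  have hDP : ∀ N, ∀ p ∈ P N, D p ∈ P N := by
    intro N p hp
    rcases N with _ | N
    · rw [hD0 p hp]; exact (P 0).smul_mem _ hp
    · have h1 := hmono (Nat.le_succ N) (hD N p hp)
      have h2 := (P (N + 1)).sub_mem h1 ((P (N + 1)).smul_mem (lam (N + 1)) hp)
      simpa using h2
  set S : Set E := {x | lam k * ‖x‖ ^ 2 ≤ -inner ℝ v x} with hS
  have hclosed : IsClosed S := isClosed_le (by fun_prop) (by fun_prop)
  suffices u ∈ closure S by rwa [hclosed.closure_eq] at this
  rw [Metric.mem_closure_iff] at hu ⊢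
  intro ε hε
  obtain ⟨_, ⟨p, rfl⟩, hp⟩ := hu ε hε
  obtain ⟨N₀, hN₀⟩ := hexh p
  obtain ⟨N, hpN, hkN⟩ : ∃ N, p ∈ P N ∧ k ≤ N :=
    ⟨max N₀ k, hmono (le_max_left _ _) hN₀, le_max_right _ _⟩
  -- The approximant `p` need not satisfy the orthogonality conditions. The projection of u to `P N`
  -- does, since k ≤ N, and it is at least as close to u.
  obtain ⟨q, hq, hort, hmin⟩ := exists_orthogonal_projection ι (P N) u
  refine ⟨ι q, ?_, ?_⟩
  · have hin : ∀ x ∈ P N, inner ℝ u (ι x) = inner ℝ (ι q) (ι x) := by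
      intro x hx
      have := hort x hx
      rw [inner_sub_left] at this
      linarith
    have h1 := spectral_gap_of_mem ι D P lam hmono hlam hD0 hD hsymm k N q hq fun j hj x hx => by
      rw [← hin x (hmono (by omega) hx)]; exact hk j hj x hx
    show lam k * ‖ι q‖ ^ 2 ≤ -inner ℝ v (ι q)
    rw [hv, hin _ (hDP N q hq), ← hsymm]
    exact h1
  · rw [dist_eq_norm] at hp ⊢
    exact (hmin p hpN).trans_lt hp

end SpectralGap

/-! ## The spherical Laplacian on polynomials -/

namespace SpherePoly

open MvPolynomial

/-- Polynomials in three variables. -/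
abbrev Poly : Type := MvPolynomial (Fin 3) ℝ

/-- The Euler operator. -/
def euler : Poly →ₗ[ℝ] Poly :=
  ∑ i, (LinearMap.mulLeft ℝ (X i : Poly)) ∘ₗ (pderiv i : Derivation ℝ Poly Poly).toLinearMap

/-- The Laplacian of `ℝ³`. -/
def flatLaplacian : Poly →ₗ[ℝ] Poly :=
  ∑ i, (pderiv i : Derivation ℝ Poly Poly).toLinearMap ∘ₗ
    (pderiv i : Derivation ℝ Poly Poly).toLinearMap

/-- The operator which induces the Laplacian of the unit sphere on restrictions. -/
def sphereLaplacian : Poly →ₗ[ℝ] Poly := flatLaplacian - euler ∘ₗ euler - euler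

theorem euler_apply (p : Poly) : euler p = ∑ i, X i * pderiv i p := by
  simp [euler, LinearMap.sum_apply]

theorem flatLaplacian_apply (p : Poly) : flatLaplacian p = ∑ i, pderiv i (pderiv i p) := by
  simp [flatLaplacian, LinearMap.sum_apply]

theorem euler_of_isHomogeneous {p : Poly} {n : ℕ} (hp : p.IsHomogeneous n) :
    euler p = (n : ℝ) • p := by
  rw [euler_apply, hp.sum_X_mul_pderiv]
  rw [Nat.cast_smul_eq_nsmul]

/-- In polar coordinates |x|²Δ is the spherical Laplacian plus E² + E, where E is the Euler
operator, and E acts as n on degree n. -/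
theorem sphereLaplacian_of_isHomogeneous {p : Poly} {n : ℕ} (hp : p.IsHomogeneous n) :
    sphereLaplacian p = flatLaplacian p - ((n : ℝ) * (n + 1)) • p := by
  have h1 : sphereLaplacian p = flatLaplacian p - euler (euler p) - euler p := rfl
  rw [h1, euler_of_isHomogeneous hp, map_smul, euler_of_isHomogeneous hp, smul_smul, sub_sub,
    ← add_smul]
  congr 2
  ring

/-- Polynomials of degree at most `N`. -/
abbrev degLE (N : ℕ) : Submodule ℝ Poly := restrictTotalDegree (Fin 3) ℝ N

theorem degLE_mono : Monotone degLE := by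
  intro a b hab p hp
  rw [mem_restrictTotalDegree] at hp ⊢
  exact hp.trans hab

/-- The truncated subtraction is harmless: for n ≤ 1 the Laplacian vanishes. -/
theorem flatLaplacian_mem {p : Poly} {n : ℕ} (hp : p.IsHomogeneous n) :
    flatLaplacian p ∈ degLE (n - 1 - 1) := by
  rw [flatLaplacian_apply]
  refine Submodule.sum_mem _ fun i _ => ?_
  rw [mem_restrictTotalDegree]
  exact (hp.pderiv.pderiv).totalDegree_le

/-- The operator is triangular for the degree filtration: on the top homogeneous component it is the
scalar -(N + 1)(N + 2) up to the flat Laplacian, which lowers the degree. This replaces the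
decomposition into spherical harmonics. -/
theorem sphereLaplacian_add_mem (N : ℕ) (p : Poly) (hp : p ∈ degLE (N + 1)) :
    sphereLaplacian p + (((N + 1 : ℕ) : ℝ) * ((N + 1 : ℕ) + 1)) • p ∈ degLE N := by
  rw [mem_restrictTotalDegree] at hp
  set l : ℝ := ((N + 1 : ℕ) : ℝ) * ((N + 1 : ℕ) + 1) with hl
  have h1 : sphereLaplacian p + l • p
      = ∑ i ∈ Finset.range (p.totalDegree + 1),
        (sphereLaplacian (homogeneousComponent i p) + l • homogeneousComponent i p) := by
    rw [Finset.sum_add_distrib, ← map_sum, ← Finset.smul_sum, sum_homogeneousComponent]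
  rw [h1]
  refine Submodule.sum_mem _ fun i hi => ?_
  have hi' : i ≤ N + 1 := by rw [Finset.mem_range] at hi; omega
  have hh := homogeneousComponent_isHomogeneous i p
  rw [sphereLaplacian_of_isHomogeneous hh]
  rcases hi'.lt_or_eq with h | h
  · have h2 : homogeneousComponent i p ∈ degLE N := by
      rw [mem_restrictTotalDegree]
      exact hh.totalDegree_le.trans (by omega)
    refine Submodule.add_mem _ (Submodule.sub_mem _ ?_ (Submodule.smul_mem _ _ h2))
      (Submodule.smul_mem _ _ h2)
    exact degLE_mono (by omega) (flatLaplacian_mem hh)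
  · subst h
    rw [← hl, sub_add_cancel]
    exact degLE_mono (by omega) (flatLaplacian_mem hh)

theorem sphereLaplacian_of_mem_degLE_zero (p : Poly) (hp : p ∈ degLE 0) :
    sphereLaplacian p = 0 := by
  rw [mem_restrictTotalDegree, Nat.le_zero, totalDegree_eq_zero_iff_eq_C] at hp
  rw [hp]
  simp [sphereLaplacian, euler_apply, flatLaplacian_apply]

/-- Restriction of a polynomial to a point of `ℝ³`. -/
def ev (p : Poly) (x : RoundCylinder.R3) : ℝ := eval (fun i => x i) p

theorem hasFDerivAt_ev (p : Poly) (x : RoundCylinder.R3) :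
    HasFDerivAt (ev p) (∑ i, ev (pderiv i p) x • EuclideanSpace.proj (𝕜 := ℝ) i) x := by
  induction p using MvPolynomial.induction_on with
  | C a =>
    have : ev (C a) = fun _ => a := by ext y; simp [ev]
    rw [this]
    simpa [ev] using hasFDerivAt_const a x
  | add p q hp hq =>
    have : ev (p + q) = fun y => ev p y + ev q y := by ext y; simp [ev]
    rw [this]
    refine (hp.add hq).congr_fderiv ?_
    rw [← Finset.sum_add_distrib]
    refine Finset.sum_congr rfl fun i _ => ?_
    rw [← add_smul]
    simp [ev]
  | mul_X p j hp =>
    have : ev (p * X j) = fun y => ev p y * y j := by ext y; simp [ev]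
    rw [this]
    have h2 : HasFDerivAt (fun y : RoundCylinder.R3 => y j) (EuclideanSpace.proj (𝕜 := ℝ) j) x :=
      (EuclideanSpace.proj (𝕜 := ℝ) j).hasFDerivAt
    refine (hp.mul h2).congr_fderiv ?_
    have h3 : ∀ i, ev (pderiv i (p * X j)) x
        = x j * ev (pderiv i p) x + ev p x * (if i = j then 1 else 0) := by
      intro i
      simp only [ev, pderiv_mul, pderiv_X, map_add, map_mul, eval_X]
      rcases eq_or_ne i j with rfl | h
      · simp; ring
      · simp [h, h.symm]; ring
    simp only [h3, add_smul, Finset.sum_add_distrib, Finset.smul_sum, smul_smul]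
    rw [add_comm]
    congr 1
    simp

theorem contDiff_ev (p : Poly) {n : WithTop ℕ∞} : ContDiff ℝ n (ev p) := by
  induction p using MvPolynomial.induction_on with
  | C a =>
    have : ev (C a) = fun _ => a := by ext y; simp [ev]
    rw [this]; exact contDiff_const
  | add p q hp hq =>
    have : ev (p + q) = fun y => ev p y + ev q y := by ext y; simp [ev]
    rw [this]; exact hp.add hq
  | mul_X p j hp =>
    have : ev (p * X j) = fun y => ev p y * y j := by ext y; simp [ev]
    rw [this]; exact hp.mul (EuclideanSpace.proj (𝕜 := ℝ) j).contDiff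

/-- `sphereLaplacian` is the trace of the Hessian on a tangent plane minus twice the normal
derivative. -/
theorem ev_sphereLaplacian (p : Poly) (x a b : RoundCylinder.R3)
    (hon : ∀ i j, a i * a j + b i * b j + x i * x j = if i = j then 1 else 0) :
    ev (sphereLaplacian p) x
      = ∑ i, ∑ j, ev (pderiv j (pderiv i p)) x * (a i * a j + b i * b j)
        - 2 * ∑ i, ev (pderiv i p) x * x i := by
  have h1 : ∀ i j, a i * a j + b i * b j = (if i = j then 1 else 0) - x i * x j :=
    fun i j => by linarith [hon i j]
  simp only [h1]
  simp only [sphereLaplacian, LinearMap.sub_apply, LinearMap.comp_apply, euler_apply,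
    flatLaplacian_apply, ev, map_sub, map_sum, map_mul, eval_X, pderiv_mul, pderiv_X, map_add]
  simp only [Fin.sum_univ_three]
  simp
  ring

end SpherePoly
end

noncomputable section
open MeasureTheory Set

/-! ## Integration over the orthogonal group -/

section Parametric

variable {K : Type*} [TopologicalSpace K] [CompactSpace K] [MeasurableSpace K] [BorelSpace K]
  (μ : Measure K) [IsFiniteMeasure μ]

theorem integrable_of_continuous_compact {f : K → ℝ} (hf : Continuous f) : Integrable f μ :=
  hf.integrable_of_hasCompactSupport (HasCompactSupport.of_compactSpace f)

/-- Differentiation under the integral sign over a compact space. -/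
theorem hasDerivAt_integral_of_compact {f f' : K → ℝ → ℝ} {x₀ : ℝ} {s : Set ℝ} (hs : s ∈ nhds x₀)
    (hf : ∀ x ∈ s, Continuous fun a => f a x)
    (hf' : ContinuousOn (fun z : K × ℝ => f' z.1 z.2) (univ ×ˢ s))
    (hd : ∀ a, ∀ x ∈ s, HasDerivAt (f a) (f' a x) x) :
    HasDerivAt (fun x => ∫ a, f a x ∂μ) (∫ a, f' a x₀ ∂μ) x₀ := by
  obtain ⟨ε, hε, hεs⟩ := Metric.nhds_basis_closedBall.mem_iff.1 hs
  have hcomp : IsCompact ((univ : Set K) ×ˢ Metric.closedBall x₀ ε) :=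
    isCompact_univ.prod (isCompact_closedBall x₀ ε)
  have hmono : (univ : Set K) ×ˢ Metric.closedBall x₀ ε ⊆ univ ×ˢ s := prod_mono le_rfl hεs
  obtain ⟨B, hB⟩ := (hcomp.image_of_continuousOn (hf'.mono hmono)).isBounded.exists_norm_le
  have hx₀ : x₀ ∈ s := mem_of_mem_nhds hs
  refine (hasDerivAt_integral_of_dominated_loc_of_deriv_le (F := fun x a => f a x)
    (F' := fun x a => f' a x) (bound := fun _ => B) (Metric.closedBall_mem_nhds x₀ hε) ?_ ?_ ?_ ?_
    (integrable_const B) ?_).2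
  · filter_upwards [hs] with x hx using (hf x hx).aestronglyMeasurable
  · exact integrable_of_continuous_compact μ (hf x₀ hx₀)
  · have : Continuous fun a => f' a x₀ := by
      rw [← continuousOn_univ]
      exact hf'.comp (f := fun a => (a, x₀)) (by fun_prop) fun a _ => ⟨mem_univ _, hx₀⟩
    exact this.aestronglyMeasurable
  · refine Filter.Eventually.of_forall fun a x hx => ?_
    exact hB _ ⟨(a, x), ⟨mem_univ _, hx⟩, rfl⟩
  · exact Filter.Eventually.of_forall fun a x hx => hd a x (hεs hx)

theorem continuousOn_integral_of_compact {Z : Type*} [TopologicalSpace Z] {f : K → Z → ℝ}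
    {s : Set Z} (hf : ContinuousOn (fun z : K × Z => f z.1 z.2) (univ ×ˢ s)) :
    ContinuousOn (fun z => ∫ a, f a z ∂μ) s := by
  refine continuousOn_integral_of_compact_support (f := fun z a => f a z) isCompact_univ ?_ ?_
  · exact hf.comp (f := fun p : Z × K => (p.2, p.1)) (by fun_prop) fun p hp => ⟨mem_univ _, hp.1⟩
  · intro p x _ hx
    exact absurd (mem_univ x) hx

end Parametric

namespace RoundCylinder

instance : IsProbabilityMeasure haarO3 :=
  ⟨by simpa [haarO3] using Measure.haarMeasure_self (K₀ := (⊤ : TopologicalSpace.PositiveCompacts O3))⟩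

instance : haarO3.IsHaarMeasure := by unfold haarO3; infer_instance

/-- A right translate of the Haar probability measure is again a Haar probability measure, so it
equals the original by uniqueness. -/
instance : haarO3.IsMulRightInvariant where
  map_mul_right_eq_self g := by
    have : IsProbabilityMeasure (haarO3.map (· * g)) :=
      Measure.isProbabilityMeasure_map (continuous_mul_const g).measurable.aemeasurable
    have : (haarO3.map (· * g)).IsMulLeftInvariant := by infer_instance
    have : (haarO3.map (· * g)).IsHaarMeasure :=
      Measure.isHaarMeasure_map_mul_right haarO3 g
    exact Measure.isHaarMeasure_eq_of_isProbabilityMeasure _ _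

/-! ## Frames -/

/-- Triples of vectors of `ℝ³`; for an orthonormal frame `c`, the base point is `c.2.2` and
`c.1`, `c.2.1` span the tangent plane of the sphere there. -/
abbrev Fr : Type := R3 × R3 × R3

/-- Frames together with the coordinate on `ℝ` and time. -/
abbrev St : Type := Fr × ℝ × ℝ

/-- The `i`-th column of an orthogonal matrix. -/
def colVec (A : O3) (i : Fin 3) : R3 := WithLp.toLp 2 fun k => A.1 k i

/-- The frame of columns of an orthogonal matrix. -/
def cols (A : O3) : Fr := (colVec A 0, colVec A 1, colVec A 2)

theorem continuous_colVec (i : Fin 3) : Continuous fun A : O3 => colVec A i := by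
  unfold colVec
  refine (PiLp.continuous_toLp 2 _).comp (continuous_pi fun k => ?_)
  exact (continuous_subtype_val.matrix_elem k i)

theorem continuous_cols : Continuous cols :=
  (continuous_colVec 0).prodMk ((continuous_colVec 1).prodMk (continuous_colVec 2))

theorem toEuclideanLin_single (A : O3) (i : Fin 3) :
    Matrix.toEuclideanLin A.1 (EuclideanSpace.single i 1) = colVec A i := by
  ext k
  simp [colVec, Matrix.toLpLin_apply, Matrix.mulVec_single]

theorem inner_colVec (A : O3) (i j : Fin 3) :
    inner ℝ (colVec A i) (colVec A j) = (if i = j then 1 else 0 : ℝ) := by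
  have h : star A.1 * A.1 = 1 := (Unitary.mem_iff.1 A.2).1
  have h1 := congrFun (congrFun h i) j
  rw [Matrix.mul_apply, Matrix.one_apply] at h1
  rw [← h1]
  simp [colVec, PiLp.inner_apply, Matrix.star_apply, mul_comm]

theorem norm_colVec (A : O3) (i : Fin 3) : ‖colVec A i‖ = 1 := by
  have := inner_colVec A i i
  rw [real_inner_self_eq_norm_sq] at this
  simp only [if_true] at this
  nlinarith [norm_nonneg (colVec A i)]

theorem colVec_ne_zero (A : O3) (i : Fin 3) : colVec A i ≠ 0 := by
  intro h
  have := norm_colVec A i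
  rw [h] at this
  simp at this

theorem sum_colVec_mul (A : O3) (i j : Fin 3) :
    colVec A 0 i * colVec A 0 j + colVec A 1 i * colVec A 1 j + colVec A 2 i * colVec A 2 j
      = if i = j then 1 else 0 := by
  have h : A.1 * star A.1 = 1 := (Unitary.mem_iff.1 A.2).2
  have h1 := congrFun (congrFun h i) j
  rw [Matrix.mul_apply, Matrix.one_apply] at h1
  rw [← h1]
  simp [colVec, Fin.sum_univ_three, Matrix.star_apply]

/-- The infinitesimal rotations of frames. -/
def xi : Fin 3 → Fr →L[ℝ] Fr
  | 0 => (-(ContinuousLinearMap.snd ℝ R3 R3 ∘L ContinuousLinearMap.snd ℝ R3 (R3 × R3))).prod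
      ((0 : Fr →L[ℝ] R3).prod (ContinuousLinearMap.fst ℝ R3 (R3 × R3)))
  | 1 => (0 : Fr →L[ℝ] R3).prod
      ((-(ContinuousLinearMap.snd ℝ R3 R3 ∘L ContinuousLinearMap.snd ℝ R3 (R3 × R3))).prod
      (ContinuousLinearMap.fst ℝ R3 R3 ∘L ContinuousLinearMap.snd ℝ R3 (R3 × R3)))
  | 2 => (ContinuousLinearMap.fst ℝ R3 R3 ∘L ContinuousLinearMap.snd ℝ R3 (R3 × R3)).prod
      ((-(ContinuousLinearMap.fst ℝ R3 (R3 × R3))).prod (0 : Fr →L[ℝ] R3))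

@[simp] theorem xi_zero (c : Fr) : xi 0 c = (-c.2.2, 0, c.1) := rfl
@[simp] theorem xi_one (c : Fr) : xi 1 c = (0, -c.2.2, c.2.1) := rfl
@[simp] theorem xi_two (c : Fr) : xi 2 c = (c.2.1, -c.1, 0) := rfl

/-- The rotations of frames generated by `xi`. -/
def flow (k : Fin 3) (θ : ℝ) (c : Fr) : Fr :=
  match k with
  | 0 => (Real.cos θ • c.1 - Real.sin θ • c.2.2, c.2.1, Real.cos θ • c.2.2 + Real.sin θ • c.1)
  | 1 => (c.1, Real.cos θ • c.2.1 - Real.sin θ • c.2.2, Real.cos θ • c.2.2 + Real.sin θ • c.2.1)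
  | 2 => (Real.cos θ • c.1 + Real.sin θ • c.2.1, Real.cos θ • c.2.1 - Real.sin θ • c.1, c.2.2)

theorem flow_zero (k : Fin 3) (c : Fr) : flow k 0 c = c := by
  fin_cases k <;> simp [flow]

theorem hasDerivAt_cos_smul (θ : ℝ) (v : R3) :
    HasDerivAt (fun t => Real.cos t • v) (-Real.sin θ • v) θ :=
  (Real.hasDerivAt_cos θ).smul_const v

theorem hasDerivAt_sin_smul (θ : ℝ) (v : R3) :
    HasDerivAt (fun t => Real.sin t • v) (Real.cos θ • v) θ :=
  (Real.hasDerivAt_sin θ).smul_const v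

theorem hasDerivAt_flow (k : Fin 3) (θ : ℝ) (c : Fr) :
    HasDerivAt (fun t => flow k t c) (xi k (flow k θ c)) θ := by
  have hc := hasDerivAt_cos_smul θ
  have hs := hasDerivAt_sin_smul θ
  match k with
  | 0 =>
    refine (((hc c.1).sub (hs c.2.2)).prodMk ((hasDerivAt_const θ c.2.1).prodMk
      ((hc c.2.2).add (hs c.1)))).congr_deriv ?_
    simp only [xi_zero, flow, Prod.mk.injEq, neg_smul, true_and]
    constructor <;> abel
  | 1 =>
    refine ((hasDerivAt_const θ c.1).prodMk (((hc c.2.1).sub (hs c.2.2)).prodMk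
      ((hc c.2.2).add (hs c.2.1)))).congr_deriv ?_
    simp only [xi_one, flow, Prod.mk.injEq, neg_smul, true_and]
    constructor <;> abel
  | 2 =>
    refine (((hc c.1).add (hs c.2.1)).prodMk (((hc c.2.1).sub (hs c.1)).prodMk
      (hasDerivAt_const θ c.2.2))).congr_deriv ?_
    simp only [xi_two, flow, Prod.mk.injEq, neg_smul, and_true]
    constructor <;> abel

theorem continuous_flow (k : Fin 3) : Continuous fun p : ℝ × Fr => flow k p.1 p.2 := by
  match k with
  | 0 => unfold flow; fun_prop
  | 1 => unfold flow; fun_prop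
  | 2 => unfold flow; fun_prop

/-- The matrix whose right multiplication realizes `flow`. -/
def rotMat (k : Fin 3) (θ : ℝ) : Matrix (Fin 3) (Fin 3) ℝ :=
  match k with
  | 0 => !![Real.cos θ, 0, Real.sin θ; 0, 1, 0; -Real.sin θ, 0, Real.cos θ]
  | 1 => !![1, 0, 0; 0, Real.cos θ, Real.sin θ; 0, -Real.sin θ, Real.cos θ]
  | 2 => !![Real.cos θ, -Real.sin θ, 0; Real.sin θ, Real.cos θ, 0; 0, 0, 1]

theorem rotMat_mem (k : Fin 3) (θ : ℝ) : rotMat k θ ∈ Matrix.orthogonalGroup (Fin 3) ℝ := by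
  rw [Matrix.mem_orthogonalGroup_iff]
  have h := Real.sin_sq_add_cos_sq θ
  ext i j
  match k with
  | 0 => fin_cases i <;> fin_cases j <;>
          simp [rotMat, Matrix.mul_apply, Fin.sum_univ_three] <;> nlinarith
  | 1 => fin_cases i <;> fin_cases j <;>
          simp [rotMat, Matrix.mul_apply, Fin.sum_univ_three] <;> nlinarith
  | 2 => fin_cases i <;> fin_cases j <;>
          simp [rotMat, Matrix.mul_apply, Fin.sum_univ_three] <;> nlinarith

/-- The rotation by `θ` as an element of `O(3)`. -/
def rot (k : Fin 3) (θ : ℝ) : O3 := ⟨rotMat k θ, rotMat_mem k θ⟩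

/-- Right multiplication recombines columns, so moving a frame by `flow` is a right translation of
O(3), and right invariance of Haar measure applies to it. -/
theorem cols_mul_rot (A : O3) (k : Fin 3) (θ : ℝ) : cols (A * rot k θ) = flow k θ (cols A) := by
  match k with
  | 0 =>
    refine Prod.ext ?_ (Prod.ext ?_ ?_) <;> ext i <;>
      simp [cols, colVec, flow, rot, rotMat, Matrix.mul_apply, Fin.sum_univ_three] <;> ring
  | 1 =>
    refine Prod.ext ?_ (Prod.ext ?_ ?_) <;> ext i <;>
      simp [cols, colVec, flow, rot, rotMat, Matrix.mul_apply, Fin.sum_univ_three] <;> ring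
  | 2 =>
    refine Prod.ext ?_ (Prod.ext ?_ ?_) <;> ext i <;>
      simp [cols, colVec, flow, rot, rotMat, Matrix.mul_apply, Fin.sum_univ_three] <;> ring

/-! ### Derivations on frame functions -/

/-- The states whose base point does not vanish and whose time lies in `J`. -/
def dom (J : Set ℝ) : Set St := {z | z.1.2.2 ≠ 0 ∧ z.2.2 ∈ J}

theorem isOpen_dom {J : Set ℝ} (hJ : IsOpen J) : IsOpen (dom J) :=
  (isOpen_ne_fun (by fun_prop) (by fun_prop)).inter (hJ.preimage (by fun_prop))

theorem cols_mem_dom {J : Set ℝ} (A : O3) (r : ℝ) {t : ℝ} (ht : t ∈ J) :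
    (cols A, r, t) ∈ dom J := ⟨colVec_ne_zero A 2, ht⟩

/-- Smooth functions on `dom J`. -/
def Smooth (J : Set ℝ) (Y : St → ℝ) : Prop := ContDiffOn ℝ (⊤ : ℕ∞) Y (dom J)

/-- Differentiation along `xi k`. -/
def dX (k : Fin 3) (Y : St → ℝ) (z : St) : ℝ := fderiv ℝ Y z (xi k z.1, 0)

/-- Differentiation in the direction of the axis. -/
def dR (Y : St → ℝ) (z : St) : ℝ := fderiv ℝ Y z (0, 1, 0)

/-- Differentiation in time. -/
def dT (Y : St → ℝ) (z : St) : ℝ := fderiv ℝ Y z (0, 0, 1)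

/-- The horizontal Laplacian on the frame bundle of the sphere. -/
def hLap (Y : St → ℝ) (z : St) : ℝ := dX 0 (dX 0 Y) z + dX 1 (dX 1 Y) z

section Calculus

variable {J : Set ℝ} {Y Z : St → ℝ}

theorem Smooth.differentiableAt (hJ : IsOpen J) (hY : Smooth J Y) {z : St} (hz : z ∈ dom J) :
    DifferentiableAt ℝ Y z :=
  (hY.contDiffAt ((isOpen_dom hJ).mem_nhds hz)).differentiableAt (by simp)

theorem Smooth.fderiv_apply (hJ : IsOpen J) (hY : Smooth J Y) {V : St → St}
    (hV : ContDiff ℝ (⊤ : ℕ∞) V) : Smooth J fun z => fderiv ℝ Y z (V z) := by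
  have h1 : ContDiffOn ℝ (⊤ : ℕ∞) (fderiv ℝ Y) (dom J) :=
    hY.fderiv_of_isOpen (isOpen_dom hJ) (by simp)
  exact h1.clm_apply hV.contDiffOn

theorem Smooth.dX (hJ : IsOpen J) (hY : Smooth J Y) (k : Fin 3) : Smooth J (dX k Y) :=
  hY.fderiv_apply hJ (V := fun z => (xi k z.1, 0))
    (((xi k).contDiff.comp contDiff_fst).prodMk contDiff_const)

theorem Smooth.dR (hJ : IsOpen J) (hY : Smooth J Y) : Smooth J (dR Y) :=
  hY.fderiv_apply hJ contDiff_const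

theorem Smooth.dT (hJ : IsOpen J) (hY : Smooth J Y) : Smooth J (dT Y) :=
  hY.fderiv_apply hJ contDiff_const

theorem Smooth.add (hY : Smooth J Y) (hZ : Smooth J Z) : Smooth J fun z => Y z + Z z :=
  ContDiffOn.add hY hZ

theorem Smooth.mul (hY : Smooth J Y) (hZ : Smooth J Z) : Smooth J fun z => Y z * Z z :=
  ContDiffOn.mul hY hZ

theorem Smooth.continuous_cols (hY : Smooth J Y) (r : ℝ) {t : ℝ} (ht : t ∈ J) :
    Continuous fun A : O3 => Y (cols A, r, t) := by
  rw [← continuousOn_univ]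
  exact (ContDiffOn.continuousOn hY).comp (f := fun A : O3 => (cols A, r, t))
    (by have := RoundCylinder.continuous_cols; fun_prop) fun A _ => cols_mem_dom A r ht

theorem Smooth.hasDerivAt_dT (hJ : IsOpen J) (hY : Smooth J Y) {c : Fr} {r t : ℝ}
    (hz : (c, r, t) ∈ dom J) : HasDerivAt (fun s => Y (c, r, s)) (RoundCylinder.dT Y (c, r, t)) t := by
  have h1 := (hY.differentiableAt hJ hz).hasFDerivAt
  have h2 : HasDerivAt (fun s : ℝ => ((c, r, s) : St)) (0, 0, 1) t :=
    (hasDerivAt_const t c).prodMk ((hasDerivAt_const t r).prodMk (hasDerivAt_id t))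
  exact h1.comp_hasDerivAt t h2

theorem Smooth.hasDerivAt_dR (hJ : IsOpen J) (hY : Smooth J Y) {c : Fr} {r t : ℝ}
    (hz : (c, r, t) ∈ dom J) : HasDerivAt (fun s => Y (c, s, t)) (RoundCylinder.dR Y (c, r, t)) r := by
  have h1 := (hY.differentiableAt hJ hz).hasFDerivAt
  have h2 : HasDerivAt (fun s : ℝ => ((c, s, t) : St)) (0, 1, 0) r :=
    (hasDerivAt_const r c).prodMk ((hasDerivAt_id r).prodMk (hasDerivAt_const r t))
  exact h1.comp_hasDerivAt r h2

theorem Smooth.hasDerivAt_flow (hJ : IsOpen J) (hY : Smooth J Y) {c : Fr} {r t : ℝ}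
    (k : Fin 3) (θ : ℝ) (hz : (flow k θ c, r, t) ∈ dom J) :
    HasDerivAt (fun s => Y (flow k s c, r, t)) (RoundCylinder.dX k Y (flow k θ c, r, t)) θ := by
  have h1 := (hY.differentiableAt hJ hz).hasFDerivAt
  have h2 : HasDerivAt (fun s : ℝ => ((flow k s c, r, t) : St)) (xi k (flow k θ c), 0) θ :=
    (RoundCylinder.hasDerivAt_flow k θ c).prodMk (hasDerivAt_const θ (r, t))
  exact h1.comp_hasDerivAt θ h2

theorem dX_mul (hJ : IsOpen J) (hY : Smooth J Y) (hZ : Smooth J Z) (k : Fin 3) {z : St}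
    (hz : z ∈ dom J) : dX k (fun z => Y z * Z z) z = Y z * dX k Z z + Z z * dX k Y z := by
  have h := ((hY.differentiableAt hJ hz).hasFDerivAt.mul (hZ.differentiableAt hJ hz).hasFDerivAt).fderiv
  have h' : fderiv ℝ (fun z => Y z * Z z) z = _ := h
  simp [dX, h']

/-- The commutator of horizontal derivatives is the vertical derivative. -/
theorem dX_commutator (hJ : IsOpen J) (hY : Smooth J Y) {z : St} (hz : z ∈ dom J) :
    dX 0 (dX 1 Y) z - dX 1 (dX 0 Y) z = dX 2 Y z := by
  have hYz : ContDiffAt ℝ (⊤ : ℕ∞) Y z := hY.contDiffAt ((isOpen_dom hJ).mem_nhds hz)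
  have hsymm : IsSymmSndFDerivAt ℝ Y z := hYz.isSymmSndFDerivAt (by
    simp only [minSmoothness_of_isRCLikeNormedField]
    exact WithTop.coe_le_coe.2 (le_top : (2 : ℕ∞) ≤ ⊤))
  have hd : DifferentiableAt ℝ (fderiv ℝ Y) z :=
    (hYz.fderiv_right (m := 1) (by norm_cast)).differentiableAt (by simp)
  -- The symmetric second derivative cancels in the commutator. What is left is the bracket of the
  -- linear fields: for c = (a, b, x), xi 1 (xi 0 c) - xi 0 (xi 1 c) = (b, -a, 0) = xi 2 c.
  have key : ∀ j k : Fin 3, dX j (dX k Y) z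
      = fderiv ℝ (fderiv ℝ Y) z (xi j z.1, 0) (xi k z.1, 0)
        + fderiv ℝ Y z (xi k (xi j z.1), 0) := by
    intro j k
    have h2 : HasFDerivAt (fun z : St => ((xi k z.1, 0) : St))
        ((xi k ∘L ContinuousLinearMap.fst ℝ Fr (ℝ × ℝ)).prod 0) z :=
      ((xi k).hasFDerivAt.comp z hasFDerivAt_fst).prodMk (hasFDerivAt_const _ _)
    have h3 : fderiv ℝ (fun z => fderiv ℝ Y z (xi k z.1, 0)) z = _ :=
      (hd.hasFDerivAt.clm_apply h2).fderiv
    show fderiv ℝ (fun z => fderiv ℝ Y z (xi k z.1, 0)) z (xi j z.1, 0) = _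
    rw [h3]
    simp
    ring
  rw [key, key, hsymm.eq (xi 0 z.1, 0) (xi 1 z.1, 0)]
  rw [add_sub_add_left_eq_sub, ← map_sub]
  unfold dX
  congr 1
  simp

end Calculus

/-! ### Averages over frames -/

/-- The average of a function over all orthonormal frames. -/
def avg (Y : St → ℝ) (r t : ℝ) : ℝ := ∫ A : O3, Y (cols A, r, t) ∂haarO3

section Avg

variable {J : Set ℝ} {Y Z : St → ℝ}

/-- The derivative is that of the average along the right translations `rot k θ`, and this average
is constant in θ. -/
theorem avg_dX (hJ : IsOpen J) (hY : Smooth J Y) (k : Fin 3) (r : ℝ) {t : ℝ} (ht : t ∈ J) :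
    avg (dX k Y) r t = 0 := by
  have hmem : ∀ A θ, (flow k θ (cols A), r, t) ∈ dom J := fun A θ => by
    rw [← cols_mul_rot]; exact cols_mem_dom _ r ht
  have h1 : HasDerivAt (fun θ => ∫ A : O3, Y (flow k θ (cols A), r, t) ∂haarO3)
      (∫ A : O3, dX k Y (flow k 0 (cols A), r, t) ∂haarO3) 0 := by
    have hflow : Continuous fun z : O3 × ℝ => ((flow k z.2 (cols z.1), r, t) : St) := by
      have h2 := continuous_flow k
      have h3 := continuous_cols
      exact (h2.comp (continuous_snd.prodMk (h3.comp continuous_fst))).prodMk continuous_const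
    refine hasDerivAt_integral_of_compact haarO3 (f := fun A θ => Y (flow k θ (cols A), r, t))
      (f' := fun A θ => dX k Y (flow k θ (cols A), r, t)) (s := univ) Filter.univ_mem ?_ ?_ ?_
    · intro θ _
      rw [← continuousOn_univ]
      exact (ContDiffOn.continuousOn hY).comp (f := fun A : O3 => ((flow k θ (cols A), r, t) : St))
        (hflow.comp (continuous_id.prodMk continuous_const)).continuousOn fun A _ => hmem A θ
    · exact (ContDiffOn.continuousOn (hY.dX hJ k)).comp hflow.continuousOn fun z _ => hmem z.1 z.2
    · intro A θ _
      exact hY.hasDerivAt_flow hJ k θ (hmem A θ)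
  have h2 : (fun θ => ∫ A : O3, Y (flow k θ (cols A), r, t) ∂haarO3)
      = fun _ => ∫ A : O3, Y (cols A, r, t) ∂haarO3 := by
    funext θ
    simp_rw [← cols_mul_rot]
    exact integral_mul_right_eq_self (fun A => Y (cols A, r, t)) (rot k θ)
  rw [h2] at h1
  simp only [flow_zero] at h1
  exact h1.unique (hasDerivAt_const _ _)

theorem Smooth.integrable (hY : Smooth J Y) (r : ℝ) {t : ℝ} (ht : t ∈ J) :
    Integrable (fun A : O3 => Y (cols A, r, t)) haarO3 :=
  integrable_of_continuous_compact _ (hY.continuous_cols r ht)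

/-- Integration by parts. -/
theorem avg_mul_dX (hJ : IsOpen J) (hY : Smooth J Y) (hZ : Smooth J Z) (k : Fin 3) (r : ℝ) {t : ℝ}
    (ht : t ∈ J) : avg (fun z => Y z * dX k Z z) r t = -avg (fun z => dX k Y z * Z z) r t := by
  have h1 := avg_dX hJ (hY.mul hZ) k r ht
  have h2 : avg (dX k fun z => Y z * Z z) r t
      = avg (fun z => Y z * dX k Z z + dX k Y z * Z z) r t := by
    unfold avg
    congr 1
    funext A
    rw [dX_mul hJ hY hZ k (cols_mem_dom A r ht)]
    ring
  have h3 : avg (fun z => Y z * dX k Z z + dX k Y z * Z z) r t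
      = avg (fun z => Y z * dX k Z z) r t + avg (fun z => dX k Y z * Z z) r t :=
    integral_add ((hY.mul (hZ.dX hJ k)).integrable r ht) (((hY.dX hJ k).mul hZ).integrable r ht)
  linarith

/-- Green's identity on frames. It yields both the symmetry of `hLap` and the sign of the
dissipation. -/
theorem avg_mul_hLap (hJ : IsOpen J) (hY : Smooth J Y) (hZ : Smooth J Z) (r : ℝ) {t : ℝ}
    (ht : t ∈ J) : avg (fun z => Y z * hLap Z z) r t
      = -avg (fun z => dX 0 Y z * dX 0 Z z + dX 1 Y z * dX 1 Z z) r t := by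
  have h0 := avg_mul_dX hJ hY (hZ.dX hJ 0) 0 r ht
  have h1 := avg_mul_dX hJ hY (hZ.dX hJ 1) 1 r ht
  have e1 : avg (fun z => Y z * hLap Z z) r t = avg (fun z => Y z * dX 0 (dX 0 Z) z) r t
      + avg (fun z => Y z * dX 1 (dX 1 Z) z) r t := by
    rw [avg, avg, avg, ← integral_add ((hY.mul ((hZ.dX hJ 0).dX hJ 0)).integrable r ht)
      ((hY.mul ((hZ.dX hJ 1).dX hJ 1)).integrable r ht)]
    simp only [hLap, mul_add]
  have e2 : avg (fun z => dX 0 Y z * dX 0 Z z + dX 1 Y z * dX 1 Z z) r t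
      = avg (fun z => dX 0 Y z * dX 0 Z z) r t + avg (fun z => dX 1 Y z * dX 1 Z z) r t :=
    integral_add (((hY.dX hJ 0).mul (hZ.dX hJ 0)).integrable r ht)
      (((hY.dX hJ 1).mul (hZ.dX hJ 1)).integrable r ht)
  linarith

theorem avg_mul_hLap_comm (hJ : IsOpen J) (hY : Smooth J Y) (hZ : Smooth J Z) (r : ℝ) {t : ℝ}
    (ht : t ∈ J) : avg (fun z => Y z * hLap Z z) r t = avg (fun z => Z z * hLap Y z) r t := by
  rw [avg_mul_hLap hJ hY hZ r ht, avg_mul_hLap hJ hZ hY r ht]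
  simp only [mul_comm]

theorem hasDerivAt_avg_dT (hJ : IsOpen J) (hY : Smooth J Y) (r : ℝ) {t : ℝ} (ht : t ∈ J) :
    HasDerivAt (fun s => avg Y r s) (avg (dT Y) r t) t := by
  refine hasDerivAt_integral_of_compact haarO3 (f := fun A s => Y (cols A, r, s))
      (f' := fun A s => dT Y (cols A, r, s)) (s := J) (hJ.mem_nhds ht) ?_ ?_ ?_
  · exact fun s hs => hY.continuous_cols r hs
  · refine (ContDiffOn.continuousOn (hY.dT hJ)).comp (f := fun z : O3 × ℝ => (cols z.1, r, z.2))
      (by have := continuous_cols; fun_prop) fun z hz => cols_mem_dom z.1 r hz.2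
  · exact fun A s hs => hY.hasDerivAt_dT hJ (cols_mem_dom A r hs)

theorem hasDerivAt_avg_dR (hJ : IsOpen J) (hY : Smooth J Y) (r : ℝ) {t : ℝ} (ht : t ∈ J) :
    HasDerivAt (fun s => avg Y s t) (avg (dR Y) r t) r := by
  refine hasDerivAt_integral_of_compact haarO3 (f := fun A s => Y (cols A, s, t))
      (f' := fun A s => dR Y (cols A, s, t)) (s := univ) Filter.univ_mem ?_ ?_ ?_
  · exact fun s hs => hY.continuous_cols s ht
  · refine (ContDiffOn.continuousOn (hY.dR hJ)).comp (f := fun z : O3 × ℝ => (cols z.1, z.2, t))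
      (by have := continuous_cols; fun_prop) fun z hz => cols_mem_dom z.1 z.2 ht
  · exact fun A s hs => hY.hasDerivAt_dR hJ (cols_mem_dom A s ht)

/-- The time set need not be open, so that endpoints of the time interval are included. -/
theorem continuousOn_avg {I : Set ℝ} (hY : ContinuousOn Y (dom I)) :
    ContinuousOn (fun z : ℝ × ℝ => avg Y z.1 z.2) (univ ×ˢ I) := by
  have h : ContinuousOn (fun z : O3 × (ℝ × ℝ) => Y (cols z.1, z.2.1, z.2.2))
      (univ ×ˢ (univ ×ˢ I)) := by
    have hc := continuous_cols
    refine hY.comp (f := fun z : O3 × (ℝ × ℝ) => ((cols z.1, z.2.1, z.2.2) : St))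
      (by fun_prop) ?_
    intro z hz
    exact ⟨colVec_ne_zero z.1 2, hz.2.2⟩
  exact continuousOn_integral_of_compact haarO3
    (f := fun A (z : ℝ × ℝ) => Y (cols A, z.1, z.2)) h

end Avg

end RoundCylinder
end

noncomputable section
open MeasureTheory Set

/-! ## The cylinder in geographical coordinates -/

namespace LocalCoords

/-- The metric of the cylinder over a sphere of squared radius `s` in coordinates
(latitude, longitude, height). -/
def latMetric (s : ℝ) (y : Fin 3 → ℝ) : Matrix (Fin 3) (Fin 3) ℝ :=
  Matrix.diagonal ![s, s * Real.cos (y 0) ^ 2, 1]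

/-- The Christoffel symbols of `latMetric`. -/
def latChristoffel (k i j : Fin 3) (φ : ℝ) : ℝ :=
  if k = 0 ∧ i = 1 ∧ j = 1 then Real.sin φ * Real.cos φ
  else if k = 1 ∧ (i = 0 ∧ j = 1 ∨ i = 1 ∧ j = 0) then -Real.tan φ else 0

/-- The derivatives at the equator of the Christoffel symbols of `latMetric`. -/
def latChristoffelDeriv (k i j : Fin 3) : ℝ :=
  if k = 0 ∧ i = 1 ∧ j = 1 then 1
  else if k = 1 ∧ (i = 0 ∧ j = 1 ∨ i = 1 ∧ j = 0) then -1 else 0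

theorem pd_congr {n : ℕ} {f g : (Fin n → ℝ) → ℝ} {y : Fin n → ℝ} (h : f =ᶠ[nhds y] g)
    (k : Fin n) : pd k f y = pd k g y := by
  simp only [pd, h.fderiv_eq]

theorem pd_comp_apply_zero {f : ℝ → ℝ} {f' : ℝ} {y : Fin 3 → ℝ} (hf : HasDerivAt f f' (y 0))
    (k : Fin 3) : pd k (fun z => f (z 0)) y = if k = 0 then f' else 0 := by
  have h1 : HasFDerivAt (fun z : Fin 3 → ℝ => z 0) (ContinuousLinearMap.proj (R := ℝ) 0) y :=
    hasFDerivAt_apply 0 y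
  have h2 := (hf.comp_hasFDerivAt y h1).fderiv
  have h3 : fderiv ℝ (fun z : Fin 3 → ℝ => f (z 0)) y = _ := h2
  rw [pd, h3]
  simp [Pi.single_apply, eq_comm]

theorem pd_sub {n : ℕ} {f g : (Fin n → ℝ) → ℝ} {y : Fin n → ℝ} (hf : DifferentiableAt ℝ f y)
    (hg : DifferentiableAt ℝ g y) (k : Fin n) :
    pd k (fun z => f z - g z) y = pd k f y - pd k g y := by
  have h : fderiv ℝ (fun z => f z - g z) y = _ := (hf.hasFDerivAt.sub hg.hasFDerivAt).fderiv
  simp [pd, h]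

theorem pd_sum {n : ℕ} {ι : Type*} (s : Finset ι) {f : ι → (Fin n → ℝ) → ℝ} {y : Fin n → ℝ}
    (hf : ∀ i, DifferentiableAt ℝ (f i) y) (k : Fin n) :
    pd k (fun z => ∑ i ∈ s, f i z) y = ∑ i ∈ s, pd k (f i) y := by
  have h : fderiv ℝ (fun z => ∑ i ∈ s, f i z) y = _ :=
    (HasFDerivAt.fun_sum fun i _ => (hf i).hasFDerivAt).fderiv
  simp [pd, h]

theorem pd_mul {n : ℕ} {f g : (Fin n → ℝ) → ℝ} {y : Fin n → ℝ} (hf : DifferentiableAt ℝ f y)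
    (hg : DifferentiableAt ℝ g y) (k : Fin n) :
    pd k (fun z => f z * g z) y = f y * pd k g y + g y * pd k f y := by
  have h : fderiv ℝ (fun z => f z * g z) y = _ := (hf.hasFDerivAt.mul hg.hasFDerivAt).fderiv
  simp [pd, h]

theorem hasDerivAt_cos_sq (s φ : ℝ) :
    HasDerivAt (fun x => s * Real.cos x ^ 2) (-(2 * s * (Real.sin φ * Real.cos φ))) φ := by
  refine (((Real.hasDerivAt_cos φ).pow 2).const_mul s).congr_deriv ?_
  simp
  ring

theorem pd_latMetric (s : ℝ) (y : Fin 3 → ℝ) (a b k : Fin 3) :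
    pd k (fun z => latMetric s z a b) y
      = if a = 1 ∧ b = 1 ∧ k = 0 then -(2 * s * (Real.sin (y 0) * Real.cos (y 0))) else 0 := by
  have hconst : ∀ c : ℝ, pd k (fun _ : Fin 3 → ℝ => c) y = 0 := by intro c; simp [pd]
  have h11 := pd_comp_apply_zero (hasDerivAt_cos_sq s (y 0)) k
  fin_cases a <;> fin_cases b <;> simp [latMetric, hconst]
  exact h11

theorem latMetric_inv {s : ℝ} (hs : s ≠ 0) {y : Fin 3 → ℝ} (hy : Real.cos (y 0) ≠ 0) :
    (latMetric s y)⁻¹ = Matrix.diagonal ![s⁻¹, (s * Real.cos (y 0) ^ 2)⁻¹, 1] := by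
  refine Matrix.inv_eq_right_inv ?_
  rw [latMetric, Matrix.diagonal_mul_diagonal, ← Matrix.diagonal_one]
  congr 1
  funext i
  fin_cases i
  · simp [hs]
  · have : s * Real.cos (y 0) ^ 2 ≠ 0 := by positivity
    simp only [Fin.mk_one, Matrix.cons_val_one, Matrix.cons_val_zero]
    exact mul_inv_cancel₀ this
  · simp

/-- Only the longitude coefficient of the metric varies, and only with latitude. The scale s drops
out, since Christoffel symbols do not change when the spherical factor is scaled. -/
theorem christoffel_of_latMetric {g : TensorField 3} {s : ℝ} (hs : s ≠ 0) {y : Fin 3 → ℝ}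
    (hy : Real.cos (y 0) ≠ 0) (hg : ∀ᶠ z in nhds y, g z = latMetric s z) (k i j : Fin 3) :
    christoffel g k i j y = latChristoffel k i j (y 0) := by
  have hpd : ∀ a b l, pd l (fun z => g z a b) y
      = if a = 1 ∧ b = 1 ∧ l = 0 then -(2 * s * (Real.sin (y 0) * Real.cos (y 0))) else 0 := by
    intro a b l
    rw [← pd_latMetric]
    exact pd_congr (hg.mono fun z hz => by rw [hz]) l
  rw [christoffel]
  simp only [hpd, hg.self_of_nhds, latMetric_inv hs hy, Fin.sum_univ_three]
  fin_cases k <;> fin_cases i <;> fin_cases j <;>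
    simp [latChristoffel, Real.tan_eq_sin_div_cos] <;> field_simp

theorem hasDerivAt_latChristoffel (k i j : Fin 3) :
    HasDerivAt (latChristoffel k i j) (latChristoffelDeriv k i j) 0 := by
  unfold latChristoffelDeriv
  have e : latChristoffel k i j = fun φ => latChristoffel k i j φ := rfl
  rw [e]
  unfold latChristoffel
  split_ifs
  · refine ((Real.hasDerivAt_sin 0).mul (Real.hasDerivAt_cos 0)).congr_deriv ?_
    simp
  · refine (Real.hasDerivAt_tan (x := 0) (by simp)).neg.congr_deriv ?_
    simp
  · exact hasDerivAt_const _ _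

theorem latChristoffel_zero (k i j : Fin 3) : latChristoffel k i j 0 = 0 := by
  simp [latChristoffel]

/-! ### Covariant derivatives and curvature at the equator -/

section Equator

variable {g : TensorField 3} {s : ℝ} {y : Fin 3 → ℝ}

theorem eventually_cos_ne_zero (hy : y 0 = 0) : ∀ᶠ z : Fin 3 → ℝ in nhds y, Real.cos (z 0) ≠ 0 := by
  have : Continuous fun z : Fin 3 → ℝ => Real.cos (z 0) := by fun_prop
  exact this.continuousAt.eventually_ne (by rw [hy]; simp)

theorem eventually_christoffel (hs : s ≠ 0) (hy : y 0 = 0)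
    (hg : ∀ᶠ z in nhds y, g z = latMetric s z) :
    ∀ᶠ z in nhds y, ∀ k i j, christoffel g k i j z = latChristoffel k i j (z 0) := by
  filter_upwards [eventually_eventually_nhds.2 hg, eventually_cos_ne_zero hy] with z h1 h2
  exact christoffel_of_latMetric hs h2 h1

/-- The symbols vanish on the equator, so the quadratic terms of the curvature tensor disappear
there, and these first derivatives carry all of the curvature. -/
theorem pd_christoffel (hs : s ≠ 0) (hy : y 0 = 0)
    (hg : ∀ᶠ z in nhds y, g z = latMetric s z) (l k i j : Fin 3) :
    pd l (christoffel g k i j) y = if l = 0 then latChristoffelDeriv k i j else 0 := by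
  have h1 : christoffel g k i j =ᶠ[nhds y] fun z => latChristoffel k i j (z 0) :=
    (eventually_christoffel hs hy hg).mono fun z hz => hz k i j
  rw [pd_congr h1]
  exact pd_comp_apply_zero (by rw [hy]; exact hasDerivAt_latChristoffel k i j) l

theorem christoffel_equator (hs : s ≠ 0) (hy : y 0 = 0)
    (hg : ∀ᶠ z in nhds y, g z = latMetric s z) (k i j : Fin 3) : christoffel g k i j y = 0 := by
  rw [(eventually_christoffel hs hy hg).self_of_nhds, hy, latChristoffel_zero]

theorem latMetric_inv_equator (hs : s ≠ 0) (hy : y 0 = 0)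
    (hg : ∀ᶠ z in nhds y, g z = latMetric s z) :
    (g y)⁻¹ = Matrix.diagonal ![s⁻¹, s⁻¹, 1] := by
  rw [hg.self_of_nhds, latMetric_inv hs (by rw [hy]; simp), hy]
  simp

/-- The curvature action at the equator. -/
theorem rmAction_equator (hs : s ≠ 0) (hy : y 0 = 0)
    (hg : ∀ᶠ z in nhds y, g z = latMetric s z) (H : TensorField 3) (i j : Fin 3) :
    rmAction g H i j y = s⁻¹ *
      (if i = 0 ∧ j = 0 then H y 1 1 else if i = 1 ∧ j = 1 then H y 0 0
        else if i = 0 ∧ j = 1 then -H y 1 0 else if i = 1 ∧ j = 0 then -H y 0 1 else 0) := by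
  simp only [rmAction, riemann, pd_christoffel hs hy hg, christoffel_equator hs hy hg,
    latMetric_inv_equator hs hy hg, Fin.sum_univ_three]
  fin_cases i <;> fin_cases j <;> simp [latChristoffelDeriv]

/-- The connection Laplacian at the equator. -/
theorem laplacian_equator (hs : s ≠ 0) (hy : y 0 = 0)
    (hg : ∀ᶠ z in nhds y, g z = latMetric s z) (H : TensorField 3)
    (hH : ∀ i j, ContDiffAt ℝ 2 (fun z => H z i j) y) (i j : Fin 3) :
    laplacian g H i j y = s⁻¹ * (pd 0 (pd 0 fun z => H z i j) y + pd 1 (pd 1 fun z => H z i j) y)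
      + pd 2 (pd 2 fun z => H z i j) y
      + s⁻¹ * ((if i = 1 then 1 else 0) + (if j = 1 then 1 else 0)) * H y i j := by
  have hHd : ∀ i j, DifferentiableAt ℝ (fun z => H z i j) y := fun i j =>
    (hH i j).differentiableAt (by norm_num)
  have hHdd : ∀ k i j, DifferentiableAt ℝ (pd k fun z => H z i j) y := by
    intro k i j
    have h1 : DifferentiableAt ℝ (fderiv ℝ fun z => H z i j) y :=
      ((hH i j).fderiv_right (m := 1) (by norm_num)).differentiableAt (by norm_num)
    exact h1.clm_apply (differentiableAt_const _)
  have hΓd : ∀ k i j, DifferentiableAt ℝ (fun z : Fin 3 → ℝ => latChristoffel k i j (z 0)) y := by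
    intro k i j
    have h1 : DifferentiableAt ℝ (latChristoffel k i j) (y 0) := by
      rw [hy]; exact (hasDerivAt_latChristoffel k i j).differentiableAt
    exact h1.comp (f := fun z : Fin 3 → ℝ => z 0) y (differentiableAt_apply 0 y)
  have hΓpd : ∀ l k i j, pd l (fun z : Fin 3 → ℝ => latChristoffel k i j (z 0)) y
      = if l = 0 then latChristoffelDeriv k i j else 0 := fun l k i j =>
    pd_comp_apply_zero (by rw [hy]; exact hasDerivAt_latChristoffel k i j) l
  -- In the derivative of a product Γ · H at the equator only the term with Γ differentiated
  -- survives.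
  have hcov : ∀ l k i j, pd l (covDeriv g H k i j) y = pd l (pd k fun z => H z i j) y
      - ∑ p, (if l = 0 then latChristoffelDeriv p k i else 0) * H y p j
      - ∑ p, (if l = 0 then latChristoffelDeriv p k j else 0) * H y i p := by
    intro l k i j
    have e : covDeriv g H k i j =ᶠ[nhds y] fun z => pd k (fun z => H z i j) z
        - ∑ p, latChristoffel p k i (z 0) * H z p j
        - ∑ p, latChristoffel p k j (z 0) * H z i p := by
      filter_upwards [eventually_christoffel hs hy hg] with z hz
      simp only [covDeriv, hz]
    have hm : ∀ a b c d e : Fin 3, DifferentiableAt ℝ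
        (fun z : Fin 3 → ℝ => latChristoffel a b c (z 0) * H z d e) y :=
      fun a b c d e => (hΓd a b c).mul (hHd d e)
    have hmpd : ∀ a b c d e : Fin 3,
        pd l (fun z : Fin 3 → ℝ => latChristoffel a b c (z 0) * H z d e) y
          = (if l = 0 then latChristoffelDeriv a b c else 0) * H y d e := by
      intro a b c d e
      rw [pd_mul (hΓd a b c) (hHd d e), hΓpd, hy, latChristoffel_zero]
      ring
    have d1 : DifferentiableAt ℝ (fun z => ∑ p, latChristoffel p k i (z 0) * H z p j) y :=
      DifferentiableAt.fun_sum fun p _ => hm p k i p j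
    have d2 : DifferentiableAt ℝ (fun z => ∑ p, latChristoffel p k j (z 0) * H z i p) y :=
      DifferentiableAt.fun_sum fun p _ => hm p k j i p
    refine (pd_congr e l).trans ((pd_sub ((hHdd k i j).fun_sub d1) d2 l).trans ?_)
    refine congrArg₂ _ ((pd_sub (hHdd k i j) d1 l).trans (congrArg₂ _ rfl ?_)) ?_
    · exact (pd_sum _ (fun p => hm p k i p j) l).trans (Finset.sum_congr rfl fun p _ => hmpd _ _ _ _ _)
    · exact (pd_sum _ (fun p => hm p k j i p) l).trans (Finset.sum_congr rfl fun p _ => hmpd _ _ _ _ _)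
  have hcov2 : ∀ l k, covDeriv₂ g H l k i j y = pd l (pd k fun z => H z i j) y
      - ∑ p, (if l = 0 then latChristoffelDeriv p k i else 0) * H y p j
      - ∑ p, (if l = 0 then latChristoffelDeriv p k j else 0) * H y i p := by
    intro l k
    simp only [covDeriv₂, christoffel_equator hs hy hg, hcov]
    simp
  simp only [laplacian, hcov2, latMetric_inv_equator hs hy hg, Fin.sum_univ_three]
  fin_cases i <;> fin_cases j <;> simp [latChristoffelDeriv] <;> ring

end Equator

end LocalCoords
end

noncomputable section
open MeasureTheory Set

namespace RoundCylinder

/-! ### Geographical charts -/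

/-- The frame at longitude `y 1` and latitude `y 0`, relative to the frame `cols A`, as an element
of `O(3)`. -/
def chartRot (A : O3) (y : Fin 3 → ℝ) : O3 := A * rot 1 (y 1) * rot 0 (y 0)

/-- The frame at longitude `y 1` and latitude `y 0`, relative to the frame `c`. -/
def chartFrame (c : Fr) (y : Fin 3 → ℝ) : Fr := flow 0 (y 0) (flow 1 (y 1) c)

theorem cols_chartRot (A : O3) (y : Fin 3 → ℝ) : cols (chartRot A y) = chartFrame (cols A) y := by
  rw [chartRot, cols_mul_rot, cols_mul_rot, chartFrame]

/-- The chart of the cylinder with equator through `cols A`. -/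
def chart (A : O3) (y : Fin 3 → ℝ) : Amb := ((chartFrame (cols A) y).2.2, y 2)

theorem chart_eq (A : O3) (y : Fin 3 → ℝ) : chart A y = (colVec (chartRot A y) 2, y 2) := by
  rw [chart, ← cols_chartRot]; rfl

/-- The vectors `c.1`, `c.2.1` and the direction of the axis. -/
def frameVec (c : Fr) (i : Fin 3) : Amb := ![(c.1, 0), (c.2.1, 0), (0, 1)] i

/-- The factors between the coordinate fields and the unit frame. -/
def latWeight (φ : ℝ) (i : Fin 3) : ℝ := ![1, Real.cos φ, 1] i

theorem contDiff_chartFrame (c : Fr) : ContDiff ℝ (⊤ : ℕ∞) (chartFrame c) := by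
  unfold chartFrame flow
  fun_prop

theorem contDiff_chart (A : O3) : ContDiff ℝ (⊤ : ℕ∞) (chart A) := by
  have := contDiff_chartFrame (cols A)
  unfold chart
  fun_prop

theorem hasDerivAt_line {n : ℕ} (y : Fin n → ℝ) (i : Fin n) (θ : ℝ) :
    HasDerivAt (fun t : ℝ => y + t • (Pi.single i 1 : Fin n → ℝ)) (Pi.single i 1) θ := by
  simpa using ((hasDerivAt_id θ).smul_const (Pi.single i 1 : Fin n → ℝ)).const_add y

theorem fderiv_single_eq {n : ℕ} {F : Type*} [NormedAddCommGroup F] [NormedSpace ℝ F]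
    {f : (Fin n → ℝ) → F} {y : Fin n → ℝ} {i : Fin n} {θ : ℝ} {v : F}
    (hf : DifferentiableAt ℝ f (y + θ • (Pi.single i 1 : Fin n → ℝ)))
    (hv : HasDerivAt (fun t : ℝ => f (y + t • (Pi.single i 1 : Fin n → ℝ))) v θ) :
    fderiv ℝ f (y + θ • (Pi.single i 1 : Fin n → ℝ)) (Pi.single i 1) = v :=
  (hf.hasFDerivAt.comp_hasDerivAt θ (hasDerivAt_line y i θ)).unique hv

/-- Meridians are great circles of unit speed, while a parallel at latitude φ has radius cos φ. The
moving frame `chartFrame` is adapted to both. -/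
theorem coordVec_chart (A : O3) (i : Fin 3) (y : Fin 3 → ℝ) :
    coordVec (chart A) i y = latWeight (y 0) i • frameVec (chartFrame (cols A) y) i := by
  have hd : ∀ y, DifferentiableAt ℝ (chart A) y := fun y =>
    (contDiff_chart A).contDiffAt.differentiableAt (by simp)
  have key : ∀ v, HasDerivAt (fun t : ℝ => chart A (y + t • (Pi.single i 1 : Fin 3 → ℝ))) v 0 →
      coordVec (chart A) i y = v := by
    intro v hv
    have := fderiv_single_eq (hd _) hv
    rwa [zero_smul, add_zero] at this
  apply key
  have hadd : ∀ a : ℝ, HasDerivAt (fun t : ℝ => a + t) 1 0 := fun a =>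
    (hasDerivAt_id (0 : ℝ)).const_add a
  match i with
  | 0 =>
    have h1 := (hasDerivAt_flow 0 (y 0 + 0) (flow 1 (y 1) (cols A))).scomp 0 (hadd (y 0))
    have h2 := (hasFDerivAt_snd.comp_hasDerivAt (0 : ℝ)
      (hasFDerivAt_snd.comp_hasDerivAt (0 : ℝ) h1)).prodMk (hasDerivAt_const (0 : ℝ) (y 2))
    convert h2 using 1
    · funext t
      simp [chart, chartFrame]
    · simp [frameVec, latWeight, chartFrame]
  | 1 =>
    have h1 := (hasDerivAt_flow 1 (y 1 + 0) (cols A)).scomp 0 (hadd (y 1))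
    have h2 := ((hasFDerivAt_snd.comp_hasDerivAt (0 : ℝ)
      (hasFDerivAt_snd.comp_hasDerivAt (0 : ℝ) h1)).const_smul (Real.cos (y 0))).add_const
        (Real.sin (y 0) • (cols A).1)
    have h3 := h2.prodMk (hasDerivAt_const (0 : ℝ) (y 2))
    convert h3 using 1
    · funext t
      simp [chart, chartFrame, flow]
    · simp [frameVec, latWeight, chartFrame, flow]
  | 2 =>
    have h3 := (hasDerivAt_const (0 : ℝ) (chartFrame (cols A) y).2.2).prodMk (hadd (y 2))
    convert h3 using 1
    · funext t
      simp [chart, chartFrame, flow]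
    · simp [frameVec, latWeight]

theorem metric_frameVec (t : ℝ) (A : O3) (i j : Fin 3) :
    metric t (frameVec (cols A) i) (frameVec (cols A) j)
      = if i = j then (if i = 2 then 1 else 2 * |t|) else 0 := by
  fin_cases i <;> fin_cases j <;> simp [metric, sphereMetric, frameVec, cols, inner_colVec, norm_colVec]

theorem metricCoeff_chart (A : O3) (t : ℝ) (y : Fin 3 → ℝ) :
    metricCoeff (chart A) t y = LocalCoords.latMetric (2 * |t|) y := by
  have hmet : ∀ (a b : ℝ) (v w : Amb), metric t (a • v) (b • w) = a * b * metric t v w := by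
    intro a b v w
    simp [metric, sphereMetric, inner_smul_left, inner_smul_right]
    ring
  ext i j
  simp only [metricCoeff, Matrix.of_apply, coordVec_chart, hmet, ← cols_chartRot, metric_frameVec]
  fin_cases i <;> fin_cases j <;> simp [latWeight, LocalCoords.latMetric]
  ring

theorem tensorCoeff_chart (A : O3) (h : Tensor₂) (y : Fin 3 → ℝ) (i j : Fin 3) :
    tensorCoeff (chart A) h y i j = latWeight (y 0) i * latWeight (y 0) j *
      h (chart A y) (frameVec (chartFrame (cols A) y) i) (frameVec (chartFrame (cols A) y) j) := by
  simp only [tensorCoeff, Matrix.of_apply, coordVec_chart, map_smul, LinearMap.smul_apply,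
    smul_eq_mul]
  ring

/-- The domain of the charts. -/
def chartDom : Set (Fin 3 → ℝ) := {y | 0 < Real.cos (y 0)}

theorem metric_smul_sum (t : ℝ) (u v w : Amb) (a : ℝ) :
    metric t u (a • v + w) = a * metric t u v + metric t u w := by
  simp [metric, sphereMetric, inner_add_right, inner_smul_right]
  ring

theorem isLocalParam_chart (A : O3) : IsLocalParam chartDom (chart A) where
  isOpen := isOpen_lt continuous_const (by fun_prop)
  smooth := (contDiff_chart A).contDiffOn
  mapsTo y _ := by
    rw [chart_eq]
    exact norm_colVec _ 2
  immersion y hy := by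
    rw [injective_iff_map_eq_zero]
    intro v hv
    have h1 : ∑ i, v i • coordVec (chart A) i y = 0 := by
      have e : v = ∑ i, v i • (Pi.single i 1 : Fin 3 → ℝ) := by
        ext j
        simp [Pi.single_apply]
      rw [e, map_sum] at hv
      simpa only [map_smul, coordVec] using hv
    -- Pairing with an orthogonal frame isolates each coefficient. The formula for `metric` at
    -- parameter 1 is used only as a convenient inner product; it gives the spherical vectors
    -- squared length 2.
    have h2 : ∀ k, v k * (latWeight (y 0) k * (if k = 2 then 1 else 2)) = 0 := by
      intro k
      have h3 : metric 1 (frameVec (cols (chartRot A y)) k) (∑ i, v i • coordVec (chart A) i y)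
          = 0 := by
        rw [h1]; simp [metric, sphereMetric]
      simp only [Fin.sum_univ_three, coordVec_chart, ← cols_chartRot, smul_smul] at h3
      rw [add_assoc, metric_smul_sum, metric_smul_sum,
        ← add_zero ((v 2 * latWeight (y 0) 2) • frameVec (cols (chartRot A y)) 2),
        metric_smul_sum] at h3
      simp only [metric_frameVec] at h3
      fin_cases k <;> simp [metric, sphereMetric] at h3 ⊢ <;> simpa using h3
    have hy' : Real.cos (y 0) ≠ 0 := (show 0 < Real.cos (y 0) from hy).ne'
    ext k
    have := h2 k
    fin_cases k <;> simpa [latWeight, hy'] using this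

/-! ### Expansion in frames -/

theorem colVec_expand (A : O3) (v : R3) :
    v = inner ℝ (colVec A 0) v • colVec A 0 + inner ℝ (colVec A 1) v • colVec A 1
      + inner ℝ (colVec A 2) v • colVec A 2 := by
  have h := sum_colVec_mul A
  ext i
  have h0 := h i 0
  have h1 := h i 1
  have h2 := h i 2
  simp only [PiLp.inner_apply, RCLike.inner_apply, conj_trivial, Fin.sum_univ_three,
    PiLp.add_apply, PiLp.smul_apply, smul_eq_mul]
  have e : v i = v 0 * (if i = 0 then 1 else 0) + v 1 * (if i = 1 then 1 else 0)
      + v 2 * (if i = 2 then 1 else 0) := by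
    fin_cases i <;> simp
  rw [e, ← h0, ← h1, ← h2]
  ring

theorem exists_colVec_two_eq {x : R3} (hx : ‖x‖ = 1) : ∃ A : O3, colVec A 2 = x := by
  have horth : Orthonormal ℝ (Set.domRestrict {2} fun _ : Fin 3 => x) := by
    constructor
    · intro i; exact hx
    · intro i j hij; exact absurd (Subsingleton.elim i j) hij
  obtain ⟨b, hb⟩ := Orthonormal.exists_orthonormalBasis_extension_of_card_eq (𝕜 := ℝ)
    (v := fun _ : Fin 3 => x) (s := {2}) (by simp) horth
  have hmem : (Matrix.of fun k i => b i k) ∈ Matrix.orthogonalGroup (Fin 3) ℝ := by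
    rw [Matrix.mem_orthogonalGroup_iff']
    ext i j
    have h1 := orthonormal_iff_ite.1 b.orthonormal i j
    rw [Matrix.mul_apply, Matrix.one_apply, ← h1]
    simp [PiLp.inner_apply, mul_comm]
  refine ⟨⟨_, hmem⟩, ?_⟩
  ext k
  simp only [colVec, Matrix.of_apply]
  rw [hb 2 (by simp)]

/-! ### Tensors as functions of frames -/

/-- The normalized base point. -/
def basePt (c : Fr) : R3 := ‖c.2.2‖⁻¹ • c.2.2

/-- The projection to the tangent space of the cylinder at a point over `x`. -/
def tanProj (x : R3) (v : Amb) : Amb := (v.1 - inner ℝ x v.1 • x, v.2)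

/-- The components of a time-dependent tensor field with respect to a frame. -/
def comp (h : ℝ → Tensor₂) (i j : Fin 3) (z : St) : ℝ :=
  h z.2.2 (basePt z.1, z.2.1) (tanProj (basePt z.1) (frameVec z.1 i))
    (tanProj (basePt z.1) (frameVec z.1 j))

theorem basePt_cols (A : O3) : basePt (cols A) = colVec A 2 := by
  simp [basePt, cols, norm_colVec]

theorem tanProj_frameVec (A : O3) (i : Fin 3) :
    tanProj (colVec A 2) (frameVec (cols A) i) = frameVec (cols A) i := by
  fin_cases i <;> simp [tanProj, frameVec, cols, inner_colVec]

theorem comp_cols (h : ℝ → Tensor₂) (i j : Fin 3) (A : O3) (r t : ℝ) :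
    comp h i j (cols A, r, t)
      = h t (colVec A 2, r) (frameVec (cols A) i) (frameVec (cols A) j) := by
  simp only [comp, basePt_cols, tanProj_frameVec]

/-- The bridge between coordinates and frames: it converts coordinate derivatives of the
coefficients into derivatives of `comp` along `flow`. -/
theorem tensorCoeff_chart_comp (A : O3) (h : ℝ → Tensor₂) (t : ℝ) (y : Fin 3 → ℝ) (i j : Fin 3) :
    tensorCoeff (chart A) (h t) y i j = latWeight (y 0) i * latWeight (y 0) j *
      comp h i j (chartFrame (cols A) y, y 2, t) := by
  rw [tensorCoeff_chart, ← cols_chartRot, comp_cols, chart_eq]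

theorem tanProj_mem_tangent {x : R3} (hx : ‖x‖ = 1) (r : ℝ) (v : Amb) :
    tanProj x v ∈ tangent (x, r) := by
  show inner ℝ x (v.1 - inner ℝ x v.1 • x) = 0
  rw [inner_sub_right, inner_smul_right, real_inner_self_eq_norm_sq, hx]
  ring

theorem norm_basePt {c : Fr} (hc : c.2.2 ≠ 0) : ‖basePt c‖ = 1 := by
  rw [basePt, norm_smul, norm_inv, norm_norm, inv_mul_cancel₀ (norm_ne_zero_iff.2 hc)]

theorem comp_symm {I : Set ℝ} {h : ℝ → Tensor₂} (hflow : IsLinearizedRicciDeTurckFlow I h)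
    (i j : Fin 3) {z : St} (hz : z ∈ dom I) : comp h i j z = comp h j i z := by
  have hx : ‖basePt z.1‖ = 1 := norm_basePt hz.1
  have hp : ((basePt z.1, z.2.1) : Amb) ∈ cyl := hx
  unfold comp
  exact hflow.symm z.2.2 hz.2 _ hp _ (tanProj_mem_tangent hx _ _) _ (tanProj_mem_tangent hx _ _)

theorem frameVec_mem_tangent (A : O3) (r : ℝ) (i : Fin 3) :
    frameVec (cols A) i ∈ tangent (colVec A 2, r) := by
  rw [← tanProj_frameVec]; exact tanProj_mem_tangent (norm_colVec A 2) r _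

/-! ### Smoothness of the components -/

/-- Inverse of `chart A`. -/
def chartInv (A : O3) (x : R3) (r : ℝ) : Fin 3 → ℝ :=
  ![Real.arcsin (inner ℝ (colVec A 0) x),
    Real.arctan (inner ℝ (colVec A 1) x / inner ℝ (colVec A 2) x), r]

theorem sum_inner_sq (A : O3) {x : R3} (hx : ‖x‖ = 1) :
    inner ℝ (colVec A 0) x ^ 2 + inner ℝ (colVec A 1) x ^ 2 + inner ℝ (colVec A 2) x ^ 2
      = (1 : ℝ) := by
  have h1 : inner ℝ x x = (1 : ℝ) := by rw [real_inner_self_eq_norm_sq, hx]; norm_num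
  nth_rewrite 1 [colVec_expand A x] at h1
  simp only [inner_add_left, inner_smul_left, conj_trivial] at h1
  linarith

theorem chart_chartInv (A : O3) {x : R3} (hx : ‖x‖ = 1) (r : ℝ)
    (hpos : 0 < inner ℝ (colVec A 2) x) :
    chart A (chartInv A x r) = (x, r) ∧ chartInv A x r ∈ chartDom := by
  have hsum := sum_inner_sq A hx
  have hexp := colVec_expand A x
  set b := inner ℝ (colVec A 0) x with hb
  set q := inner ℝ (colVec A 1) x with hq
  set p := inner ℝ (colVec A 2) x with hp
  have hsq : 0 < Real.sqrt (1 + (q / p) ^ 2) := Real.sqrt_pos.2 (by positivity)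
  -- From b² + q² + p² = 1 the cosine of the latitude is √(p² + q²), and p > 0 allows p to be taken
  -- out of the root. Here p > 0 says that x lies in the open hemisphere about column 2.
  have hcos : Real.cos (Real.arcsin b) = p * Real.sqrt (1 + (q / p) ^ 2) := by
    rw [Real.cos_arcsin, ← Real.sqrt_sq hpos.le, ← Real.sqrt_mul (sq_nonneg _)]
    congr 1
    rw [Real.sqrt_sq hpos.le]
    field_simp
    linarith
  have hsin : Real.sin (Real.arcsin b) = b :=
    Real.sin_arcsin (by nlinarith [sq_nonneg q]) (by nlinarith [sq_nonneg q])
  constructor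
  · refine Prod.ext ?_ (by simp [chart, chartInv])
    simp only [chart, chartFrame, chartInv, flow, cols, Matrix.cons_val_zero, Matrix.cons_val_one]
    rw [← hb, ← hq, ← hp, hcos, hsin, Real.cos_arctan, Real.sin_arctan]
    refine Eq.trans ?_ hexp.symm
    rw [smul_add, smul_smul, smul_smul]
    have e1 : p * Real.sqrt (1 + (q / p) ^ 2) * (1 / Real.sqrt (1 + (q / p) ^ 2)) = p := by
      field_simp
    have e2 : p * Real.sqrt (1 + (q / p) ^ 2) * (q / p / Real.sqrt (1 + (q / p) ^ 2)) = q := by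
      field_simp
    rw [e1, e2]
    abel
  · show 0 < Real.cos (chartInv A x r 0)
    simp only [chartInv, Matrix.cons_val_zero]
    rw [← hb, hcos]
    positivity

/-- The coefficients of the tangential part of a vector with respect to the coordinate fields of
`chart A`. -/
def chartCoef (A : O3) (y : Fin 3 → ℝ) (v : Amb) (k : Fin 3) : ℝ :=
  ![inner ℝ (chartFrame (cols A) y).1 v.1,
    inner ℝ (chartFrame (cols A) y).2.1 v.1 / Real.cos (y 0), v.2] k

theorem tanProj_eq_sum_coordVec (A : O3) {x : R3} (hx : ‖x‖ = 1) (r : ℝ)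
    (hpos : 0 < inner ℝ (colVec A 2) x) (v : Amb) :
    tanProj x v = ∑ k, chartCoef A (chartInv A x r) v k • coordVec (chart A) k (chartInv A x r) := by
  obtain ⟨h1, h2⟩ := chart_chartInv A hx r hpos
  set y := chartInv A x r with hy
  have hcos : Real.cos (y 0) ≠ 0 := (show 0 < Real.cos (y 0) from h2).ne'
  have hB : colVec (chartRot A y) 2 = x := by
    rw [chart_eq] at h1
    exact congrArg Prod.fst h1
  simp only [coordVec_chart, Fin.sum_univ_three, chartCoef, ← cols_chartRot]
  have hexp := colVec_expand (chartRot A y) v.1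
  rw [hB] at hexp
  refine Prod.ext ?_ ?_
  · simp only [tanProj, frameVec, latWeight, cols]
    rw [sub_eq_iff_eq_add]
    nth_rewrite 1 [hexp]
    simp [smul_smul, hcos]
  · simp [tanProj, frameVec, latWeight]

/-- Smoothness is given in charts only. Around a given state the base point stays in the hemisphere
about column 2 of a suitable A. There the projected frame vectors are combinations of the coordinate
fields of `chart A` with smooth coefficients. Normalizing the base point and projecting the vectors
in `comp` extends the components to all triples with nonzero base point, so that ordinary Fréchet
derivatives are available; at orthonormal frames nothing changes. -/
theorem contDiffOn_comp {I : Set ℝ} {h : ℝ → Tensor₂} (hflow : IsLinearizedRicciDeTurckFlow I h)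
    (i j : Fin 3) : ContDiffOn ℝ (⊤ : ℕ∞) (comp h i j) (dom I) := by
  refine contDiffOn_of_locally_contDiffOn fun z₀ hz₀ => ?_
  obtain ⟨A, hA⟩ := exists_colVec_two_eq (norm_basePt hz₀.1)
  set W : Set St := {z | 0 < inner ℝ (colVec A 2) z.1.2.2} with hW
  have hWo : IsOpen W := isOpen_lt continuous_const (by fun_prop)
  refine ⟨W, hWo, ?_, ?_⟩
  · show 0 < inner ℝ (colVec A 2) z₀.1.2.2
    rw [hA, basePt, inner_smul_left, real_inner_self_eq_norm_sq]
    have := norm_pos_iff.2 hz₀.1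
    simp only [conj_trivial]
    positivity
  have hne : ∀ z ∈ W, z.1.2.2 ≠ 0 := by
    intro z hz h0
    have : 0 < inner ℝ (colVec A 2) z.1.2.2 := hz
    rw [h0, inner_zero_right] at this
    exact lt_irrefl _ this
  have hpos : ∀ z ∈ W, 0 < inner ℝ (colVec A 2) (basePt z.1) := by
    intro z hz
    have h1 := norm_pos_iff.2 (hne z hz)
    have h2 : 0 < inner ℝ (colVec A 2) z.1.2.2 := hz
    rw [basePt, inner_smul_right]
    positivity
  have hc2 : ContDiff ℝ (⊤ : ℕ∞) fun z : St => z.1.2.2 := by fun_prop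
  have hbp : ContDiffOn ℝ (⊤ : ℕ∞) (fun z : St => basePt z.1) W := by
    unfold basePt
    exact ((hc2.contDiffOn.norm ℝ hne).inv fun z hz => (norm_pos_iff.2 (hne z hz)).ne').smul
      hc2.contDiffOn
  have hin : ∀ k, ContDiffOn ℝ (⊤ : ℕ∞) (fun z : St => (inner ℝ (colVec A k) (basePt z.1) : ℝ)) W :=
    fun k => contDiffOn_const.inner ℝ hbp
  have hy : ContDiffOn ℝ (⊤ : ℕ∞) (fun z : St => chartInv A (basePt z.1) z.2.1) W := by
    rw [contDiffOn_pi]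
    intro k
    match k with
    | 0 =>
      refine fun z hz => ContDiffAt.comp_contDiffWithinAt z (g := Real.arcsin)
        (Real.contDiffAt_arcsin ?_ ?_) (hin 0 z hz)
      all_goals
        have h1 := sum_inner_sq A (norm_basePt (hne z hz))
        have h2 := hpos z hz
        intro h3
        rw [h3] at h1
        nlinarith [sq_nonneg (inner ℝ (colVec A 1) (basePt z.1))]
    | 1 =>
      exact Real.contDiff_arctan.comp_contDiffOn ((hin 1).div (hin 2) fun z hz => (hpos z hz).ne')
    | 2 =>
      have : ContDiff ℝ (⊤ : ℕ∞) fun z : St => z.2.1 := by fun_prop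
      exact this.contDiffOn
  have hF : ContDiffOn ℝ (⊤ : ℕ∞)
      (fun z : St => chartFrame (cols A) (chartInv A (basePt z.1) z.2.1)) W :=
    (contDiff_chartFrame (cols A)).comp_contDiffOn hy
  have hv : ∀ i, ContDiff ℝ (⊤ : ℕ∞) fun z : St => frameVec z.1 i := by
    intro i
    match i with
    | 0 => simp only [frameVec, Matrix.cons_val_zero]; fun_prop
    | 1 => simp only [frameVec, Matrix.cons_val_one, Matrix.cons_val_zero]; fun_prop
    | 2 => exact contDiff_const
  have hκ : ∀ i k, ContDiffOn ℝ (⊤ : ℕ∞)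
      (fun z : St => chartCoef A (chartInv A (basePt z.1) z.2.1) (frameVec z.1 i) k) W := by
    intro i k
    match k with
    | 0 => exact (contDiff_fst.comp_contDiffOn hF).inner ℝ (contDiff_fst.comp (hv i)).contDiffOn
    | 1 =>
      refine ((contDiff_fst.comp_contDiffOn (contDiff_snd.comp_contDiffOn hF)).inner ℝ
        (contDiff_fst.comp (hv i)).contDiffOn).div (Real.contDiff_cos.comp_contDiffOn
          ((contDiffOn_pi.1 hy) 0)) fun z hz => ?_
      exact (show 0 < Real.cos _ from
        (chart_chartInv A (norm_basePt (hne z hz)) z.2.1 (hpos z hz)).2).ne'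
    | 2 => exact (contDiff_snd.comp (hv i)).contDiffOn
  have hT : ∀ k l, ContDiffOn ℝ (⊤ : ℕ∞) (fun z : St =>
      tensorCoeff (chart A) (h z.2.2) (chartInv A (basePt z.1) z.2.1) k l) (dom I ∩ W) := by
    intro k l
    have h1 : ContDiff ℝ (⊤ : ℕ∞) fun z : St => z.2.2 := by fun_prop
    exact (hflow.smooth _ _ (isLocalParam_chart A) k l).comp
      ((hy.mono inter_subset_right).prodMk h1.contDiffOn) fun z hz =>
        ⟨(chart_chartInv A (norm_basePt (hne z hz.2)) z.2.1 (hpos z hz.2)).2, hz.1.2⟩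
  have hsum : ContDiffOn ℝ (⊤ : ℕ∞) (fun z : St => ∑ k, ∑ l,
      chartCoef A (chartInv A (basePt z.1) z.2.1) (frameVec z.1 i) k *
      chartCoef A (chartInv A (basePt z.1) z.2.1) (frameVec z.1 j) l *
      tensorCoeff (chart A) (h z.2.2) (chartInv A (basePt z.1) z.2.1) k l) (dom I ∩ W) :=
    ContDiffOn.sum fun k _ => ContDiffOn.sum fun l _ =>
      (((hκ i k).mono inter_subset_right).mul ((hκ j l).mono inter_subset_right)).mul (hT k l)
  refine hsum.congr fun z hz => ?_
  have hn := norm_basePt (hne z hz.2)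
  have h1 := (chart_chartInv A hn z.2.1 (hpos z hz.2)).1
  rw [comp, tanProj_eq_sum_coordVec A hn z.2.1 (hpos z hz.2) (frameVec z.1 i),
    tanProj_eq_sum_coordVec A hn z.2.1 (hpos z hz.2) (frameVec z.1 j)]
  simp only [map_sum, LinearMap.sum_apply, map_smul, LinearMap.smul_apply, smul_eq_mul,
    tensorCoeff, Matrix.of_apply, h1]
  simp only [Finset.mul_sum]
  rw [Finset.sum_comm]
  refine Finset.sum_congr rfl fun k _ => ?_
  refine Finset.sum_congr rfl fun l _ => ?_
  ring

end RoundCylinder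
end

noncomputable section
open MeasureTheory Set

namespace RoundCylinder

/-! ### The equation in terms of frames -/

/-- Reduces a repeated partial derivative to one-variable calculus along a coordinate line, where
`flow` is explicit. -/
theorem pd_pd_eq {n : ℕ} {f : (Fin n → ℝ) → ℝ} {y : Fin n → ℝ} {k : Fin n} {φ' : ℝ → ℝ} {D : ℝ}
    (hf : ContDiffAt ℝ 2 f y)
    (h1 : ∀ᶠ θ in nhds (0 : ℝ),
      HasDerivAt (fun θ : ℝ => f (y + θ • (Pi.single k 1 : Fin n → ℝ))) (φ' θ) θ)
    (h2 : HasDerivAt φ' D 0) : LocalCoords.pd k (LocalCoords.pd k f) y = D := by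
  have hd : DifferentiableAt ℝ (LocalCoords.pd k f) y :=
    (((hf.fderiv_right (m := 1) (by norm_num)).differentiableAt (by norm_num))).clm_apply
      (differentiableAt_const _)
  have hline : ContinuousAt (fun θ : ℝ => y + θ • (Pi.single k 1 : Fin n → ℝ)) 0 := by fun_prop
  have hev : ∀ᶠ z in nhds y, DifferentiableAt ℝ f z := by
    filter_upwards [hf.eventually (by norm_num)] with z hz using hz.differentiableAt (by norm_num)
  have hev' : ∀ᶠ θ in nhds (0 : ℝ),
      DifferentiableAt ℝ f (y + θ • (Pi.single k 1 : Fin n → ℝ)) :=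
    hline.eventually (by simpa using hev)
  have e : φ' =ᶠ[nhds 0] fun θ => LocalCoords.pd k f (y + θ • (Pi.single k 1 : Fin n → ℝ)) := by
    filter_upwards [h1, hev'] with θ h3 h4 using (fderiv_single_eq h4 h3).symm
  have h3 := h2.congr_of_eventuallyEq e.symm
  have hd' : DifferentiableAt ℝ (LocalCoords.pd k f)
      (y + (0 : ℝ) • (Pi.single k 1 : Fin n → ℝ)) := by simpa using hd
  have := fderiv_single_eq hd' h3
  simpa [LocalCoords.pd] using this

/-- The number of directions tangent to the sphere. -/
def sphDeg (i : Fin 3) : ℝ := if i = 2 then 0 else 1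

theorem hasDerivAt_latWeight (i : Fin 3) (φ : ℝ) :
    HasDerivAt (fun x => latWeight x i) (if i = 1 then -Real.sin φ else 0) φ := by
  match i with
  | 0 => simpa [latWeight] using hasDerivAt_const φ (1 : ℝ)
  | 1 => simpa [latWeight] using Real.hasDerivAt_cos φ
  | 2 => simpa [latWeight] using hasDerivAt_const φ (1 : ℝ)

section Equation

variable {I : Set ℝ} {h : ℝ → Tensor₂}

theorem smooth_comp (hflow : IsLinearizedRicciDeTurckFlow I h) (i j : Fin 3) :
    Smooth (interior I) (comp h i j) :=
  (contDiffOn_comp hflow i j).mono fun _ hz => ⟨hz.1, interior_subset hz.2⟩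

/-- The base point of `cols A` at height `r` in the chart `chart A`. -/
def chartOrigin (r : ℝ) : Fin 3 → ℝ := ![0, 0, r]

theorem chartFrame_origin (c : Fr) (r : ℝ) : chartFrame c (chartOrigin r) = c := by
  simp [chartFrame, chartOrigin, flow_zero]

theorem latWeight_zero (i : Fin 3) : latWeight 0 i = 1 := by
  fin_cases i <;> simp [latWeight]

theorem tensorCoeff_origin (A : O3) (r t : ℝ) (i j : Fin 3) :
    tensorCoeff (chart A) (h t) (chartOrigin r) i j = comp h i j (cols A, r, t) := by
  rw [tensorCoeff_chart_comp, chartFrame_origin]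
  simp [chartOrigin, latWeight_zero]

theorem origin_mem_chartDom (r : ℝ) : chartOrigin r ∈ chartDom := by
  simp [chartDom, chartOrigin]

theorem contDiffAt_tensorCoeff (hflow : IsLinearizedRicciDeTurckFlow I h) (A : O3) (r : ℝ) {t : ℝ}
    (ht : t ∈ I) (i j : Fin 3) :
    ContDiffAt ℝ 2 (fun z => tensorCoeff (chart A) (h t) z i j) (chartOrigin r) := by
  have h1 : ContDiffOn ℝ (⊤ : ℕ∞) (fun z => tensorCoeff (chart A) (h t) z i j) chartDom :=
    (hflow.smooth _ _ (isLocalParam_chart A) i j).comp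
      (f := fun y : Fin 3 → ℝ => (y, t)) (by fun_prop) fun y hy => ⟨hy, ht⟩
  exact (h1.contDiffAt ((isLocalParam_chart A).isOpen.mem_nhds (origin_mem_chartDom r))).of_le
    (WithTop.coe_le_coe.2 (le_top : (2 : ℕ∞) ≤ ⊤))

theorem pd_pd_tensorCoeff_two (hflow : IsLinearizedRicciDeTurckFlow I h) (A : O3) (r : ℝ) {t : ℝ}
    (ht : t ∈ interior I) (i j : Fin 3) :
    LocalCoords.pd 2 (LocalCoords.pd 2 fun z => tensorCoeff (chart A) (h t) z i j) (chartOrigin r)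
      = dR (dR (comp h i j)) (cols A, r, t) := by
  have hS := smooth_comp hflow i j
  refine pd_pd_eq (contDiffAt_tensorCoeff hflow A r (interior_subset ht) i j)
    (φ' := fun θ => dR (comp h i j) (cols A, r + θ, t)) (Filter.Eventually.of_forall fun θ => ?_) ?_
  · have h1 := (hS.hasDerivAt_dR isOpen_interior (cols_mem_dom A (r + θ) ht)).comp_const_add r θ
    refine h1.congr_of_eventuallyEq (Filter.Eventually.of_forall fun x => ?_)
    show tensorCoeff (chart A) (h t) _ i j = _
    have e : chartOrigin r + x • (Pi.single 2 1 : Fin 3 → ℝ) = chartOrigin (r + x) := by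
      ext k; fin_cases k <;> simp [chartOrigin]
    rw [e, tensorCoeff_origin]
  · have h1 := ((hS.dR isOpen_interior).hasDerivAt_dR isOpen_interior
      (cols_mem_dom A (r + 0) ht)).comp_const_add r 0
    simpa using h1

theorem pd_pd_tensorCoeff_one (hflow : IsLinearizedRicciDeTurckFlow I h) (A : O3) (r : ℝ) {t : ℝ}
    (ht : t ∈ interior I) (i j : Fin 3) :
    LocalCoords.pd 1 (LocalCoords.pd 1 fun z => tensorCoeff (chart A) (h t) z i j) (chartOrigin r)
      = dX 1 (dX 1 (comp h i j)) (cols A, r, t) := by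
  have hS := smooth_comp hflow i j
  have hmem : ∀ θ, (flow 1 θ (cols A), r, t) ∈ dom (interior I) := fun θ => by
    rw [← cols_mul_rot]; exact cols_mem_dom _ r ht
  refine pd_pd_eq (contDiffAt_tensorCoeff hflow A r (interior_subset ht) i j)
    (φ' := fun θ => dX 1 (comp h i j) (flow 1 θ (cols A), r, t))
    (Filter.Eventually.of_forall fun θ => ?_) ?_
  · have h1 := hS.hasDerivAt_flow isOpen_interior 1 θ (hmem θ)
    refine h1.congr_of_eventuallyEq (Filter.Eventually.of_forall fun x => ?_)
    show tensorCoeff (chart A) (h t) _ i j = _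
    rw [tensorCoeff_chart_comp]
    simp [chartOrigin, chartFrame, flow_zero, latWeight_zero]
  · have h1 := (hS.dX isOpen_interior 1).hasDerivAt_flow isOpen_interior 1 0 (hmem 0)
    simpa only [flow_zero] using h1

/-- The zeroth-order term is the second derivative at latitude 0 of the weights cos φ, one for each
longitude index. -/
theorem pd_pd_tensorCoeff_zero (hflow : IsLinearizedRicciDeTurckFlow I h) (A : O3) (r : ℝ) {t : ℝ}
    (ht : t ∈ interior I) (i j : Fin 3) :
    LocalCoords.pd 0 (LocalCoords.pd 0 fun z => tensorCoeff (chart A) (h t) z i j) (chartOrigin r)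
      = dX 0 (dX 0 (comp h i j)) (cols A, r, t)
        - ((if i = 1 then 1 else 0) + (if j = 1 then 1 else 0)) * comp h i j (cols A, r, t) := by
  have hS := smooth_comp hflow i j
  have hmem : ∀ θ, (flow 0 θ (cols A), r, t) ∈ dom (interior I) := fun θ => by
    rw [← cols_mul_rot]; exact cols_mem_dom _ r ht
  have hwd := hasDerivAt_latWeight
  have hwd' : ∀ i : Fin 3, HasDerivAt (fun φ => if i = 1 then -Real.sin φ else 0)
      (if i = 1 then -1 else 0) 0 := by
    intro i
    split_ifs
    · exact (Real.hasDerivAt_sin 0).neg.congr_deriv (by simp)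
    · exact hasDerivAt_const _ _
  have hS1 := fun θ => hS.hasDerivAt_flow isOpen_interior 0 θ (hmem θ)
  have hS2 := (hS.dX isOpen_interior 0).hasDerivAt_flow isOpen_interior 0 0 (hmem 0)
  refine pd_pd_eq (contDiffAt_tensorCoeff hflow A r (interior_subset ht) i j)
    (φ' := fun θ => ((if i = 1 then -Real.sin θ else 0) * latWeight θ j
        + latWeight θ i * (if j = 1 then -Real.sin θ else 0)) * comp h i j (flow 0 θ (cols A), r, t)
      + latWeight θ i * latWeight θ j * dX 0 (comp h i j) (flow 0 θ (cols A), r, t))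
    (Filter.Eventually.of_forall fun θ => ?_) ?_
  · have h1 := ((hwd i θ).mul (hwd j θ)).mul (hS1 θ)
    refine h1.congr_of_eventuallyEq (Filter.Eventually.of_forall fun x => ?_)
    show tensorCoeff (chart A) (h t) _ i j = _
    rw [tensorCoeff_chart_comp]
    simp [chartOrigin, chartFrame, flow_zero]
  · have h1 := ((((hwd' i).mul (hwd j 0)).add ((hwd i 0).mul (hwd' j))).mul (hS1 0)).add
      (((hwd i 0).mul (hwd j 0)).mul hS2)
    refine h1.congr_deriv ?_
    simp only [flow_zero, latWeight_zero, Pi.mul_apply, Pi.add_apply, Real.sin_zero, neg_zero,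
      ite_self]
    split_ifs <;> ring

/-- The linearized Ricci–DeTurck equation for the components in orthonormal frames. -/
theorem frame_equation (hneg : I ⊆ Iio 0) (hflow : IsLinearizedRicciDeTurckFlow I h) (A : O3)
    (r : ℝ) {t : ℝ} (ht : t ∈ interior I) (i j : Fin 3) :
    dT (comp h i j) (cols A, r, t)
        + (-2 * t)⁻¹ * (sphDeg i + sphDeg j) * comp h i j (cols A, r, t)
      = dR (dR (comp h i j)) (cols A, r, t) + (-2 * t)⁻¹ * hLap (comp h i j) (cols A, r, t)
        + 2 * ((-2 * t)⁻¹ *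
          (if i = 0 ∧ j = 0 then comp h 1 1 (cols A, r, t)
          else if i = 1 ∧ j = 1 then comp h 0 0 (cols A, r, t)
          else if i = 0 ∧ j = 1 then -comp h 1 0 (cols A, r, t)
          else if i = 1 ∧ j = 0 then -comp h 0 1 (cols A, r, t) else 0)) := by
  have htI := interior_subset ht
  have ht0 : t < 0 := hneg htI
  have hnhds : I ∈ nhds t := mem_interior_iff_mem_nhds.1 ht
  have habs : 2 * |t| = -2 * t := by rw [abs_of_neg ht0]; ring
  have hs : -2 * t ≠ 0 := by linarith
  have hy : chartOrigin r 0 = 0 := rfl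
  have hg : ∀ᶠ z in nhds (chartOrigin r),
      metricCoeff (chart A) t z = LocalCoords.latMetric (-2 * t) z :=
    Filter.Eventually.of_forall fun z => by rw [metricCoeff_chart, habs]
  have heq := hflow.equation _ _ (isLocalParam_chart A) t htI _ (origin_mem_chartDom r) i j
  rw [LocalCoords.laplacian_equator hs hy hg _
      (fun i j => contDiffAt_tensorCoeff hflow A r htI i j),
    LocalCoords.rmAction_equator hs hy hg,
    pd_pd_tensorCoeff_zero hflow A r ht, pd_pd_tensorCoeff_one hflow A r ht,
    pd_pd_tensorCoeff_two hflow A r ht] at heq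
  have hdT : derivWithin (fun s => tensorCoeff (chart A) (h s) (chartOrigin r) i j) I t
      = dT (comp h i j) (cols A, r, t) := by
    rw [derivWithin_of_mem_nhds hnhds]
    simp only [tensorCoeff_origin]
    exact ((smooth_comp hflow i j).hasDerivAt_dT isOpen_interior (cols_mem_dom A r ht)).deriv
  have hdg : ∀ p q, derivWithin (fun s => metricCoeff (chart A) s (chartOrigin r) p q) I t
      = if p = q then -2 * sphDeg p else 0 := by
    intro p q
    rw [derivWithin_of_mem_nhds hnhds]
    have e : (fun s => metricCoeff (chart A) s (chartOrigin r) p q)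
        =ᶠ[nhds t] fun s => if p = q then -2 * s * sphDeg p + (1 - sphDeg p) else 0 := by
      filter_upwards [Iio_mem_nhds ht0] with s hs
      have hs0 : s < 0 := hs
      have : 2 * |s| = -2 * s := by rw [abs_of_neg hs0]; ring
      rw [metricCoeff_chart, this]
      fin_cases p <;> fin_cases q <;>
        simp [LocalCoords.latMetric, sphDeg, chartOrigin]
    rw [e.deriv_eq]
    split_ifs
    · have : HasDerivAt (fun s => -2 * s * sphDeg p + (1 - sphDeg p)) (-2 * 1 * sphDeg p) t :=
        (((hasDerivAt_id t).const_mul (-2)).mul_const _).add_const _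
      rw [this.deriv]; ring
    · simp
  -- Each spherical index contributes (-2t)⁻¹, since ∂ₜg = -2 in spherical directions while g = -2t
  -- there.
  have huhl : LocalCoords.uhlenbeckDeriv I (metricCoeff (chart A))
      (fun s => tensorCoeff (chart A) (h s)) i j t (chartOrigin r)
      = dT (comp h i j) (cols A, r, t)
        + (-2 * t)⁻¹ * (sphDeg i + sphDeg j) * comp h i j (cols A, r, t) := by
    unfold LocalCoords.uhlenbeckDeriv
    rw [hdT, LocalCoords.latMetric_inv_equator hs hy hg]
    simp only [hdg, tensorCoeff_origin, Fin.sum_univ_three]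
    fin_cases i <;> fin_cases j <;> simp [sphDeg] <;> ring
  rw [huhl] at heq
  rw [heq]
  -- The zeroth-order term of `laplacian_equator` cancels the one coming from the latitude weights,
  -- which leaves the bare horizontal Laplacian.
  simp only [tensorCoeff_origin, hLap]
  ring

end Equation

end RoundCylinder
end

noncomputable section
open MeasureTheory Set

namespace RoundCylinder

/-! ### Polynomials as frame functions, and the Poincaré inequality on the sphere -/

open SpherePoly

/-- A polynomial as a function of the base point of a frame. -/
def polyFn (p : Poly) (z : St) : ℝ := ev p z.1.2.2

theorem smooth_polyFn (J : Set ℝ) (p : Poly) : Smooth J (polyFn p) := by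
  have h1 : ContDiff ℝ (⊤ : ℕ∞) fun z : St => z.1.2.2 := by fun_prop
  exact ((contDiff_ev p).comp h1).contDiffOn

theorem hasFDerivAt_polyFn (p : Poly) (z : St) : HasFDerivAt (polyFn p)
    ((∑ i, ev (MvPolynomial.pderiv i p) z.1.2.2 • EuclideanSpace.proj (𝕜 := ℝ) i) ∘L
      (ContinuousLinearMap.snd ℝ R3 R3 ∘L ContinuousLinearMap.snd ℝ R3 (R3 × R3) ∘L
        ContinuousLinearMap.fst ℝ Fr (ℝ × ℝ))) z := by
  have h1 : HasFDerivAt (fun z : St => z.1.2.2) (ContinuousLinearMap.snd ℝ R3 R3 ∘L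
    ContinuousLinearMap.snd ℝ R3 (R3 × R3) ∘L ContinuousLinearMap.fst ℝ Fr (ℝ × ℝ)) z :=
    (ContinuousLinearMap.snd ℝ R3 R3 ∘L ContinuousLinearMap.snd ℝ R3 (R3 × R3) ∘L
      ContinuousLinearMap.fst ℝ Fr (ℝ × ℝ)).hasFDerivAt
  exact (hasFDerivAt_ev p z.1.2.2).comp z h1

theorem fderiv_polyFn (p : Poly) (z v : St) :
    fderiv ℝ (polyFn p) z v = ∑ i, ev (MvPolynomial.pderiv i p) z.1.2.2 * v.1.2.2 i := by
  rw [(hasFDerivAt_polyFn p z).fderiv]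
  simp

theorem dX_zero_polyFn (p : Poly) :
    dX 0 (polyFn p) = fun z => ∑ i, polyFn (MvPolynomial.pderiv i p) z * z.1.1 i := by
  funext z
  rw [dX, fderiv_polyFn]
  rfl

theorem dX_one_polyFn (p : Poly) :
    dX 1 (polyFn p) = fun z => ∑ i, polyFn (MvPolynomial.pderiv i p) z * z.1.2.1 i := by
  funext z
  rw [dX, fderiv_polyFn]
  rfl

theorem dX_polyFn_mul (k : Fin 3) (p : Fin 3 → Poly) (L : St →L[ℝ] R3) (z : St) :
    dX k (fun z => ∑ i, polyFn (p i) z * L z i) z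
      = ∑ i, ((∑ j, polyFn (MvPolynomial.pderiv j (p i)) z * (xi k z.1).2.2 j) * L z i
        + polyFn (p i) z * L (xi k z.1, 0) i) := by
  have h : HasFDerivAt (fun z => ∑ i, polyFn (p i) z * L z i) _ z :=
    HasFDerivAt.fun_sum fun i _ => (hasFDerivAt_polyFn (p i) z).mul
      ((EuclideanSpace.proj (𝕜 := ℝ) i ∘L L).hasFDerivAt)
  rw [dX, h.fderiv]
  simp only [sum_apply, add_apply, smul_apply, ContinuousLinearMap.comp_apply, smul_eq_mul]
  refine Finset.sum_congr rfl fun i _ => ?_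
  simp [polyFn]
  ring

/-- The two squares give the trace of the Hessian over the tangent plane. Differentiating the fields
once more turns each tangent vector into minus the base point, whence the term -2 ∂ₓ. Orthonormality
of the frame is essential. -/
theorem hLap_polyFn (p : Poly) (A : O3) (r t : ℝ) :
    hLap (polyFn p) (cols A, r, t) = polyFn (sphereLaplacian p) (cols A, r, t) := by
  have h0 := dX_polyFn_mul 0 (fun i => MvPolynomial.pderiv i p)
    (ContinuousLinearMap.fst ℝ R3 (R3 × R3) ∘L ContinuousLinearMap.fst ℝ Fr (ℝ × ℝ))
    (cols A, r, t)
  have h1 := dX_polyFn_mul 1 (fun i => MvPolynomial.pderiv i p)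
    (ContinuousLinearMap.fst ℝ R3 R3 ∘L ContinuousLinearMap.snd ℝ R3 (R3 × R3) ∘L
      ContinuousLinearMap.fst ℝ Fr (ℝ × ℝ)) (cols A, r, t)
  have e0 := (congrFun (congrArg (dX 0) (dX_zero_polyFn p)) (cols A, r, t)).trans h0
  have e1 := (congrFun (congrArg (dX 1) (dX_one_polyFn p)) (cols A, r, t)).trans h1
  have e2 := ev_sphereLaplacian p (colVec A 2) (colVec A 0) (colVec A 1) (sum_colVec_mul A)
  rw [hLap, e0, e1]
  show _ = ev (sphereLaplacian p) (colVec A 2)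
  rw [e2]
  simp only [polyFn, cols, xi_zero, xi_one, ContinuousLinearMap.comp_apply,
    ContinuousLinearMap.coe_fst', ContinuousLinearMap.coe_snd', Fin.sum_univ_three,
    PiLp.neg_apply]
  ring

/-- The unit sphere. -/
abbrev Sph : Type := Metric.sphere (0 : R3) 1

theorem colVec_mem_sphere (A : O3) : colVec A 2 ∈ Metric.sphere (0 : R3) 1 := by
  simpa using norm_colVec A 2

/-- The base point of an orthogonal frame. -/
def baseMap : C(O3, Sph) :=
  ⟨fun A => ⟨colVec A 2, colVec_mem_sphere A⟩, (continuous_colVec 2).subtype_mk _⟩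

/-- Restriction of polynomials to the sphere. -/
def restr : Poly →ₐ[ℝ] C(Sph, ℝ) :=
  MvPolynomial.aeval fun i => ⟨fun x => x.1 i, by fun_prop⟩

theorem restr_apply (p : Poly) (x : Sph) : restr p x = ev p x.1 := by
  induction p using MvPolynomial.induction_on with
  | C a => simp [restr, ev]
  | add p q hp hq => simp only [map_add, ContinuousMap.add_apply, hp, hq]; simp [ev]
  | mul_X p i hp => simp only [map_mul, ContinuousMap.mul_apply, hp]; simp [ev, restr]

theorem closure_range_restr : closure (range restr) = univ := by
  have h : (restr.range).SeparatesPoints := by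
    intro x y hxy
    have : ∃ i, x.1 i ≠ y.1 i := by
      by_contra! h
      exact hxy (Subtype.ext (by ext i; exact h i))
    obtain ⟨i, hi⟩ := this
    refine ⟨_, ⟨restr (MvPolynomial.X i), ⟨_, rfl⟩, rfl⟩, ?_⟩
    simpa [restr_apply, ev] using hi
  have h2 := ContinuousMap.subalgebra_topologicalClosure_eq_top_of_separatesPoints _ h
  have h3 := congrArg (fun S : Subalgebra ℝ C(Sph, ℝ) => (S : Set C(Sph, ℝ))) h2
  simpa using h3

/-- Restriction to the sphere as a map to `L²(O(3))`. -/
def restrL2 : Poly →ₗ[ℝ] Lp ℝ 2 haarO3 :=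
  (ContinuousMap.toLp (E := ℝ) 2 haarO3 ℝ).toLinearMap ∘ₗ
    (ContinuousMap.compRightAlgHom ℝ ℝ baseMap).toLinearMap ∘ₗ restr.toLinearMap

theorem restrL2_apply (p : Poly) :
    restrL2 p = ContinuousMap.toLp (E := ℝ) 2 haarO3 ℝ ((restr p).comp baseMap) := rfl

/-- Uniform density of polynomials passes to L² because the passage to L² is continuous. This
supplies the closure hypothesis of `spectral_gap_of_mem_closure`. -/
theorem toLp_mem_closure (g : C(Sph, ℝ)) :
    ContinuousMap.toLp (E := ℝ) 2 haarO3 ℝ (g.comp baseMap) ∈ closure (range restrL2) := by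
  have hg : g ∈ closure (range restr) := by rw [closure_range_restr]; trivial
  have hcont : Continuous fun g : C(Sph, ℝ) =>
      ContinuousMap.toLp (E := ℝ) 2 haarO3 ℝ (g.comp baseMap) :=
    (ContinuousMap.toLp (E := ℝ) 2 haarO3 ℝ).continuous.comp (ContinuousMap.continuous_precomp _)
  have h1 := image_closure_subset_closure_image hcont ⟨g, hg, rfl⟩
  rwa [← range_comp] at h1

theorem inner_toLp_eq (f g : C(O3, ℝ)) :
    inner ℝ (ContinuousMap.toLp (E := ℝ) 2 haarO3 ℝ f) (ContinuousMap.toLp (E := ℝ) 2 haarO3 ℝ g)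
      = ∫ A, f A * g A ∂haarO3 := by
  rw [ContinuousMap.inner_toLp]
  simp [mul_comm]

/-- The sharp Poincaré inequality for functions on the sphere which are orthogonal to all
polynomials of degree less than `k`. -/
theorem poincare {J : Set ℝ} (hJ : IsOpen J) {Y : St → ℝ} (hY : Smooth J Y) (r : ℝ) {t : ℝ}
    (ht : t ∈ J) (g : C(Sph, ℝ)) (hg : ∀ A, Y (cols A, r, t) = g (baseMap A)) (k : ℕ)
    (hort : ∀ j < k, ∀ p ∈ degLE j, avg (fun z => Y z * polyFn p z) r t = 0) :
    (k : ℝ) * (k + 1) * avg (fun z => Y z * Y z) r t ≤ -avg (fun z => Y z * hLap Y z) r t := by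
  have hLc : Continuous fun A : O3 => hLap Y (cols A, r, t) :=
    ((((hY.dX hJ 0).dX hJ 0)).add (((hY.dX hJ 1).dX hJ 1))).continuous_cols r ht
  set u := ContinuousMap.toLp (E := ℝ) 2 haarO3 ℝ (g.comp baseMap) with hu
  set v := ContinuousMap.toLp (E := ℝ) 2 haarO3 ℝ ⟨_, hLc⟩ with hv
  have hpe : ∀ p A, (restr p).comp baseMap A = polyFn p (cols A, r, t) := fun p A => by
    rw [ContinuousMap.comp_apply, restr_apply]; rfl
  have hge : ∀ A, g.comp baseMap A = Y (cols A, r, t) := fun A => by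
    rw [ContinuousMap.comp_apply, hg]
  have hup : ∀ p, inner ℝ u (restrL2 p) = avg (fun z => Y z * polyFn p z) r t := by
    intro p
    rw [hu, restrL2_apply, inner_toLp_eq]
    simp only [hpe, hge, avg]
  have hpp : ∀ p q, inner ℝ (restrL2 p) (restrL2 q)
      = avg (fun z => polyFn p z * polyFn q z) r t := by
    intro p q
    rw [restrL2_apply, restrL2_apply, inner_toLp_eq]
    simp only [hpe, avg]
  have hlap : ∀ (Z : St → ℝ) p, avg (fun z => Z z * polyFn (sphereLaplacian p) z) r t
      = avg (fun z => Z z * hLap (polyFn p) z) r t := by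
    intro Z p
    simp only [avg, hLap_polyFn]
  -- The class v of `hLap Y` enters only through the weak identity ⟨v, p⟩ = ⟨u, Δp⟩, so it is enough
  -- to approximate u itself by polynomials; no convergence of Laplacians is needed.
  have key := spectral_gap_of_mem_closure restrL2 sphereLaplacian degLE
    (fun N => (N : ℝ) * (N + 1)) degLE_mono
    (fun p => ⟨p.totalDegree, (MvPolynomial.mem_restrictTotalDegree _ _ _).2 le_rfl⟩)
    (fun a b hab => by simp only; gcongr)
    (fun p hp => by rw [sphereLaplacian_of_mem_degLE_zero p hp]; simp)
    sphereLaplacian_add_mem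
    (fun p q => by
      rw [real_inner_comm, hpp, hpp, hlap, hlap]
      exact avg_mul_hLap_comm hJ (smooth_polyFn J q) (smooth_polyFn J p) r ht)
    k (u := u) (v := v) (toLp_mem_closure g)
    (fun p => by
      rw [hup, hlap, avg_mul_hLap_comm hJ hY (smooth_polyFn J p) r ht, hv, restrL2_apply,
        inner_toLp_eq]
      simp only [hpe, avg, ContinuousMap.coe_mk, mul_comm])
    (fun j hj q hq => by rw [hup]; exact hort j hj q hq)
  have e1 : ‖u‖ ^ 2 = avg (fun z => Y z * Y z) r t := by
    rw [← real_inner_self_eq_norm_sq, hu, inner_toLp_eq]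
    simp only [hge, avg]
  have e2 : inner ℝ v u = avg (fun z => Y z * hLap Y z) r t := by
    rw [hu, hv, inner_toLp_eq]
    simp only [hge, avg, ContinuousMap.coe_mk, mul_comm]
  rw [e1, e2] at key
  exact key

/-- Polynomials of degree at most one are affine. -/
theorem polyFn_of_mem_degLE_one {p : Poly} (hp : p ∈ degLE 1) :
    ∃ (a : ℝ) (b : Fin 3 → ℝ), ∀ z, polyFn p z = a + ∑ i, b i * z.1.2.2 i := by
  rw [MvPolynomial.mem_restrictTotalDegree] at hp
  have h1 : MvPolynomial.homogeneousComponent 1 p ∈ Submodule.span ℝ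
      (range (MvPolynomial.X : Fin 3 → Poly)) := by
    rw [← MvPolynomial.homogeneousSubmodule_one_eq_span_X]
    exact MvPolynomial.homogeneousComponent_mem 1 p
  obtain ⟨b, hb⟩ := (Submodule.mem_span_range_iff_exists_fun ℝ).1 h1
  refine ⟨MvPolynomial.coeff 0 p, b, fun z => ?_⟩
  have h2 : p = MvPolynomial.homogeneousComponent 0 p + MvPolynomial.homogeneousComponent 1 p := by
    have h3 := MvPolynomial.sum_homogeneousComponent p
    have h4 : ∑ i ∈ Finset.range (p.totalDegree + 1), MvPolynomial.homogeneousComponent i p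
        = ∑ i ∈ Finset.range 2, MvPolynomial.homogeneousComponent i p := by
      refine Finset.sum_subset (Finset.range_subset_range.2 (by omega)) fun i _ hi => ?_
      exact MvPolynomial.homogeneousComponent_eq_zero _ _ (by
        rw [Finset.mem_range] at hi; omega)
    rw [h4, Finset.sum_range_succ, Finset.sum_range_one] at h3
    exact h3.symm
  have h5 := congrArg (fun q => polyFn q z) h2
  rw [← hb, MvPolynomial.homogeneousComponent_zero] at h5
  rw [h5]
  simp [polyFn, ev, MvPolynomial.smul_eval]

end RoundCylinder
end

noncomputable section
open MeasureTheory Set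

namespace RoundCylinder

/-! ### Solutions of reaction–diffusion equations on frames -/

/-- Differentiation along a vector field. -/
def dV (V : St → St) (Y : St → ℝ) (z : St) : ℝ := fderiv ℝ Y z (V z)

section Derivations

variable {J : Set ℝ} {Y Z : St → ℝ}

/-- `dX k`, `dR` and `dT` all unfold to `dV`, so each rule is proved once. Identities are stated on
the open set `dom J`, so that they may be differentiated again. -/
theorem dV_congr (hJ : IsOpen J) (V : St → St) (h : EqOn Y Z (dom J)) :
    EqOn (dV V Y) (dV V Z) (dom J) := by
  intro z hz
  have : Y =ᶠ[nhds z] Z := Filter.eventuallyEq_of_mem ((isOpen_dom hJ).mem_nhds hz) h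
  simp [dV, this.fderiv_eq]

theorem dV_lin (hJ : IsOpen J) (V : St → St) (hY : Smooth J Y) (hZ : Smooth J Z) (a b : ℝ) :
    EqOn (dV V fun z => a * Y z + b * Z z) (fun z => a * dV V Y z + b * dV V Z z) (dom J) := by
  intro z hz
  have h : fderiv ℝ (fun z => a * Y z + b * Z z) z = _ :=
    (((hY.differentiableAt hJ hz).hasFDerivAt.const_mul a).add
      ((hZ.differentiableAt hJ hz).hasFDerivAt.const_mul b)).fderiv
  simp [dV, h]

theorem dV_dV_lin (hJ : IsOpen J) (V : St → St) (hY : Smooth J Y) (hZ : Smooth J Z)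
    (hVY : Smooth J (dV V Y)) (hVZ : Smooth J (dV V Z)) (a b : ℝ) :
    EqOn (dV V (dV V fun z => a * Y z + b * Z z))
      (fun z => a * dV V (dV V Y) z + b * dV V (dV V Z) z) (dom J) :=
  (dV_congr hJ V (dV_lin hJ V hY hZ a b)).trans (dV_lin hJ V hVY hVZ a b)

theorem dV_mul (hJ : IsOpen J) (V : St → St) (hY : Smooth J Y) (hZ : Smooth J Z) :
    EqOn (dV V fun z => Y z * Z z) (fun z => Y z * dV V Z z + Z z * dV V Y z) (dom J) := by
  intro z hz
  have h : fderiv ℝ (fun z => Y z * Z z) z = _ :=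
    ((hY.differentiableAt hJ hz).hasFDerivAt.mul (hZ.differentiableAt hJ hz).hasFDerivAt).fderiv
  simp [dV, h]

/-- A function of time as a frame function. -/
def timeFn (a : ℝ → ℝ) (z : St) : ℝ := a z.2.2

theorem smooth_timeFn {a : ℝ → ℝ} (ha : ContDiffOn ℝ (⊤ : ℕ∞) a J) : Smooth J (timeFn a) := by
  have h : ContDiff ℝ (⊤ : ℕ∞) fun z : St => z.2.2 := by fun_prop
  exact ha.comp h.contDiffOn fun z hz => hz.2

theorem dV_timeFn {a : ℝ → ℝ} {a' : ℝ} {z : St} (ha : HasDerivAt a a' z.2.2) (V : St → St) :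
    dV V (timeFn a) z = a' * (V z).2.2 := by
  have h1 : HasFDerivAt (fun z : St => z.2.2)
      (ContinuousLinearMap.snd ℝ ℝ ℝ ∘L ContinuousLinearMap.snd ℝ Fr (ℝ × ℝ)) z :=
    (ContinuousLinearMap.snd ℝ ℝ ℝ ∘L ContinuousLinearMap.snd ℝ Fr (ℝ × ℝ)).hasFDerivAt
  have h2 : fderiv ℝ (timeFn a) z = _ := (ha.comp_hasFDerivAt z h1).fderiv
  simp [dV, h2]

theorem dV_scale (hJ : IsOpen J) {V : St → St} (hV : ∀ z, (V z).2.2 = 0) (hY : Smooth J Y)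
    {a : ℝ → ℝ} (ha : ContDiffOn ℝ (⊤ : ℕ∞) a J) :
    EqOn (dV V fun z => timeFn a z * Y z) (fun z => timeFn a z * dV V Y z) (dom J) := by
  intro z hz
  have h : HasDerivAt a (deriv a z.2.2) z.2.2 :=
    ((ha.contDiffAt (hJ.mem_nhds hz.2)).differentiableAt (by simp)).hasDerivAt
  refine (dV_mul hJ V (smooth_timeFn ha) hY hz).trans ?_
  simp only [dV_timeFn h, hV]
  ring

theorem dV_dV_scale (hJ : IsOpen J) {V : St → St} (hV : ∀ z, (V z).2.2 = 0) (hY : Smooth J Y)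
    (hVY : Smooth J (dV V Y)) {a : ℝ → ℝ} (ha : ContDiffOn ℝ (⊤ : ℕ∞) a J) :
    EqOn (dV V (dV V fun z => timeFn a z * Y z)) (fun z => timeFn a z * dV V (dV V Y) z) (dom J) :=
  (dV_congr hJ V (dV_scale hJ hV hY ha)).trans (dV_scale hJ hV hVY ha)

theorem hLap_lin (hJ : IsOpen J) (hY : Smooth J Y) (hZ : Smooth J Z) (a b : ℝ) :
    EqOn (hLap fun z => a * Y z + b * Z z) (fun z => a * hLap Y z + b * hLap Z z) (dom J) := by
  intro z hz
  have h := fun k => dV_dV_lin hJ (fun z : St => ((xi k z.1, 0) : St)) hY hZ (hY.dX hJ k)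
    (hZ.dX hJ k) a b hz
  refine (congrArg₂ (· + ·) (h 0) (h 1)).trans ?_
  change (a * dX 0 (dX 0 Y) z + b * dX 0 (dX 0 Z) z) + (a * dX 1 (dX 1 Y) z + b * dX 1 (dX 1 Z) z)
    = a * (dX 0 (dX 0 Y) z + dX 1 (dX 1 Y) z) + b * (dX 0 (dX 0 Z) z + dX 1 (dX 1 Z) z)
  ring

theorem hLap_scale (hJ : IsOpen J) (hY : Smooth J Y) {a : ℝ → ℝ}
    (ha : ContDiffOn ℝ (⊤ : ℕ∞) a J) :
    EqOn (hLap fun z => timeFn a z * Y z) (fun z => timeFn a z * hLap Y z) (dom J) := by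
  intro z hz
  have h := fun k => dV_dV_scale hJ (V := fun z : St => ((xi k z.1, 0) : St)) (fun _ => rfl) hY
    (hY.dX hJ k) ha hz
  refine (congrArg₂ (· + ·) (h 0) (h 1)).trans ?_
  change timeFn a z * dX 0 (dX 0 Y) z + timeFn a z * dX 1 (dX 1 Y) z
    = timeFn a z * (dX 0 (dX 0 Y) z + dX 1 (dX 1 Y) z)
  ring

theorem dT_lin (hJ : IsOpen J) (hY : Smooth J Y) (hZ : Smooth J Z) (a b : ℝ) {z : St}
    (hz : z ∈ dom J) : dT (fun z => a * Y z + b * Z z) z = a * dT Y z + b * dT Z z :=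
  dV_lin hJ (fun _ => ((0, 0, 1) : St)) hY hZ a b hz

theorem dR_dR_lin (hJ : IsOpen J) (hY : Smooth J Y) (hZ : Smooth J Z) (a b : ℝ) {z : St}
    (hz : z ∈ dom J) :
    dR (dR fun z => a * Y z + b * Z z) z = a * dR (dR Y) z + b * dR (dR Z) z :=
  dV_dV_lin hJ (fun _ => ((0, 1, 0) : St)) hY hZ (hY.dR hJ) (hZ.dR hJ) a b hz

theorem dT_mul (hJ : IsOpen J) (hY : Smooth J Y) (hZ : Smooth J Z) {z : St} (hz : z ∈ dom J) :
    dT (fun z => Y z * Z z) z = Y z * dT Z z + Z z * dT Y z :=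
  dV_mul hJ (fun _ => ((0, 0, 1) : St)) hY hZ hz

theorem dR_dR_mul_self (hJ : IsOpen J) (hY : Smooth J Y) {z : St} (hz : z ∈ dom J) :
    dR (dR fun z => Y z * Y z) z = 2 * (Y z * dR (dR Y) z + dR Y z * dR Y z) := by
  have hd := hY.dR hJ
  have e1 : EqOn (dR fun z => Y z * Y z) (fun z => 1 * (Y z * dR Y z) + 1 * (Y z * dR Y z))
      (dom J) := fun z hz => by
    refine (dV_mul hJ (fun _ => ((0, 1, 0) : St)) hY hY hz).trans ?_
    simp only [one_mul]
    rfl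
  have e2 := dV_congr hJ (fun _ => ((0, 1, 0) : St)) e1 hz
  have e3 := dV_lin hJ (fun _ => ((0, 1, 0) : St)) (hY.mul hd) (hY.mul hd) 1 1 hz
  have e4 : _ = Y z * dR (dR Y) z + dR Y z * dR Y z :=
    dV_mul hJ (fun _ => ((0, 1, 0) : St)) hY hd hz
  refine (e2.trans e3).trans ?_
  simp only [e4]
  ring

theorem Smooth.hLap (hJ : IsOpen J) (hY : Smooth J Y) : Smooth J (hLap Y) :=
  ((hY.dX hJ 0).dX hJ 0).add ((hY.dX hJ 1).dX hJ 1)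

/-- `Y` solves `∂ₜ Y = ∂ᵣ² Y + (Δ Y + κ Y) / (-2 t)` on orthonormal frames. -/
structure IsSol (J : Set ℝ) (κ : ℝ) (Y : St → ℝ) : Prop where
  smooth : Smooth J Y
  eq : ∀ A r, ∀ t ∈ J, dT Y (cols A, r, t) = dR (dR Y) (cols A, r, t)
    + (-2 * t)⁻¹ * (hLap Y (cols A, r, t) + κ * Y (cols A, r, t))

theorem IsSol.lin (hJ : IsOpen J) {κ : ℝ} (hY : IsSol J κ Y) (hZ : IsSol J κ Z) (a b : ℝ) :
    IsSol J κ fun z => a * Y z + b * Z z where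
  smooth := ((contDiffOn_const (c := a)).mul hY.smooth).add ((contDiffOn_const (c := b)).mul hZ.smooth)
  eq A r t ht := by
    have hz := cols_mem_dom A r ht
    have h1 := hY.eq A r t ht
    have h2 := hZ.eq A r t ht
    rw [dT_lin hJ hY.smooth hZ.smooth a b hz, dR_dR_lin hJ hY.smooth hZ.smooth a b hz,
      hLap_lin hJ hY.smooth hZ.smooth a b hz, h1, h2]
    ring

/-- Such an a is a multiple of (-2t)^(-m/2) on intervals of negative time. Rescaling to `g_t`-unit
frames is thus a shift of the reaction coefficient. -/
theorem IsSol.scale (hJ : IsOpen J) {κ m : ℝ} (hY : IsSol J κ Y) {a : ℝ → ℝ}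
    (ha : ContDiffOn ℝ (⊤ : ℕ∞) a J) (ha' : ∀ t ∈ J, HasDerivAt a (m * a t * (-2 * t)⁻¹) t) :
    IsSol J (κ + m) fun z => timeFn a z * Y z where
  smooth := (smooth_timeFn ha).mul hY.smooth
  eq A r t ht := by
    have hz := cols_mem_dom A r ht
    have h1 := hY.eq A r t ht
    have e1 : dT (timeFn a) (cols A, r, t) = m * a t * (-2 * t)⁻¹ * 1 :=
      dV_timeFn (z := (cols A, r, t)) (ha' t ht) fun _ => (0, 0, 1)
    have e2 : dR (dR fun z => timeFn a z * Y z) (cols A, r, t)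
        = timeFn a (cols A, r, t) * dR (dR Y) (cols A, r, t) :=
      dV_dV_scale hJ (V := fun _ => (0, 1, 0)) (fun _ => rfl) hY.smooth (hY.smooth.dR hJ) ha hz
    rw [dT_mul hJ (smooth_timeFn ha) hY.smooth hz, e1, e2, hLap_scale hJ hY.smooth ha hz, h1]
    simp only [timeFn]
    ring

end Derivations

/-! ### Energy -/

section Energy

variable {J : Set ℝ} {Y Z : St → ℝ}

theorem avg_add (hY : Smooth J Y) (hZ : Smooth J Z) (r : ℝ) {t : ℝ} (ht : t ∈ J) :
    avg (fun z => Y z + Z z) r t = avg Y r t + avg Z r t :=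
  integral_add (hY.integrable r ht) (hZ.integrable r ht)

theorem avg_const_mul (a : ℝ) (Y : St → ℝ) (r t : ℝ) :
    avg (fun z => a * Y z) r t = a * avg Y r t :=
  integral_const_mul _ _

theorem avg_mono (hY : Smooth J Y) (hZ : Smooth J Z) (r : ℝ) {t : ℝ} (ht : t ∈ J)
    (h : ∀ A, Y (cols A, r, t) ≤ Z (cols A, r, t)) : avg Y r t ≤ avg Z r t :=
  integral_mono (hY.integrable r ht) (hZ.integrable r ht) h

theorem avg_nonneg (r t : ℝ) (h : ∀ A, 0 ≤ Y (cols A, r, t)) : 0 ≤ avg Y r t :=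
  integral_nonneg h

theorem Smooth.const_mul (a : ℝ) (hY : Smooth J Y) : Smooth J fun z => a * Y z :=
  (contDiffOn_const (c := a)).mul hY

/-- The evolution inequality of the energy of a solution. -/
theorem IsSol.energy_le (hJ : IsOpen J) {κ : ℝ} (hY : IsSol J κ Y) (r : ℝ) {t : ℝ} (ht : t ∈ J) :
    avg (dT fun z => Y z * Y z) r t ≤ avg (dR (dR fun z => Y z * Y z)) r t
      + 2 * (-2 * t)⁻¹ * (avg (fun z => Y z * hLap Y z) r t + κ * avg (fun z => Y z * Y z) r t) := by
  have hs := hY.smooth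
  have hL := hs.hLap hJ
  have hYY := hs.mul hs
  have h1 : avg (dT fun z => Y z * Y z) r t ≤ avg (fun z => dR (dR fun z => Y z * Y z) z
      + 2 * (-2 * t)⁻¹ * (Y z * hLap Y z + κ * (Y z * Y z))) r t := by
    refine avg_mono (hYY.dT hJ) (((hYY.dR hJ).dR hJ).add
      (((hs.mul hL).add (hYY.const_mul κ)).const_mul _)) r ht fun A => ?_
    have hz := cols_mem_dom A r ht
    have h2 := hY.eq A r t ht
    rw [dT_mul hJ hs hs hz, dR_dR_mul_self hJ hs hz, h2]
    -- The term dropped is 2(∂ᵣY)², which comes from ∂ᵣ²(Y²).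
    nlinarith [mul_self_nonneg (dR Y (cols A, r, t))]
  refine h1.trans (le_of_eq ?_)
  rw [avg_add ((hYY.dR hJ).dR hJ) (((hs.mul hL).add (hYY.const_mul κ)).const_mul _) r ht,
    avg_const_mul, avg_add (hs.mul hL) (hYY.const_mul κ) r ht, avg_const_mul]

theorem avg_mul_hLap_nonpos (hJ : IsOpen J) (hY : Smooth J Y) (r : ℝ) {t : ℝ} (ht : t ∈ J) :
    avg (fun z => Y z * hLap Y z) r t ≤ 0 := by
  rw [avg_mul_hLap hJ hY hY r ht, neg_nonpos]
  exact avg_nonneg r t fun A => add_nonneg (mul_self_nonneg _) (mul_self_nonneg _)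

theorem avg_congr (r t : ℝ) (h : ∀ A, Y (cols A, r, t) = Z (cols A, r, t)) :
    avg Y r t = avg Z r t := by
  unfold avg
  simp only [h]

/-- The spectral gap for one-forms, a consequence of the commutation relations. -/
theorem oneForm_gap (hJ : IsOpen J) (hY : Smooth J Y) (hZ : Smooth J Z) (r : ℝ) {t : ℝ}
    (ht : t ∈ J) (h2Y : ∀ A, dX 2 Y (cols A, r, t) = Z (cols A, r, t)) :
    2 * avg (fun z => Z z * Z z) r t
      ≤ -avg (fun z => Y z * hLap Y z) r t - avg (fun z => Z z * hLap Z z) r t := by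
  have s0 := hY.dX hJ 0
  have s1 := hY.dX hJ 1
  have u0 := hZ.dX hJ 0
  have u1 := hZ.dX hJ 1
  have c1 := avg_mul_dX hJ hZ s1 0 r ht
  have c2 := avg_mul_dX hJ hZ s0 1 r ht
  have c3 : avg (fun z => Z z * dX 0 (dX 1 Y) z) r t
      = avg (fun z => Z z * dX 1 (dX 0 Y) z) r t + avg (fun z => Z z * Z z) r t := by
    rw [← avg_add (hZ.mul (s0.dX hJ 1)) (hZ.mul hZ) r ht]
    refine avg_congr r t fun A => ?_
    have h := dX_commutator hJ hY (cols_mem_dom A r ht)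
    rw [h2Y] at h
    rw [← h]
    ring
  -- A Cauchy–Riemann type square. Expanded, it is the Dirichlet energy of the pair plus 2(X₀Z·X₁Y -
  -- X₁Z·X₀Y); integration by parts turns the latter into -2 times the average of Z·[X₀, X₁]Y, and
  -- [X₀, X₁]Y = X₂Y = Z.
  have hnonneg : 0 ≤ avg (fun z => (dX 0 Y z - dX 1 Z z) * (dX 0 Y z - dX 1 Z z)
      + (dX 0 Z z + dX 1 Y z) * (dX 0 Z z + dX 1 Y z)) r t :=
    avg_nonneg r t fun A => add_nonneg (mul_self_nonneg _) (mul_self_nonneg _)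
  have e1 : avg (fun z => (dX 0 Y z - dX 1 Z z) * (dX 0 Y z - dX 1 Z z)
      + (dX 0 Z z + dX 1 Y z) * (dX 0 Z z + dX 1 Y z)) r t
      = avg (fun z => ((dX 0 Y z * dX 0 Y z + dX 1 Y z * dX 1 Y z)
        + (dX 0 Z z * dX 0 Z z + dX 1 Z z * dX 1 Z z))
        + (2 * (dX 0 Z z * dX 1 Y z) + (-2) * (dX 1 Z z * dX 0 Y z))) r t :=
    avg_congr r t fun A => by ring
  have q1 := (s0.mul s0).add (s1.mul s1)
  have q2 := (u0.mul u0).add (u1.mul u1)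
  have q3 := (u0.mul s1).const_mul 2
  have q4 := (u1.mul s0).const_mul (-2)
  rw [e1, avg_add (q1.add q2) (q3.add q4) r ht, avg_add q1 q2 r ht, avg_add q3 q4 r ht,
    avg_const_mul, avg_const_mul] at hnonneg
  rw [avg_mul_hLap hJ hY hY r ht, avg_mul_hLap hJ hZ hZ r ht]
  linarith

end Energy

/-! ### The components as solutions -/

section Components

variable {I : Set ℝ} {h : ℝ → Tensor₂}

/-- Here and in the next four results the reaction coefficient is minus the number of spherical
indices, plus the curvature term: +2 on the spherical trace, -2 on the traceless spherical part, 0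
when an index is axial. -/
theorem isSol_comp_two_two (hneg : I ⊆ Iio 0) (hflow : IsLinearizedRicciDeTurckFlow I h) :
    IsSol (interior I) 0 (comp h 2 2) where
  smooth := smooth_comp hflow 2 2
  eq A r t ht := by
    have := frame_equation hneg hflow A r ht 2 2
    simp [sphDeg] at this
    rw [this]
    simp

theorem isSol_comp_two (hneg : I ⊆ Iio 0) (hflow : IsLinearizedRicciDeTurckFlow I h) {i : Fin 3}
    (hi : i ≠ 2) : IsSol (interior I) (-1) (comp h 2 i) where
  smooth := smooth_comp hflow 2 i
  eq A r t ht := by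
    have := frame_equation hneg hflow A r ht 2 i
    fin_cases i <;> simp [sphDeg] at this hi ⊢ <;> linarith

theorem isSol_comp_zero_one (hneg : I ⊆ Iio 0) (hflow : IsLinearizedRicciDeTurckFlow I h) :
    IsSol (interior I) (-4) (comp h 0 1) where
  smooth := smooth_comp hflow 0 1
  eq A r t ht := by
    have h1 := frame_equation hneg hflow A r ht 0 1
    have h2 := comp_symm hflow 1 0 (cols_mem_dom A r (interior_subset ht))
    simp [sphDeg, h2] at h1
    rw [show (-2 * t)⁻¹ = -(t⁻¹ * 2⁻¹) by rw [mul_inv]; ring]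
    linear_combination h1

/-- The coefficients 1 are written out so that the rules for linear combinations apply literally. -/
theorem isSol_trace (hneg : I ⊆ Iio 0) (hflow : IsLinearizedRicciDeTurckFlow I h) :
    IsSol (interior I) 0 (fun z => 1 * comp h 0 0 z + 1 * comp h 1 1 z) where
  smooth := ((smooth_comp hflow 0 0).const_mul 1).add ((smooth_comp hflow 1 1).const_mul 1)
  eq A r t ht := by
    have hJ : IsOpen (interior I) := isOpen_interior
    have s0 := smooth_comp hflow 0 0
    have s1 := smooth_comp hflow 1 1
    have hz := cols_mem_dom A r ht
    have h1 := frame_equation hneg hflow A r ht 0 0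
    have h2 := frame_equation hneg hflow A r ht 1 1
    rw [dT_lin hJ s0 s1 1 1 hz, dR_dR_lin hJ s0 s1 1 1 hz, hLap_lin hJ s0 s1 1 1 hz]
    simp [sphDeg] at h1 h2
    rw [show (-2 * t)⁻¹ = -(t⁻¹ * 2⁻¹) by rw [mul_inv]; ring]
    linear_combination h1 + h2

theorem isSol_diff (hneg : I ⊆ Iio 0) (hflow : IsLinearizedRicciDeTurckFlow I h) :
    IsSol (interior I) (-4) (fun z => 1 * comp h 0 0 z + (-1) * comp h 1 1 z) where
  smooth := ((smooth_comp hflow 0 0).const_mul 1).add ((smooth_comp hflow 1 1).const_mul (-1))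
  eq A r t ht := by
    have hJ : IsOpen (interior I) := isOpen_interior
    have s0 := smooth_comp hflow 0 0
    have s1 := smooth_comp hflow 1 1
    have hz := cols_mem_dom A r ht
    have h1 := frame_equation hneg hflow A r ht 0 0
    have h2 := frame_equation hneg hflow A r ht 1 1
    rw [dT_lin hJ s0 s1 1 (-1) hz, dR_dR_lin hJ s0 s1 1 (-1) hz, hLap_lin hJ s0 s1 1 (-1) hz]
    simp [sphDeg] at h1 h2
    rw [show (-2 * t)⁻¹ = -(t⁻¹ * 2⁻¹) by rw [mul_inv]; ring]
    linear_combination h1 - h2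

/-- `(-2 t)⁻¹`. -/
def invScale (t : ℝ) : ℝ := (-2 * t)⁻¹

theorem contDiffOn_invScale {J : Set ℝ} (hJ : J ⊆ Iio 0) : ContDiffOn ℝ (⊤ : ℕ∞) invScale J := by
  unfold invScale
  refine ContDiffOn.inv (by fun_prop) fun t ht => ?_
  have : t < 0 := hJ ht
  linarith

theorem hasDerivAt_invScale {t : ℝ} (ht : t < 0) :
    HasDerivAt invScale (2 * invScale t * (-2 * t)⁻¹) t := by
  have h0 : -2 * t ≠ 0 := by linarith
  refine (((hasDerivAt_id t).const_mul (-2)).inv h0).congr_deriv ?_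
  simp only [invScale, id]
  field_simp

theorem invScale_pos {t : ℝ} (ht : t < 0) : 0 < invScale t := by
  unfold invScale
  have : 0 < -2 * t := by linarith
  positivity

theorem contDiffOn_sqrt_invScale {J : Set ℝ} (hJ : J ⊆ Iio 0) :
    ContDiffOn ℝ (⊤ : ℕ∞) (fun s => Real.sqrt (invScale s)) J :=
  (contDiffOn_invScale hJ).sqrt fun _ ht => (invScale_pos (hJ ht)).ne'

theorem hasDerivAt_sqrt_invScale {t : ℝ} (ht : t < 0) :
    HasDerivAt (fun s => Real.sqrt (invScale s))
      (1 * Real.sqrt (invScale t) * (-2 * t)⁻¹) t := by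
  have h0 := invScale_pos ht
  refine ((hasDerivAt_invScale ht).sqrt h0.ne').congr_deriv ?_
  have h1 : Real.sqrt (invScale t) * Real.sqrt (invScale t) = invScale t := Real.mul_self_sqrt h0.le
  have h2 : 0 < Real.sqrt (invScale t) := Real.sqrt_pos.2 h0
  rw [div_eq_iff (by positivity)]
  calc 2 * invScale t * (-2 * t)⁻¹
      = 2 * (Real.sqrt (invScale t) * Real.sqrt (invScale t)) * (-2 * t)⁻¹ := by rw [h1]
    _ = _ := by ring

/-- The scalar fields on frames which describe `h`: the axial component, the two mixed components,
the trace, and the two traceless components. -/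
def field (h : ℝ → Tensor₂) (n : Fin 6) (z : St) : ℝ :=
  match n with
  | 0 => comp h 2 2 z
  | 1 => timeFn (fun t => Real.sqrt (invScale t)) z * comp h 2 0 z
  | 2 => timeFn (fun t => Real.sqrt (invScale t)) z * comp h 2 1 z
  | 3 => timeFn invScale z * (1 * comp h 0 0 z + 1 * comp h 1 1 z)
  | 4 => timeFn invScale z * (1 * comp h 0 0 z + (-1) * comp h 1 1 z)
  | 5 => timeFn invScale z * comp h 0 1 z

/-- The reaction coefficients of the fields. -/
def reaction : Fin 6 → ℝ
  | 0 | 1 | 2 => 0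
  | 3 => 2
  | 4 | 5 => -2

/-- The weights of the fields in the norm. -/
def weight : Fin 6 → ℝ
  | 0 => 1
  | 3 | 4 => 1 / 2
  | 1 | 2 | 5 => 2

/-- The unit-length factor (-2t)^(-d/2) for d spherical indices adds d: -1 + 1 = 0 for mixed
components, 0 + 2 = 2 for the trace, -4 + 2 = -2 for traceless components. -/
theorem isSol_field (hneg : I ⊆ Iio 0) (hflow : IsLinearizedRicciDeTurckFlow I h) (n : Fin 6) :
    IsSol (interior I) (reaction n) (field h n) := by
  have hJ : IsOpen (interior I) := isOpen_interior
  have hneg' : interior I ⊆ Iio 0 := interior_subset.trans hneg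
  have a1 := contDiffOn_invScale hneg'
  have a2 := contDiffOn_sqrt_invScale hneg'
  have b1 : ∀ t ∈ interior I, HasDerivAt invScale (2 * invScale t * (-2 * t)⁻¹) t :=
    fun t ht => hasDerivAt_invScale (hneg' ht)
  have b2 : ∀ t ∈ interior I, HasDerivAt (fun s => Real.sqrt (invScale s))
      (1 * Real.sqrt (invScale t) * (-2 * t)⁻¹) t := fun t ht => hasDerivAt_sqrt_invScale (hneg' ht)
  match n with
  | 0 => exact isSol_comp_two_two hneg hflow
  | 1 =>
    have := (isSol_comp_two hneg hflow (i := 0) (by decide)).scale hJ a2 b2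
    rw [show (-1 : ℝ) + 1 = 0 by norm_num] at this
    exact this
  | 2 =>
    have := (isSol_comp_two hneg hflow (i := 1) (by decide)).scale hJ a2 b2
    rw [show (-1 : ℝ) + 1 = 0 by norm_num] at this
    exact this
  | 3 =>
    have := (isSol_trace hneg hflow).scale hJ a1 b1
    rw [show (0 : ℝ) + 2 = reaction 3 by simp only [reaction]; norm_num] at this
    exact this
  | 4 =>
    have := (isSol_diff hneg hflow).scale hJ a1 b1
    rw [show (-4 : ℝ) + 2 = reaction 4 by simp only [reaction]; norm_num] at this
    exact this
  | 5 =>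
    have := (isSol_comp_zero_one hneg hflow).scale hJ a1 b1
    rw [show (-4 : ℝ) + 2 = reaction 5 by simp only [reaction]; norm_num] at this
    exact this

end Components

end RoundCylinder
end

noncomputable section
open MeasureTheory Set

namespace RoundCylinder

/-! ### The fiberwise norm as an average over frames -/

theorem toEuclideanLin_colVec (A B : O3) (i : Fin 3) :
    Matrix.toEuclideanLin A.1 (colVec B i) = colVec (A * B) i := by
  ext k
  simp [colVec, Matrix.toLpLin_apply, Matrix.mulVec, dotProduct, Matrix.mul_apply]

/-- The isometry of `ℝ³` given by an orthogonal matrix. -/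
def rotIso (A : O3) : R3 ≃ₗᵢ[ℝ] R3 :=
  LinearIsometry.toLinearIsometryEquiv
    { toLinearMap := Matrix.toEuclideanLin A.1
      norm_map' := fun x => by
        have h : inner ℝ (Matrix.toEuclideanLin A.1 x) (Matrix.toEuclideanLin A.1 x)
            = inner ℝ x x := by
          -- Every vector is its norm times the last column of an orthogonal matrix B, and A maps
          -- that column to a column of AB, again a unit vector.
          obtain ⟨⟨B, hB⟩, rfl⟩ | h0 := em (∃ B : R3 × O3, ‖B.1‖ • colVec B.2 2 = x)
          · rw [map_smul, toEuclideanLin_colVec]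
            simp only [inner_smul_left, inner_smul_right, inner_colVec]
          · refine absurd ?_ h0
            by_cases hx : x = 0
            · exact ⟨(0, 1), by simp [hx]⟩
            · obtain ⟨B, hB⟩ := exists_colVec_two_eq (x := ‖x‖⁻¹ • x)
                (by rw [norm_smul, norm_inv, norm_norm, inv_mul_cancel₀ (norm_ne_zero_iff.2 hx)])
              refine ⟨(x, B), ?_⟩
              rw [hB, smul_smul, mul_inv_cancel₀ (norm_ne_zero_iff.2 hx), one_smul]
        rw [real_inner_self_eq_norm_sq, real_inner_self_eq_norm_sq] at h
        exact (sq_eq_sq₀ (norm_nonneg _) (norm_nonneg _)).1 h } rfl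

theorem rotIso_apply (A : O3) (x : R3) : rotIso A x = Matrix.toEuclideanLin A.1 x := rfl

/-- The action of `O(3)` on the unit sphere. -/
def sphAct (A : O3) (x : Sph) : Sph :=
  ⟨rotIso A x.1, by simp⟩

theorem sphAct_baseMap (A B : O3) : sphAct A (baseMap B) = baseMap (A * B) :=
  Subtype.ext (toEuclideanLin_colVec A B 2)

theorem exists_baseMap_eq (x : Sph) : ∃ A, baseMap A = x := by
  obtain ⟨A, hA⟩ := exists_colVec_two_eq (x := x.1) (by simp)
  exact ⟨A, Subtype.ext hA⟩

theorem continuous_sphAct : Continuous fun p : O3 × Sph => sphAct p.1 p.2 := by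
  have h : (fun p : O3 × Sph => (sphAct p.1 p.2).1)
      = fun p => WithLp.toLp 2 fun k => ∑ j, p.1.1 k j * p.2.1 j := by
    funext p
    ext k
    simp [sphAct, rotIso_apply, Matrix.toLpLin_apply, Matrix.mulVec, dotProduct]
  refine continuous_induced_rng.2 ?_
  change Continuous fun p : O3 × Sph => (sphAct p.1 p.2).1
  rw [h]
  refine (PiLp.continuous_toLp 2 fun _ : Fin 3 => ℝ).comp (continuous_pi fun k => ?_)
  refine continuous_finsetSum (f := fun (j : Fin 3) (p : O3 × Sph) => p.1.1 k j * p.2.1 j) _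
    fun j _ => ?_
  refine ((continuous_subtype_val.matrix_elem k j).comp continuous_fst).mul ?_
  have : Continuous fun p : O3 × Sph => p.2.1 := by fun_prop
  exact (PiLp.continuous_apply 2 _ j).comp this

open scoped Pointwise in
-- The sphere measure of a set is, up to a constant, the volume of the cone over it, and rotations
-- preserve volume.
theorem measurePreserving_sphAct (A : O3) :
    MeasurePreserving (sphAct A) (volume : Measure R3).toSphere (volume : Measure R3).toSphere := by
  have hc0 := continuous_sphAct.comp (by fun_prop : Continuous fun x : Sph => (A, x))
  have hc : Continuous (sphAct A) := hc0
  refine ⟨hc.measurable, ?_⟩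
  ext s hs
  rw [Measure.map_apply hc.measurable hs, Measure.toSphere_apply' _ (hc.measurable hs),
    Measure.toSphere_apply' _ hs]
  have h : Ioo (0 : ℝ) 1 • (Subtype.val '' (sphAct A ⁻¹' s))
      = rotIso A ⁻¹' (Ioo (0 : ℝ) 1 • (Subtype.val '' s)) := by
    ext v
    simp only [Set.mem_smul, mem_preimage, mem_image]
    constructor
    · rintro ⟨a, ha, _, ⟨x, hx, rfl⟩, rfl⟩
      exact ⟨a, ha, _, ⟨_, hx, rfl⟩, ((rotIso A).map_smul a x.1).symm⟩
    · rintro ⟨a, ha, _, ⟨y, hy, rfl⟩, hv⟩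
      refine ⟨a, ha, _, ⟨⟨(rotIso A).symm y.1, by simp⟩, ?_, rfl⟩, ?_⟩
      · have : sphAct A ⟨(rotIso A).symm y.1, by simp⟩ = y :=
          Subtype.ext ((rotIso A).apply_symm_apply y.1)
        rwa [this]
      · apply (rotIso A).injective
        rw [map_smul, LinearIsometryEquiv.apply_symm_apply, hv]
  rw [h, (rotIso A).measurePreserving.measure_preimage_emb
    (rotIso A).toHomeomorph.measurableEmbedding]

/-- Integration over the sphere as an average over frames. -/
theorem integral_toSphere {g : Sph → ℝ} (hg : Continuous g) :
    ∫ x, g x ∂(volume : Measure R3).toSphere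
      = (volume : Measure R3).toSphere.real univ * ∫ A, g (baseMap A) ∂haarO3 := by
  have h1 : ∀ A : O3, ∫ x, g (sphAct A x) ∂(volume : Measure R3).toSphere
      = ∫ x, g x ∂(volume : Measure R3).toSphere := fun A => by
    rw [← integral_map (measurePreserving_sphAct A).measurable.aemeasurable
      hg.aestronglyMeasurable, (measurePreserving_sphAct A).map_eq]
  have h2 : ∀ x : Sph, ∫ A, g (sphAct A x) ∂haarO3 = ∫ A, g (baseMap A) ∂haarO3 := fun x => by
    obtain ⟨B, rfl⟩ := exists_baseMap_eq x
    simp only [sphAct_baseMap]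
    exact integral_mul_right_eq_self (fun A => g (baseMap A)) B
  have hc : Continuous fun p : O3 × Sph => g (sphAct p.1 p.2) := hg.comp continuous_sphAct
  -- The integral of g(Ax) over O(3) × S² is evaluated in both orders: the inner integral over S²
  -- does not depend on A, and the inner one over O(3) does not depend on x.
  have h3 := integral_integral_swap (f := fun (A : O3) (x : Sph) => g (sphAct A x)) (μ := haarO3)
    (ν := (volume : Measure R3).toSphere)
    (hc.integrable_of_hasCompactSupport (HasCompactSupport.of_compactSpace _))
  simp only [h1, h2, integral_const, smul_eq_mul] at h3
  simpa using h3

/-! ### The fiberwise norm in terms of the six fields -/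

section FiberNorm

variable {I : Set ℝ} {h : ℝ → Tensor₂}

/-- The squared norm of `h` on frames. -/
def energyDensity (h : ℝ → Tensor₂) (z : St) : ℝ :=
  ∑ n, weight n * (field h n z * field h n z)

/-- Dividing the spherical frame vectors by √(-2t) makes the frame `g_t`-orthonormal. Weight 2
counts symmetric off-diagonal pairs; weight 1/2 comes from a² + b² = ((a + b)² + (a - b)²)/2. -/
theorem normSq_eq_energyDensity (hneg : I ⊆ Iio 0) (hflow : IsLinearizedRicciDeTurckFlow I h)
    (A : O3) (r : ℝ) {t : ℝ} (ht : t ∈ I) :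
    normSq t (colVec A 2, r) (h t (colVec A 2, r)) = energyDensity h (cols A, r, t) := by
  have ht0 : t < 0 := hneg ht
  have hz := cols_mem_dom A r ht
  have hp := invScale_pos ht0
  obtain ⟨q, hq⟩ : ∃ q, Real.sqrt (invScale t) = q := ⟨_, rfl⟩
  have hqq : invScale t = q * q := by rw [← hq, Real.mul_self_sqrt hp.le]
  have hqt : q * q * (-2 * t) = 1 := by
    rw [← hqq, invScale, inv_mul_cancel₀ (by linarith)]
  let m : Fin 3 → ℝ := fun i => if i = 2 then 1 else q
  have hcyl : ((colVec A 2, r) : Amb) ∈ cyl := norm_colVec A 2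
  have hN := normSq_eq_of_orthonormal ht0 hcyl (h t (colVec A 2, r))
    (fun i => m i • frameVec (cols A) i)
    (fun i => Submodule.smul_mem _ _ (frameVec_mem_tangent A r i)) ?_
  · rw [hN]
    have hm : ∀ i j, h t (colVec A 2, r) (m i • frameVec (cols A) i) (m j • frameVec (cols A) j)
        = m i * (m j * comp h i j (cols A, r, t)) := fun i j => by
      rw [map_smul, map_smul, LinearMap.smul_apply, comp_cols]
      simp only [smul_eq_mul]
      ring
    have m0 : m 0 = q := rfl
    have m1 : m 1 = q := rfl
    have m2 : m 2 = 1 := rfl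
    simp only [hm, Fin.sum_univ_three, energyDensity, Fin.sum_univ_six, field, weight, timeFn,
      m0, m1, m2, comp_symm hflow 1 0 hz, comp_symm hflow 0 2 hz, comp_symm hflow 1 2 hz, hq]
    simp only [hqq]
    ring
  · intro i j
    have : metric t (m i • frameVec (cols A) i) (m j • frameVec (cols A) j)
        = m i * m j * metric t (frameVec (cols A) i) (frameVec (cols A) j) := by
      simp only [metric, sphereMetric, Prod.smul_fst, Prod.smul_snd, inner_smul_left,
        inner_smul_right, smul_eq_mul, conj_trivial]
      ring
    rw [this, metric_frameVec, abs_of_neg ht0]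
    by_cases hij : i = j
    · subst hij
      by_cases hi : i = 2
      · simp [hi, m]
      · simp only [hi, m, if_false, if_true]
        linarith
    · simp [hij]

theorem continuous_comp_frame (hflow : IsLinearizedRicciDeTurckFlow I h) (i j : Fin 3)
    (u v : R3) (r : ℝ) {t : ℝ} (ht : t ∈ I) :
    Continuous fun x : Sph => comp h i j ((u, v, x.1), r, t) := by
  refine (contDiffOn_comp hflow i j).continuousOn.comp_continuous (by fun_prop) fun x => ⟨?_, ht⟩
  exact ne_zero_of_mem_unit_sphere x

theorem comp_frame (x : Sph) (i j : Fin 3) (u v : R3) (r t : ℝ) :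
    comp h i j ((u, v, x.1), r, t)
      = h t (x.1, r) (tanProj x.1 (frameVec (u, v, x.1) i)) (tanProj x.1 (frameVec (u, v, x.1) j)) := by
  have : basePt (u, v, x.1) = x.1 := by simp [basePt]
  simp only [comp, this]

/-- The projected standard basis vectors are frame vectors of the non-orthonormal triples (eᵢ, eⱼ,
x), on which `comp` is already known to be continuous. -/
theorem continuous_normSq (hflow : IsLinearizedRicciDeTurckFlow I h) (r : ℝ) {t : ℝ}
    (ht : t ∈ I) : Continuous fun x : Sph => normSq t (x.1, r) (h t (x.1, r)) := by
  unfold normSq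
  have hp : ∀ (x : R3) (k : Fin 3), tanProj x (EuclideanSpace.single k 1, 0) = (sphereProj x k, 0) := by
    intro x k
    simp [tanProj, sphereProj, EuclideanSpace.inner_single_right]
  have hp' : ∀ x : R3, tanProj x (0, 1) = (0, 1) := fun x => by simp [tanProj]
  set s := (Real.sqrt (2 * |t|))⁻¹ with hs
  have hsome : ∀ (x : R3) (k : Fin 3), projFrame t (x, r) (some k) = s • ((sphereProj x k, 0) : Amb) := by
    intro x k
    simp [projFrame, hs]
  refine continuous_finsetSum _ fun a _ => continuous_finsetSum _ fun b _ => Continuous.pow ?_ 2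
  rcases a with _ | i <;> rcases b with _ | j
  · refine (continuous_comp_frame hflow 2 2 0 0 r ht).congr fun x => ?_
    simp [comp_frame, frameVec, hp', projFrame]
  · refine (continuous_const.mul (continuous_comp_frame hflow 2 0 (EuclideanSpace.single j 1) 0 r
      ht)).congr (f := fun x => s * _) fun x => ?_
    simp only [hsome, map_smul, smul_eq_mul]
    simp [comp_frame, frameVec, hp, hp', projFrame]
  · refine (continuous_const.mul (continuous_comp_frame hflow 0 2 (EuclideanSpace.single i 1) 0 r
      ht)).congr (f := fun x => s * _) fun x => ?_
    simp only [hsome, map_smul, smul_eq_mul, LinearMap.smul_apply]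
    simp [comp_frame, frameVec, hp, hp', projFrame]
  · refine (continuous_const.mul (continuous_comp_frame hflow 0 1 (EuclideanSpace.single i 1)
      (EuclideanSpace.single j 1) r ht)).congr (f := fun x => s * s * _) fun x => ?_
    simp only [hsome, map_smul, smul_eq_mul, LinearMap.smul_apply]
    simp [comp_frame, frameVec, hp, mul_assoc]

/-- The square of the fiberwise norm. -/
def energy (h : ℝ → Tensor₂) (r t : ℝ) : ℝ :=
  ∑ n, weight n * avg (fun z => field h n z * field h n z) r t

theorem smooth_field (hneg : I ⊆ Iio 0) (hflow : IsLinearizedRicciDeTurckFlow I h) (n : Fin 6) :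
    Smooth I (field h n) := by
  have c := contDiffOn_comp hflow
  have a1 := smooth_timeFn (contDiffOn_invScale hneg)
  have a2 := smooth_timeFn (contDiffOn_sqrt_invScale hneg)
  match n with
  | 0 => exact c 2 2
  | 1 => exact a2.mul (c 2 0)
  | 2 => exact a2.mul (c 2 1)
  | 3 => exact a1.mul ((Smooth.const_mul 1 (c 0 0)).add (Smooth.const_mul 1 (c 1 1)))
  | 4 => exact a1.mul ((Smooth.const_mul 1 (c 0 0)).add (Smooth.const_mul (-1) (c 1 1)))
  | 5 => exact a1.mul (c 0 1)

theorem weight_pos (n : Fin 6) : 0 < weight n := by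
  fin_cases n <;> norm_num [weight]

theorem fiberL2_eq (hneg : I ⊆ Iio 0) (hflow : IsLinearizedRicciDeTurckFlow I h) (r : ℝ) {t : ℝ}
    (ht : t ∈ I) : fiberL2 t (h t) r = Real.sqrt (energy h r t) := by
  have ht0 : t < 0 := hneg ht
  have hσ : (volume : Measure R3).toSphere.real univ ≠ 0 := by
    rw [measureReal_def, ENNReal.toReal_ne_zero]
    exact ⟨Measure.measure_univ_ne_zero.2 (Measure.toSphere_ne_zero _), measure_ne_top _ _⟩
  have hpos : 0 < 2 * |t| := by have := abs_pos.2 ht0.ne; positivity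
  rw [fiberL2]
  congr 1
  rw [fiberMeasure, integral_smul_measure, integral_toSphere (continuous_normSq hflow r ht),
    measureReal_ennreal_smul_apply, ENNReal.toReal_ofReal hpos.le]
  have e : ∫ A, normSq t ((baseMap A).1, r) (h t ((baseMap A).1, r)) ∂haarO3 = energy h r t := by
    calc _ = ∫ A, energyDensity h (cols A, r, t) ∂haarO3 :=
          integral_congr_ae (.of_forall fun A => normSq_eq_energyDensity hneg hflow A r ht)
      _ = _ := by
          unfold energyDensity energy
          rw [integral_finsetSum _ fun n _ => ?_]
          · refine Finset.sum_congr rfl fun n _ => ?_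
            rw [integral_const_mul]
            rfl
          · have hs := smooth_field hneg hflow n
            exact ((hs.mul hs).integrable r ht).const_mul _
  have := abs_pos.2 ht0.ne
  rw [e, smul_eq_mul]
  field_simp

end FiberNorm

end RoundCylinder
end

noncomputable section
open MeasureTheory Set

namespace RoundCylinder

open SpherePoly

/-! ### Evolution of weighted energies -/

section WeightedEnergy

variable {ι : Type*} [Fintype ι] {J : Set ℝ} {Y : ι → St → ℝ} {w κ : ι → ℝ}

/-- The weighted sum of the averages of a family of frame functions. -/
def wavg (w : ι → ℝ) (Y : ι → St → ℝ) (r t : ℝ) : ℝ := ∑ n, w n * avg (Y n) r t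

theorem hasDerivAt_wavg_dT (hJ : IsOpen J) (hY : ∀ n, Smooth J (Y n)) (r : ℝ) {t : ℝ}
    (ht : t ∈ J) : HasDerivAt (fun s => wavg w Y r s) (wavg w (fun n => dT (Y n)) r t) t :=
  HasDerivAt.fun_sum fun n _ => (hasDerivAt_avg_dT hJ (hY n) r ht).const_mul (w n)

theorem hasDerivAt_wavg_dR (hJ : IsOpen J) (hY : ∀ n, Smooth J (Y n)) (r : ℝ) {t : ℝ}
    (ht : t ∈ J) : HasDerivAt (fun s => wavg w Y s t) (wavg w (fun n => dR (Y n)) r t) r :=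
  HasDerivAt.fun_sum fun n _ => (hasDerivAt_avg_dR hJ (hY n) r ht).const_mul (w n)

theorem continuousOn_wavg (hY : ∀ n, Smooth J (Y n)) :
    ContinuousOn (fun z : ℝ × ℝ => wavg w Y z.1 z.2) (univ ×ˢ J) :=
  continuousOn_finsetSum _ fun n _ => continuousOn_const.mul (continuousOn_avg (hY n).continuousOn)

theorem wavg_energy_le (hJ : IsOpen J) (hY : ∀ n, IsSol J (κ n) (Y n)) (hw : ∀ n, 0 ≤ w n) (r : ℝ)
    {t : ℝ} (ht : t ∈ J) :
    wavg w (fun n => dT fun z => Y n z * Y n z) r t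
      ≤ wavg w (fun n => dR (dR fun z => Y n z * Y n z)) r t
        + 2 * (-2 * t)⁻¹ * ∑ n, w n * (avg (fun z => Y n z * hLap (Y n) z) r t
          + κ n * avg (fun z => Y n z * Y n z) r t) := by
  unfold wavg
  rw [Finset.mul_sum, ← Finset.sum_add_distrib]
  refine Finset.sum_le_sum fun n _ => ?_
  have := mul_le_mul_of_nonneg_left ((hY n).energy_le hJ r ht) (hw n)
  linarith

end WeightedEnergy

/-! ### Consequences of the vanishing average -/

section Average

variable {I : Set ℝ} {h : ℝ → Tensor₂}

/-- At the base point e₂ with the standard frame, A carries the frame to its own columns, so the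
O(3)-average of h is the frame average of `comp`. -/
theorem avg_comp_self_eq_zero {t : ℝ}
    (havg : ∀ p ∈ cyl, ∀ v ∈ tangent p, ∀ w ∈ tangent p, o3Average (h t) p v w = 0) (i : Fin 3)
    (r : ℝ) : avg (comp h i i) r t = 0 := by
  let e : Fin 3 → R3 := fun k => EuclideanSpace.single k 1
  have hmem : frameVec (e 0, e 1, e 2) i ∈ tangent (e 2, r) := by
    show inner ℝ (e 2) (frameVec (e 0, e 1, e 2) i).1 = 0
    fin_cases i <;> simp [frameVec, e, EuclideanSpace.inner_single_left]
  have h1 := havg (e 2, r) (by simp [cyl, e]) _ hmem _ hmem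
  rw [← h1]
  unfold avg o3Average
  congr 1
  funext A
  have hact : act A (frameVec (e 0, e 1, e 2) i) = frameVec (cols A) i := by
    fin_cases i <;> simp [frameVec, act, e, cols, toEuclideanLin_single]
  have hbase : act A (e 2, r) = (colVec A 2, r) := by
    simp [act, e, toEuclideanLin_single]
  rw [comp_cols, hact, hbase]

theorem avg_field_zero {t : ℝ}
    (havg : ∀ p ∈ cyl, ∀ v ∈ tangent p, ∀ w ∈ tangent p, o3Average (h t) p v w = 0) (r : ℝ) :
    avg (field h 0) r t = 0 :=
  avg_comp_self_eq_zero havg 2 r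

theorem avg_field_three (hflow : IsLinearizedRicciDeTurckFlow I h) {t : ℝ} (ht : t ∈ I)
    (havg : ∀ p ∈ cyl, ∀ v ∈ tangent p, ∀ w ∈ tangent p, o3Average (h t) p v w = 0) (r : ℝ) :
    avg (field h 3) r t = 0 := by
  have s : ∀ i, Smooth I (comp h i i) := fun i => contDiffOn_comp hflow i i
  have h1 : avg (field h 3) r t
      = invScale t * avg (fun z => 1 * comp h 0 0 z + 1 * comp h 1 1 z) r t :=
    (avg_congr r t fun _ => rfl).trans
      (avg_const_mul (invScale t) (fun z => 1 * comp h 0 0 z + 1 * comp h 1 1 z) r t)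
  rw [h1, avg_add ((s 0).const_mul 1) ((s 1).const_mul 1) r ht, avg_const_mul, avg_const_mul,
    avg_comp_self_eq_zero havg, avg_comp_self_eq_zero havg]
  ring

/-- The axial component descends to the sphere. -/
theorem exists_field_zero_eq (hflow : IsLinearizedRicciDeTurckFlow I h) (r : ℝ) {t : ℝ}
    (ht : t ∈ I) : ∃ g : C(Sph, ℝ), ∀ A, field h 0 (cols A, r, t) = g (baseMap A) := by
  -- The axial component does not see the first two frame vectors, so both may be set to 0.
  refine ⟨⟨_, continuous_comp_frame hflow 2 2 0 0 r ht⟩, fun A => ?_⟩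
  show comp h 2 2 (cols A, r, t) = comp h 2 2 ((0, 0, (baseMap A).1), r, t)
  rw [comp_frame, comp_cols, ← tanProj_frameVec]
  rfl

/-- The trace descends to the sphere. -/
theorem exists_field_three_eq (hflow : IsLinearizedRicciDeTurckFlow I h) (r : ℝ) {t : ℝ}
    (ht : t ∈ I) : ∃ g : C(Sph, ℝ), ∀ A, field h 3 (cols A, r, t) = g (baseMap A) := by
  -- Tracing over the projections of the standard basis of ℝ³ gives an expression in the base point
  -- alone, hence globally continuous although the sphere has no global tangent frame.
  have hc : Continuous fun x : Sph => invScale t *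
      ∑ k : Fin 3, comp h 0 0 ((EuclideanSpace.single k 1, 0, x.1), r, t) :=
    continuous_const.mul (continuous_finsetSum _ fun k _ =>
      continuous_comp_frame hflow 0 0 (EuclideanSpace.single k 1) 0 r ht)
  refine ⟨⟨_, hc⟩, fun A => ?_⟩
  have hk : ∀ k : Fin 3, comp h 0 0 ((EuclideanSpace.single k 1, 0, (baseMap A).1), r, t)
      = colVec A 0 k * colVec A 0 k * comp h 0 0 (cols A, r, t)
        + colVec A 0 k * colVec A 1 k * (comp h 0 1 (cols A, r, t) + comp h 1 0 (cols A, r, t))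
        + colVec A 1 k * colVec A 1 k * comp h 1 1 (cols A, r, t) := by
    intro k
    have hv : tanProj (colVec A 2) (frameVec (EuclideanSpace.single k 1, 0, colVec A 2) 0)
        = colVec A 0 k • frameVec (cols A) 0 + colVec A 1 k • frameVec (cols A) 1 := by
      have := colVec_expand A (EuclideanSpace.single k 1)
      simp only [EuclideanSpace.inner_single_right, one_mul, conj_trivial] at this
      refine Prod.ext ?_ (by simp [tanProj, frameVec])
      show (EuclideanSpace.single k 1 : R3)
        - inner ℝ (colVec A 2) (EuclideanSpace.single k (1 : ℝ)) • colVec A 2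
        = colVec A 0 k • colVec A 0 + colVec A 1 k • colVec A 1
      rw [EuclideanSpace.inner_single_right, one_mul, conj_trivial]
      nth_rewrite 1 [this]
      abel
    rw [comp_frame]
    change h t (colVec A 2, r)
      (tanProj (colVec A 2) (frameVec (EuclideanSpace.single k 1, 0, colVec A 2) 0))
      (tanProj (colVec A 2) (frameVec (EuclideanSpace.single k 1, 0, colVec A 2) 0)) = _
    rw [hv]
    simp only [map_add, map_smul, LinearMap.add_apply, LinearMap.smul_apply, smul_eq_mul, comp_cols]
    ring
  have hon : ∀ i j, ∑ k, colVec A i k * colVec A j k = if i = j then 1 else 0 := fun i j => by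
    rw [← inner_colVec A i j]
    simp [PiLp.inner_apply, mul_comm]
  show invScale t * (1 * comp h 0 0 (cols A, r, t) + 1 * comp h 1 1 (cols A, r, t)) = invScale t *
      ∑ k : Fin 3, comp h 0 0 ((EuclideanSpace.single k 1, 0, (baseMap A).1), r, t)
  simp only [hk, Finset.sum_add_distrib, ← Finset.sum_mul, hon]
  simp

/-- The case k = 1: polynomials of degree below 1 are constants, so mean zero suffices. -/
theorem poincare_of_avg_eq_zero {J : Set ℝ} (hJ : IsOpen J) {Y : St → ℝ} (hY : Smooth J Y) (r : ℝ)
    {t : ℝ} (ht : t ∈ J) (hg : ∃ g : C(Sph, ℝ), ∀ A, Y (cols A, r, t) = g (baseMap A))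
    (h0 : avg Y r t = 0) :
    2 * avg (fun z => Y z * Y z) r t ≤ -avg (fun z => Y z * hLap Y z) r t := by
  obtain ⟨g, hg⟩ := hg
  have := poincare hJ hY r ht g hg 1 fun j hj p hp => ?_
  · norm_num at this ⊢
    exact this
  · obtain rfl : j = 0 := by omega
    rw [MvPolynomial.mem_restrictTotalDegree, Nat.le_zero,
      MvPolynomial.totalDegree_eq_zero_iff_eq_C] at hp
    have h1 : avg (fun z => Y z * polyFn p z) r t = avg (fun z => MvPolynomial.coeff 0 p * Y z) r t :=
      avg_congr r t fun A => by rw [hp]; simp [polyFn, ev, mul_comm]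
    rw [h1, avg_const_mul, h0, mul_zero]

end Average

/-! ### Monotonicity -/

section Monotone

variable {I : Set ℝ} {h : ℝ → Tensor₂}

theorem energy_eq_wavg (h : ℝ → Tensor₂) :
    energy h = wavg weight fun n z => field h n z * field h n z := rfl

/-- The trace is the only critical case: its reaction 2 equals the first nonzero eigenvalue, and
mean zero is exactly what is needed. -/
theorem dissipation_nonpos (hneg : I ⊆ Iio 0) (hflow : IsLinearizedRicciDeTurckFlow I h)
    (havg : ∀ t ∈ I, ∀ p ∈ cyl, ∀ v ∈ tangent p, ∀ w ∈ tangent p, o3Average (h t) p v w = 0)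
    (r : ℝ) {t : ℝ} (ht : t ∈ interior I) (n : Fin 6) :
    avg (fun z => field h n z * hLap (field h n) z) r t
      + reaction n * avg (fun z => field h n z * field h n z) r t ≤ 0 := by
  have hs := (isSol_field hneg hflow n).smooth
  have h1 := avg_mul_hLap_nonpos isOpen_interior hs r ht
  have h2 : 0 ≤ avg (fun z => field h n z * field h n z) r t :=
    avg_nonneg r t fun _ => mul_self_nonneg _
  have ht' := interior_subset ht
  match n with
  | 0 | 1 | 2 => simpa [reaction] using h1
  | 3 =>
    have := poincare_of_avg_eq_zero isOpen_interior hs r ht (exists_field_three_eq hflow r ht')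
      (avg_field_three hflow ht' (havg t ht') r)
    simp only [reaction]
    linarith
  | 4 | 5 =>
    simp only [reaction]
    linarith

theorem energy_le (hneg : I ⊆ Iio 0) (hflow : IsLinearizedRicciDeTurckFlow I h)
    (havg : ∀ t ∈ I, ∀ p ∈ cyl, ∀ v ∈ tangent p, ∀ w ∈ tangent p, o3Average (h t) p v w = 0)
    {t₁ t₂ C M : ℝ} (hsub : Icc t₁ t₂ ⊆ I) (hC : ∀ r, ∀ t ∈ Icc t₁ t₂, energy h r t ≤ C)
    (hM : ∀ r, energy h r t₁ ≤ M) (r : ℝ) : ∀ t ∈ Icc t₁ t₂, energy h r t ≤ M := by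
  have hJ : IsOpen (interior I) := isOpen_interior
  have hint : Ioo t₁ t₂ ⊆ interior I :=
    interior_maximal (Ioo_subset_Icc_self.trans hsub) isOpen_Ioo
  have hsol := isSol_field hneg hflow
  have hs : ∀ n, Smooth (interior I) fun z => field h n z * field h n z :=
    fun n => (hsol n).smooth.mul (hsol n).smooth
  rw [energy_eq_wavg] at *
  refine HeatEquation.le_of_bounded_subsolution (F := wavg weight fun n z => field h n z * field h n z)
    ((continuousOn_wavg fun n => ?_).mono (prod_mono_right hsub))
    (fun r t ht => hasDerivAt_wavg_dT hJ hs r (hint ht))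
    (fun r t ht => hasDerivAt_wavg_dR hJ hs r (hint ht))
    (fun r t ht => hasDerivAt_wavg_dR hJ (fun n => (hs n).dR hJ) r (hint ht))
    (fun r t ht => ?_) hC hM r
  · exact (smooth_field hneg hflow n).mul (smooth_field hneg hflow n)
  · refine (wavg_energy_le hJ hsol (fun n => (weight_pos n).le) r (hint ht)).trans ?_
    have ht0 : 0 < -2 * t := by
      have : t < 0 := hneg (interior_subset (hint ht))
      linarith
    have : ∑ n, weight n * (avg (fun z => field h n z * hLap (field h n) z) r t
        + reaction n * avg (fun z => field h n z * field h n z) r t) ≤ 0 :=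
      Finset.sum_nonpos fun n _ => mul_nonpos_of_nonneg_of_nonpos (weight_pos n).le
        (dissipation_nonpos hneg hflow havg r (hint ht) n)
    have := mul_nonpos_of_nonneg_of_nonpos (by positivity : 0 ≤ 2 * (-2 * t)⁻¹) this
    linarith

theorem antitoneOn_iSup_fiberL2 (hI : I.OrdConnected) (hneg : I ⊆ Iio 0)
    (hflow : IsLinearizedRicciDeTurckFlow I h)
    (havg : ∀ t ∈ I, ∀ p ∈ cyl, ∀ v ∈ tangent p, ∀ w ∈ tangent p, o3Average (h t) p v w = 0)
    (hbd : ∀ t₁ ∈ I, ∀ t₂ ∈ I, ∃ C : ℝ, ∀ t ∈ Icc t₁ t₂, ∀ r : ℝ, fiberL2 t (h t) r ≤ C) :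
    AntitoneOn (fun t => ⨆ r : ℝ, fiberL2 t (h t) r) I := by
  intro t₁ ht₁ t₂ ht₂ hle
  obtain ⟨C, hC⟩ := hbd t₁ ht₁ t₂ ht₂
  have hsub : Icc t₁ t₂ ⊆ I := hI.out ht₁ ht₂
  have hsq : ∀ t ∈ I, ∀ r K, fiberL2 t (h t) r ≤ K → energy h r t ≤ K ^ 2 := by
    intro t ht r K hK
    rw [fiberL2_eq hneg hflow r ht] at hK
    exact (Real.sqrt_le_iff.1 hK).2
  -- The bound makes the real supremum genuine; for an unbounded family it would take the default
  -- value 0.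
  have hbdd : BddAbove (range fun r => fiberL2 t₁ (h t₁) r) :=
    ⟨C, by rintro _ ⟨r, rfl⟩; exact hC t₁ (left_mem_Icc.2 hle) r⟩
  have hsup : ∀ r, fiberL2 t₁ (h t₁) r ≤ ⨆ r : ℝ, fiberL2 t₁ (h t₁) r := le_ciSup hbdd
  refine ciSup_le fun r => ?_
  rw [fiberL2_eq hneg hflow r ht₂]
  refine Real.sqrt_le_iff.2 ⟨(Real.sqrt_nonneg _).trans (hsup 0), ?_⟩
  exact energy_le hneg hflow havg hsub (fun r t ht => hsq t (hsub ht) r C (hC t ht r))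
    (fun r => hsq t₁ ht₁ r _ (hsup r)) r t₂ (right_mem_Icc.2 hle)

end Monotone

end RoundCylinder
end

noncomputable section
open MeasureTheory Set

namespace RoundCylinder

open SpherePoly

/-! ### Pairing solutions with polynomials -/

section Pairing

variable {J : Set ℝ} {Y : St → ℝ}

theorem dT_mul_polyFn (hJ : IsOpen J) (hY : Smooth J Y) (p : Poly) :
    EqOn (dT fun z => Y z * polyFn p z) (fun z => dT Y z * polyFn p z) (dom J) := fun z hz => by
  have h0 : dT (polyFn p) z = 0 := by simp [dT, fderiv_polyFn]
  rw [dT_mul hJ hY (smooth_polyFn J p) hz, h0]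
  ring

theorem dR_mul_polyFn (hJ : IsOpen J) (hY : Smooth J Y) (p : Poly) :
    EqOn (dR fun z => Y z * polyFn p z) (fun z => dR Y z * polyFn p z) (dom J) := fun z hz => by
  have h0 : dR (polyFn p) z = 0 := by simp [dR, fderiv_polyFn]
  have h1 : dR (fun z => Y z * polyFn p z) z = Y z * dR (polyFn p) z + polyFn p z * dR Y z :=
    dV_mul hJ (fun _ => ((0, 1, 0) : St)) hY (smooth_polyFn J p) hz
  rw [h1, h0]
  ring

/-- Integrals against an eigenfunction of the Laplacian on the sphere which balances the reaction
term solve the heat equation on the line. -/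
theorem IsSol.avg_dT_mul_polyFn (hJ : IsOpen J) {κ : ℝ} (hY : IsSol J κ Y) {p : Poly}
    (hp : sphereLaplacian p = -κ • p) (r : ℝ) {t : ℝ} (ht : t ∈ J) :
    avg (dT fun z => Y z * polyFn p z) r t = avg (dR (dR fun z => Y z * polyFn p z)) r t := by
  have hs := hY.smooth
  have hP := smooth_polyFn J p
  have e1 : avg (dT fun z => Y z * polyFn p z) r t
      = avg (fun z => dR (dR Y) z * polyFn p z
        + (-2 * t)⁻¹ * (polyFn p z * hLap Y z + κ * (Y z * polyFn p z))) r t := by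
    refine avg_congr r t fun A => ?_
    refine (dT_mul_polyFn hJ hs p (cols_mem_dom A r ht)).trans ?_
    simp only [hY.eq A r t ht]
    ring
  have e2 : avg (dR (dR fun z => Y z * polyFn p z)) r t
      = avg (fun z => dR (dR Y) z * polyFn p z) r t := by
    refine avg_congr r t fun A => ?_
    exact (dV_congr hJ (fun _ => ((0, 1, 0) : St)) (dR_mul_polyFn hJ hs p)).trans
      (dR_mul_polyFn hJ (hs.dR hJ) p) (cols_mem_dom A r ht)
  have e3 : avg (fun z => Y z * hLap (polyFn p) z) r t = -κ * avg (fun z => Y z * polyFn p z) r t := by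
    rw [← avg_const_mul]
    refine avg_congr r t fun A => ?_
    rw [hLap_polyFn, hp]
    simp [polyFn, ev]
    ring
  have s1 := hP.mul (hs.hLap hJ)
  have s2 := (hs.mul hP).const_mul κ
  rw [e1, e2, avg_add (((hs.dR hJ).dR hJ).mul hP) ((s1.add s2).const_mul _) r ht, avg_const_mul,
    avg_add s1 s2 r ht, avg_const_mul, avg_mul_hLap_comm hJ hP hs r ht, e3]
  ring

/-- These stationary solutions are the model to be subtracted: with κ = 2 and p linear they have the
reaction coefficient of the trace. -/
theorem isSol_polyFn {κ : ℝ} {p : Poly} (hp : sphereLaplacian p = -κ • p) :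
    IsSol J κ (polyFn p) where
  smooth := smooth_polyFn J p
  eq A r t _ := by
    have hR : dR (polyFn p) = fun _ => 0 := by
      funext z
      simp [dR, fderiv_polyFn]
    have hT : dT (polyFn p) (cols A, r, t) = 0 := by simp [dT, fderiv_polyFn]
    rw [hLap_polyFn, hp, hR, hT]
    simp [dR, polyFn, ev]

/-- The coordinate functions. -/
def coord (i : Fin 3) : St → ℝ := polyFn (MvPolynomial.X i)

theorem coord_apply (i : Fin 3) (z : St) : coord i z = z.1.2.2 i := by
  simp [coord, polyFn, ev]

theorem sphereLaplacian_X (i : Fin 3) :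
    sphereLaplacian (MvPolynomial.X i) = -(2 : ℝ) • (MvPolynomial.X i : Poly) := by
  rw [sphereLaplacian_of_isHomogeneous (MvPolynomial.isHomogeneous_X ℝ i)]
  have : flatLaplacian (MvPolynomial.X i : Poly) = 0 := by
    rw [flatLaplacian_apply]
    refine Finset.sum_eq_zero fun j _ => ?_
    rw [MvPolynomial.pderiv_X]
    by_cases hij : i = j <;> simp [hij]
  rw [this]
  norm_num

theorem avg_const (a r t : ℝ) : avg (fun _ => a) r t = a := by simp [avg]

theorem avg_hLap (hJ : IsOpen J) (hY : Smooth J Y) (r : ℝ) {t : ℝ} (ht : t ∈ J) :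
    avg (hLap Y) r t = 0 := by
  have h := avg_add ((hY.dX hJ 0).dX hJ 0) ((hY.dX hJ 1).dX hJ 1) r ht
  rw [avg_dX hJ (hY.dX hJ 0) 0 r ht, avg_dX hJ (hY.dX hJ 1) 1 r ht, add_zero] at h
  exact h

/-- The spherical Laplacian of xᵢxⱼ is 2δᵢⱼ - 6xᵢxⱼ and has average zero, so no integral has to be
computed. -/
theorem avg_coord_mul_coord (i j : Fin 3) (r t : ℝ) :
    avg (fun z => coord i z * coord j z) r t = if i = j then 1 / 3 else 0 := by
  let p : Poly := MvPolynomial.X i * MvPolynomial.X j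
  have hp : p.IsHomogeneous 2 :=
    (MvPolynomial.isHomogeneous_X ℝ i).mul (MvPolynomial.isHomogeneous_X ℝ j)
  have hflat : flatLaplacian p = MvPolynomial.C (if i = j then 2 else 0) := by
    rw [flatLaplacian_apply]
    fin_cases i <;> fin_cases j <;>
      simp [p, Fin.sum_univ_three, MvPolynomial.pderiv_X] <;>
      (rw [map_ofNat]; norm_num)
  have h0 := avg_hLap isOpen_univ (smooth_polyFn univ p) r (mem_univ t)
  have h1 : avg (hLap (polyFn p)) r t
      = avg (fun z => (if i = j then 2 else 0) + (-6) * (coord i z * coord j z)) r t := by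
    refine avg_congr r t fun A => ?_
    rw [hLap_polyFn, sphereLaplacian_of_isHomogeneous hp, hflat]
    simp only [polyFn, ev, map_sub, MvPolynomial.eval_C, MvPolynomial.smul_eval, p, map_mul,
      MvPolynomial.eval_X, coord]
    push_cast
    ring
  have hc : Smooth univ fun _ : St => (if i = j then 2 else 0 : ℝ) := contDiffOn_const
  have hs : ∀ k, Smooth univ (coord k) := fun k => smooth_polyFn univ _
  rw [h1, avg_add hc (((hs i).mul (hs j)).const_mul _) r (mem_univ t), avg_const, avg_const_mul] at h0
  split_ifs at h0 ⊢ <;> linarith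

theorem avg_coord (i : Fin 3) (r t : ℝ) : avg (coord i) r t = 0 := by
  have h0 := avg_hLap isOpen_univ (smooth_polyFn univ (MvPolynomial.X i)) r (mem_univ t)
  have h1 : avg (hLap (coord i)) r t = avg (fun z => -2 * coord i z) r t :=
    avg_congr r t fun A => by
      rw [coord, hLap_polyFn, sphereLaplacian_X]
      simp [polyFn, ev]
  rw [show hLap (polyFn (MvPolynomial.X i)) = hLap (coord i) from rfl, h1, avg_const_mul] at h0
  linarith

theorem smooth_sum {ι : Type*} [Fintype ι] {Y : ι → St → ℝ} (hY : ∀ n, Smooth J (Y n)) :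
    Smooth J fun z => ∑ n, Y n z :=
  ContDiffOn.sum fun n _ => hY n

theorem avg_sum {ι : Type*} [Fintype ι] {Y : ι → St → ℝ} (hY : ∀ n, Smooth J (Y n)) (r : ℝ) {t : ℝ}
    (ht : t ∈ J) : avg (fun z => ∑ n, Y n z) r t = ∑ n, avg (Y n) r t :=
  integral_finsetSum _ fun n _ => (hY n).integrable r ht

end Pairing

/-! ### Ancient solutions -/

section Ancient

variable {I : Set ℝ} {h : ℝ → Tensor₂}

/-- `flow 2` rotates the tangent frame and fixes the base point, so the mixed components rotate like
the two components of a one-form. -/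
theorem dX_two_comp_two_zero (hflow : IsLinearizedRicciDeTurckFlow I h) (A : O3) (r : ℝ) {t : ℝ}
    (ht : t ∈ interior I) :
    dX 2 (comp h 2 0) (cols A, r, t) = comp h 2 1 (cols A, r, t)
      ∧ dX 2 (comp h 2 1) (cols A, r, t) = -comp h 2 0 (cols A, r, t) := by
  have key : ∀ j, ∀ θ, comp h 2 j (flow 2 θ (cols A), r, t)
      = h t (colVec A 2, r) (frameVec (cols A) 2) (frameVec (flow 2 θ (cols A)) j) := by
    intro j θ
    rw [← cols_mul_rot, comp_cols, cols_mul_rot]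
    have hb : colVec (A * rot 2 θ) 2 = colVec A 2 := congrArg (fun c : Fr => c.2.2) (cols_mul_rot A 2 θ)
    rw [hb]
    rfl
  have e0 : ∀ θ, frameVec (flow 2 θ (cols A)) 0
      = Real.cos θ • frameVec (cols A) 0 + Real.sin θ • frameVec (cols A) 1 := fun θ => by
    simp [frameVec, flow]
  have e1 : ∀ θ, frameVec (flow 2 θ (cols A)) 1
      = Real.cos θ • frameVec (cols A) 1 - Real.sin θ • frameVec (cols A) 0 := fun θ => by
    simp [frameVec, flow]
  have d := fun j => (smooth_comp hflow 2 j).hasDerivAt_flow isOpen_interior 2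
    (c := cols A) 0 (r := r) (t := t) (by rw [flow_zero]; exact cols_mem_dom A r ht)
  simp only [flow_zero] at d
  have hc := Real.hasDerivAt_cos 0
  have hs := Real.hasDerivAt_sin 0
  constructor
  · refine (d 0).unique ?_
    have : (fun θ => comp h 2 0 (flow 2 θ (cols A), r, t)) = fun θ =>
        Real.cos θ * comp h 2 0 (cols A, r, t) + Real.sin θ * comp h 2 1 (cols A, r, t) := by
      funext θ
      rw [key, e0, map_add, map_smul, map_smul, comp_cols, comp_cols]
      rfl
    rw [this]
    refine ((hc.mul_const _).add (hs.mul_const _)).congr_deriv ?_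
    simp
  · refine (d 1).unique ?_
    have : (fun θ => comp h 2 1 (flow 2 θ (cols A), r, t)) = fun θ =>
        Real.cos θ * comp h 2 1 (cols A, r, t) - Real.sin θ * comp h 2 0 (cols A, r, t) := by
      funext θ
      rw [key, e1, map_sub, map_smul, map_smul, comp_cols, comp_cols]
      rfl
    rw [this]
    refine ((hc.mul_const _).sub (hs.mul_const _)).congr_deriv ?_
    simp

theorem dX_two_field (hneg : I ⊆ Iio 0) (hflow : IsLinearizedRicciDeTurckFlow I h) (A : O3) (r : ℝ)
    {t : ℝ} (ht : t ∈ interior I) :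
    dX 2 (field h 1) (cols A, r, t) = field h 2 (cols A, r, t)
      ∧ dX 2 (field h 2) (cols A, r, t) = -field h 1 (cols A, r, t) := by
  have hz := cols_mem_dom A r ht
  have ha := contDiffOn_sqrt_invScale (interior_subset.trans hneg)
  have e := fun j => dV_scale isOpen_interior (V := fun z : St => ((xi 2 z.1, 0) : St))
    (fun _ => rfl) (smooth_comp hflow 2 j) ha hz
  obtain ⟨d0, d1⟩ := dX_two_comp_two_zero hflow A r ht
  have e0 : dX 2 (field h 1) (cols A, r, t)
      = timeFn (fun s => Real.sqrt (invScale s)) (cols A, r, t) * dX 2 (comp h 2 0) (cols A, r, t) :=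
    e 0
  have e1 : dX 2 (field h 2) (cols A, r, t)
      = timeFn (fun s => Real.sqrt (invScale s)) (cols A, r, t) * dX 2 (comp h 2 1) (cols A, r, t) :=
    e 1
  rw [e0, e1, d0, d1]
  exact ⟨rfl, by rw [mul_neg]; rfl⟩

/-- The spectral gap of the mixed components. -/
theorem mixed_gap (hneg : I ⊆ Iio 0) (hflow : IsLinearizedRicciDeTurckFlow I h) (r : ℝ) {t : ℝ}
    (ht : t ∈ interior I) :
    avg (fun z => field h 1 z * field h 1 z) r t + avg (fun z => field h 2 z * field h 2 z) r t
      ≤ -avg (fun z => field h 1 z * hLap (field h 1) z) r t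
        - avg (fun z => field h 2 z * hLap (field h 2) z) r t := by
  have hJ : IsOpen (interior I) := isOpen_interior
  have s1 := (isSol_field hneg hflow 1).smooth
  have s2 := (isSol_field hneg hflow 2).smooth
  -- `oneForm_gap` is applied to the pairs (f₁, f₂) and (f₂, -f₁) and the results are added. The
  -- sign change is written as a linear combination to match `hLap_lin`.
  have s1' : Smooth (interior I) fun z => (-1) * field h 1 z + 0 * field h 1 z :=
    (s1.const_mul (-1)).add (s1.const_mul 0)
  have g1 := oneForm_gap hJ s1 s2 r ht fun A => (dX_two_field hneg hflow A r ht).1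
  have g2 := oneForm_gap hJ s2 s1' r ht fun A => by
    rw [(dX_two_field hneg hflow A r ht).2]; ring
  have c1 : avg (fun z => (-1 * field h 1 z + 0 * field h 1 z) * (-1 * field h 1 z + 0 * field h 1 z))
      r t = avg (fun z => field h 1 z * field h 1 z) r t := avg_congr r t fun A => by ring
  have c2 : avg (fun z => (-1 * field h 1 z + 0 * field h 1 z)
      * hLap (fun z => -1 * field h 1 z + 0 * field h 1 z) z) r t
      = avg (fun z => field h 1 z * hLap (field h 1) z) r t := avg_congr r t fun A => by
    rw [hLap_lin hJ s1 s1 (-1) 0 (cols_mem_dom A r ht)]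
    ring
  rw [c1, c2] at g2
  linarith

/-- The linear polynomial with coefficients `a`. -/
def linPoly (a : Fin 3 → ℝ) : Poly := ∑ i, a i • MvPolynomial.X i

theorem polyFn_linPoly (a : Fin 3 → ℝ) (z : St) : polyFn (linPoly a) z = ∑ i, a i * coord i z := by
  simp [polyFn, linPoly, ev, coord, MvPolynomial.smul_eval]

theorem sphereLaplacian_linPoly (a : Fin 3 → ℝ) :
    sphereLaplacian (linPoly a) = -(2 : ℝ) • linPoly a := by
  simp only [linPoly, map_sum, map_smul, sphereLaplacian_X, Finset.smul_sum]
  exact Finset.sum_congr rfl fun i _ => smul_comm _ _ _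

/-- The fields of the difference of `h` and `∑ aᵢ xᵢ` times the spherical part of the metric. -/
def redField (h : ℝ → Tensor₂) (a : Fin 3 → ℝ) (n : Fin 6) (z : St) : ℝ :=
  if n = 3 then 1 * field h 3 z + (-2) * polyFn (linPoly a) z else field h n z

/-- The factor 2 is the trace of the metric of the two-dimensional sphere. -/
theorem redField_three (h : ℝ → Tensor₂) (a : Fin 3 → ℝ) :
    redField h a 3 = fun z => 1 * field h 3 z + (-2) * polyFn (linPoly a) z := rfl

theorem redField_of_ne (h : ℝ → Tensor₂) (a : Fin 3 → ℝ) {n : Fin 6} (hn : n ≠ 3) :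
    redField h a n = field h n := by
  funext z
  simp [redField, hn]

theorem isSol_redField (hneg : I ⊆ Iio 0) (hflow : IsLinearizedRicciDeTurckFlow I h)
    (a : Fin 3 → ℝ) (n : Fin 6) : IsSol (interior I) (reaction n) (redField h a n) := by
  by_cases hn : n = 3
  · subst hn
    rw [redField_three]
    exact (isSol_field hneg hflow 3).lin isOpen_interior
      (isSol_polyFn (sphereLaplacian_linPoly a)) 1 (-2)
  · rw [redField_of_ne h a hn]
    exact isSol_field hneg hflow n

theorem exists_redField_three_eq (hflow : IsLinearizedRicciDeTurckFlow I h) (a : Fin 3 → ℝ) (r : ℝ)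
    {t : ℝ} (ht : t ∈ I) : ∃ g : C(Sph, ℝ), ∀ A, redField h a 3 (cols A, r, t) = g (baseMap A) := by
  obtain ⟨g, hg⟩ := exists_field_three_eq hflow r ht
  refine ⟨(1 : ℝ) • g + (-2 : ℝ) • restr (linPoly a), fun A => ?_⟩
  simp only [redField_three, hg, ContinuousMap.add_apply, ContinuousMap.smul_apply, restr_apply,
    smul_eq_mul]
  rfl

/-- The trace of the model is 2 Σ aᵢxᵢ and xᵢ² has average 1/3, so its pairing with xᵢ is 2aᵢ/3;
subtracting the model removes the degree-one part of the trace. -/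
theorem avg_redField_three_mul_polyFn (hneg : I ⊆ Iio 0) (hflow : IsLinearizedRicciDeTurckFlow I h)
    {a : Fin 3 → ℝ} {r t : ℝ} (ht : t ∈ I) (h0 : avg (field h 3) r t = 0)
    (h1 : ∀ i, avg (fun z => field h 3 z * coord i z) r t = 2 / 3 * a i) {p : Poly}
    (hp : p ∈ degLE 1) : avg (fun z => redField h a 3 z * polyFn p z) r t = 0 := by
  obtain ⟨c, b, hcb⟩ := polyFn_of_mem_degLE_one hp
  have s3 := smooth_field hneg hflow 3
  have sx : ∀ i, Smooth I (coord i) := fun i => smooth_polyFn I _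
  have sY : Smooth I (redField h a 3) := by
    rw [redField_three]
    exact (s3.const_mul 1).add ((smooth_polyFn I _).const_mul (-2))
  have e0 : avg (redField h a 3) r t = 0 := by
    have : avg (redField h a 3) r t
        = avg (fun z => field h 3 z + ∑ i, -2 * a i * coord i z) r t :=
      avg_congr r t fun A => by
        simp only [redField_three, polyFn_linPoly, Finset.mul_sum, one_mul, mul_assoc]
    rw [this, avg_add s3 (smooth_sum fun i => (sx i).const_mul _) r ht,
      avg_sum (fun i => (sx i).const_mul _) r ht, h0]
    simp only [avg_const_mul, avg_coord]
    simp
  have e1 : ∀ k, avg (fun z => redField h a 3 z * coord k z) r t = 0 := fun k => by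
    have : avg (fun z => redField h a 3 z * coord k z) r t
        = avg (fun z => field h 3 z * coord k z + ∑ i, -2 * a i * (coord i z * coord k z)) r t :=
      avg_congr r t fun A => by
        simp only [redField_three, polyFn_linPoly, Finset.mul_sum, Finset.sum_mul, add_mul, one_mul,
          mul_assoc]
    rw [this, avg_add (s3.mul (sx k)) (smooth_sum fun i => ((sx i).mul (sx k)).const_mul _) r ht,
      avg_sum (fun i => ((sx i).mul (sx k)).const_mul _) r ht, h1]
    simp only [avg_const_mul, avg_coord_mul_coord]
    simp
    ring
  have e2 : avg (fun z => redField h a 3 z * polyFn p z) r t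
      = avg (fun z => c * redField h a 3 z + ∑ i, b i * (redField h a 3 z * coord i z)) r t :=
    avg_congr r t fun A => by
      simp only [hcb, mul_add, Finset.mul_sum, coord_apply]
      congr 1
      · ring
      · exact Finset.sum_congr rfl fun i _ => by ring
  rw [e2, avg_add (sY.const_mul c) (smooth_sum fun i => (sY.mul (sx i)).const_mul _) r ht,
    avg_sum (fun i => (sY.mul (sx i)).const_mul _) r ht]
  simp [avg_const_mul, e0, e1]

end Ancient

end RoundCylinder
end

noncomputable section
open MeasureTheory Set

namespace RoundCylinder

open SpherePoly

/-! ### Rigidity of bounded ancient solutions -/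

section Rigidity

variable {I : Set ℝ} {h : ℝ → Tensor₂} {T C : ℝ}

theorem avg_field_sq_le (h : ℝ → Tensor₂) (r t : ℝ) :
    avg (fun z => field h 3 z * field h 3 z) r t ≤ 2 * energy h r t := by
  have hw : weight 3 = 1 / 2 := by simp only [weight]
  have : weight 3 * avg (fun z => field h 3 z * field h 3 z) r t ≤ energy h r t :=
    Finset.single_le_sum
      (f := fun n => weight n * avg (fun z => field h n z * field h n z) r t)
      (fun n _ => mul_nonneg (weight_pos n).le (avg_nonneg r t fun _ => mul_self_nonneg _))
      (Finset.mem_univ 3)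
  rw [hw] at this
  linarith

theorem exists_avg_mul_coord_eq (hneg : I ⊆ Iio 0) (hflow : IsLinearizedRicciDeTurckFlow I h)
    (hT : Iio T ⊆ interior I) (hC : ∀ r, ∀ t < T, energy h r t ≤ C) :
    ∃ a : Fin 3 → ℝ, ∀ i r, ∀ t < T, avg (fun z => field h 3 z * coord i z) r t = 2 / 3 * a i := by
  have hJ : IsOpen (interior I) := isOpen_interior
  have hsol := isSol_field hneg hflow 3
  have key : ∀ i, ∃ b, ∀ r, ∀ t < T, avg (fun z => field h 3 z * coord i z) r t = b := by
    intro i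
    have sx : Smooth (interior I) (coord i) := smooth_polyFn _ _
    have s := hsol.smooth.mul sx
    -- The bound comes from |f x| ≤ f² + x²: the averages of the two squares are at most 2C and
    -- equal to 1/3 respectively.
    refine HeatEquation.const_of_ancient_solution (C := 2 * C + 1 / 3)
      ((continuousOn_avg s.continuousOn).mono (prod_mono_right hT))
      (fun r t ht => hasDerivAt_avg_dT hJ s r (hT ht))
      (fun r t ht => hasDerivAt_avg_dR hJ s r (hT ht))
      (fun r t ht => hasDerivAt_avg_dR hJ (s.dR hJ) r (hT ht))
      (fun r t ht => hsol.avg_dT_mul_polyFn hJ (sphereLaplacian_X i) r (hT ht)) fun r t ht => ?_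
    have h1 := avg_field_sq_le h r t
    have h2 := hC r t ht
    have h3 := avg_coord_mul_coord i i r t
    rw [if_pos rfl] at h3
    have sff := hsol.smooth.mul hsol.smooth
    have sxx := sx.mul sx
    have h4 := avg_add sff sxx r (hT ht)
    rw [abs_le]
    constructor
    · have := avg_mono ((sff.add sxx).const_mul (-1)) s r (hT ht) fun A => by
        nlinarith [sq_nonneg (field h 3 (cols A, r, t) + coord i (cols A, r, t)),
          sq_nonneg (field h 3 (cols A, r, t)), sq_nonneg (coord i (cols A, r, t))]
      rw [avg_const_mul] at this
      linarith
    · have := avg_mono s (sff.add sxx) r (hT ht) fun A => by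
        nlinarith [sq_nonneg (field h 3 (cols A, r, t) - coord i (cols A, r, t)),
          sq_nonneg (field h 3 (cols A, r, t)), sq_nonneg (coord i (cols A, r, t))]
      linarith
  choose b hb using key
  exact ⟨fun i => 3 / 2 * b i, fun i r t ht => by rw [hb i r t ht]; ring⟩

/-- The damping rates are 2 for the axial part, 1 for the mixed pair, 6 - 2 = 4 for the reduced
trace and at least 2 for the traceless part; the mixed pair determines the common rate 1. -/
theorem redField_dissipation_le (hneg : I ⊆ Iio 0) (hflow : IsLinearizedRicciDeTurckFlow I h)
    {a : Fin 3 → ℝ} {r t : ℝ} (ht : t ∈ interior I)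
    (havg : ∀ p ∈ cyl, ∀ v ∈ tangent p, ∀ w ∈ tangent p, o3Average (h t) p v w = 0)
    (ha : ∀ i, avg (fun z => field h 3 z * coord i z) r t = 2 / 3 * a i) :
    ∑ n, weight n * (avg (fun z => redField h a n z * hLap (redField h a n) z) r t
        + reaction n * avg (fun z => redField h a n z * redField h a n z) r t)
      ≤ -wavg weight (fun n z => redField h a n z * redField h a n z) r t := by
  have hJ : IsOpen (interior I) := isOpen_interior
  have ht' := interior_subset ht
  have hs := fun n => (isSol_redField hneg hflow a n).smooth
  have hE : ∀ n, 0 ≤ avg (fun z => redField h a n z * redField h a n z) r t :=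
    fun n => avg_nonneg r t fun _ => mul_self_nonneg _
  have hL := fun n => avg_mul_hLap_nonpos hJ (hs n) r ht
  have d0 := poincare_of_avg_eq_zero hJ (isSol_field hneg hflow 0).smooth r ht
    (exists_field_zero_eq hflow r ht') (avg_field_zero havg r)
  have d12 := mixed_gap hneg hflow r ht
  obtain ⟨g, hg⟩ := exists_redField_three_eq hflow a r ht'
  have d3 := poincare hJ (hs 3) r ht g hg 2 fun j hj p hp =>
    avg_redField_three_mul_polyFn hneg hflow ht' (avg_field_three hflow ht' havg r) ha
      (degLE_mono (by omega) hp)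
  rw [← redField_of_ne h a (n := 0) (by decide)] at d0
  rw [← redField_of_ne h a (n := 1) (by decide), ← redField_of_ne h a (n := 2) (by decide)] at d12
  simp only [wavg, Fin.sum_univ_six, weight, reaction]
  norm_num at d3
  linarith [hE 0, hE 3, hE 4, hE 5, hL 4, hL 5]

theorem avg_redField_sq_eq_zero (hneg : I ⊆ Iio 0) (hflow : IsLinearizedRicciDeTurckFlow I h)
    (havg : ∀ t ∈ I, ∀ p ∈ cyl, ∀ v ∈ tangent p, ∀ w ∈ tangent p, o3Average (h t) p v w = 0)
    (hT0 : T ≤ 0) (hT : Iio T ⊆ interior I) (hC : ∀ r, ∀ t < T, energy h r t ≤ C) {a : Fin 3 → ℝ}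
    (ha : ∀ i r, ∀ t < T, avg (fun z => field h 3 z * coord i z) r t = 2 / 3 * a i) (n : Fin 6)
    (r : ℝ) {t : ℝ} (ht : t < T) : avg (fun z => redField h a n z * redField h a n z) r t = 0 := by
  have hJ : IsOpen (interior I) := isOpen_interior
  have hsol := isSol_redField hneg hflow a
  have hs : ∀ n, Smooth (interior I) fun z => redField h a n z * redField h a n z :=
    fun n => (hsol n).smooth.mul (hsol n).smooth
  have hE : ∀ n r t, 0 ≤ avg (fun z => redField h a n z * redField h a n z) r t :=
    fun n r t => avg_nonneg r t fun _ => mul_self_nonneg _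
  have key : wavg weight (fun n z => redField h a n z * redField h a n z) r t ≤ 0 := by
    refine HeatEquation.nonpos_of_ancient_subsolution
      (F := wavg weight fun n z => redField h a n z * redField h a n z)
      -- From (f - 2ℓ)² ≤ 2f² + 8ℓ² with weight 1/2. The average of ℓ² does not depend on r and t,
      -- so it may be evaluated at (0, 0).
      (C := 2 * C + 4 * avg (fun z => polyFn (linPoly a) z * polyFn (linPoly a) z) 0 0) hT0
      (fun r t ht => hasDerivAt_wavg_dT hJ hs r (hT ht))
      ((continuousOn_wavg hs).mono (prod_mono_right hT))
      (fun r t ht => hasDerivAt_wavg_dR hJ hs r (hT ht))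
      (fun r t ht => hasDerivAt_wavg_dR hJ (fun n => (hs n).dR hJ) r (hT ht))
      (fun r t ht => ?_) (fun r t ht => ?_) r t ht
    · have h1 := wavg_energy_le hJ hsol (fun n => (weight_pos n).le) r (hT ht)
      have h2 := redField_dissipation_le hneg hflow (hT ht) (havg t (interior_subset (hT ht)))
        fun i => ha i r t ht
      have ht0 : 0 < -t := by linarith
      have h3 := mul_le_mul_of_nonneg_left h2 (by positivity : 0 ≤ (-t)⁻¹)
      have h4 : 2 * (-2 * t)⁻¹ = (-t)⁻¹ := by
        rw [show -2 * t = 2 * -t by ring, mul_inv]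
        ring
      rw [h4] at h1
      rw [div_eq_inv_mul]
      linarith
    · have s3 := (isSol_field hneg hflow 3).smooth
      have sL := smooth_polyFn (interior I) (linPoly a)
      have h1 := avg_mono (hs 3) (((s3.mul s3).const_mul 2).add ((sL.mul sL).const_mul 8)) r (hT ht)
        fun A => by
          simp only [redField_three]
          nlinarith [sq_nonneg (field h 3 (cols A, r, t) + 2 * polyFn (linPoly a) (cols A, r, t))]
      rw [avg_add ((s3.mul s3).const_mul 2) ((sL.mul sL).const_mul 8) r (hT ht), avg_const_mul,
        avg_const_mul] at h1
      have h2 : avg (fun z => polyFn (linPoly a) z * polyFn (linPoly a) z) r t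
        = avg (fun z => polyFn (linPoly a) z * polyFn (linPoly a) z) 0 0 := rfl
      have h3 := hC r t ht
      have h4 : ∀ n, 0 ≤ avg (fun z => field h n z * field h n z) r t :=
        fun n => avg_nonneg r t fun _ => mul_self_nonneg _
      have h5 : ∀ n : Fin 6, n ≠ 3 → avg (fun z => redField h a n z * redField h a n z) r t
          = avg (fun z => field h n z * field h n z) r t := fun n hn => by
        rw [redField_of_ne h a hn]
      simp only [energy, Fin.sum_univ_six, weight] at h3
      simp only [wavg, Fin.sum_univ_six, weight]
      rw [h5 0 (by decide), h5 1 (by decide), h5 2 (by decide), h5 4 (by decide), h5 5 (by decide)]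
      linarith [h4 0, h4 1, h4 2, h4 4, h4 5]
  have h1 : weight n * avg (fun z => redField h a n z * redField h a n z) r t ≤ 0 :=
    (Finset.single_le_sum (f := fun n => weight n * avg (fun z => redField h a n z * redField h a n z) r t)
      (fun n _ => mul_nonneg (weight_pos n).le (hE n r t)) (Finset.mem_univ n)).trans key
  exact le_antisymm (nonpos_of_mul_nonpos_right h1 (weight_pos n)) (hE n r t)

/-- A continuous function that vanishes almost everywhere vanishes identically, because Haar measure
charges every nonempty open set. -/
theorem eq_zero_of_avg_sq_eq_zero {J : Set ℝ} {Y : St → ℝ} (hY : Smooth J Y) {r t : ℝ} (ht : t ∈ J)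
    (h0 : avg (fun z => Y z * Y z) r t = 0) (A : O3) : Y (cols A, r, t) = 0 := by
  have hc := (hY.mul hY).continuous_cols r ht
  have h1 := (integral_eq_zero_iff_of_nonneg (fun A => mul_self_nonneg _)
    ((hY.mul hY).integrable r ht)).1 h0
  have h2 := congrFun ((Continuous.ae_eq_iff_eq haarO3 hc continuous_zero).1 h1) A
  exact mul_self_eq_zero.1 h2

/-- The components of a bounded ancient solution. -/
theorem comp_eq_of_ancient (hneg : I ⊆ Iio 0) (hflow : IsLinearizedRicciDeTurckFlow I h)
    (havg : ∀ t ∈ I, ∀ p ∈ cyl, ∀ v ∈ tangent p, ∀ w ∈ tangent p, o3Average (h t) p v w = 0)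
    (hT0 : T ≤ 0) (hT : Iio T ⊆ interior I) (hC : ∀ r, ∀ t < T, energy h r t ≤ C) :
    ∃ a : Fin 3 → ℝ, ∀ A r, ∀ t < T, ∀ i j, comp h i j (cols A, r, t)
      = if i = j ∧ i ≠ 2 then (∑ k, a k * colVec A 2 k) * (-2 * t) else 0 := by
  obtain ⟨a, ha⟩ := exists_avg_mul_coord_eq hneg hflow hT hC
  refine ⟨a, fun A r t ht => ?_⟩
  have hz := cols_mem_dom A r (interior_subset (hT ht))
  have hv : ∀ n, redField h a n (cols A, r, t) = 0 := fun n =>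
    eq_zero_of_avg_sq_eq_zero (isSol_redField hneg hflow a n).smooth (hT ht)
      (avg_redField_sq_eq_zero hneg hflow havg hT0 hT hC ha n r ht) A
  have ht0 : t < 0 := hneg (interior_subset (hT ht))
  have hp := invScale_pos ht0
  have hq := Real.sqrt_pos.2 hp
  have hpt : invScale t * (-2 * t) = 1 := inv_mul_cancel₀ (by linarith)
  have f : ∀ n : Fin 6, n ≠ 3 → field h n (cols A, r, t) = 0 := fun n hn => by
    rw [← redField_of_ne h a hn, hv]
  have f0 : comp h 2 2 (cols A, r, t) = 0 := f 0 (by decide)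
  have f1 : comp h 2 0 (cols A, r, t) = 0 := (mul_eq_zero.1 (f 1 (by decide))).resolve_left hq.ne'
  have f2 : comp h 2 1 (cols A, r, t) = 0 := (mul_eq_zero.1 (f 2 (by decide))).resolve_left hq.ne'
  have f4 : 1 * comp h 0 0 (cols A, r, t) + (-1) * comp h 1 1 (cols A, r, t) = 0 :=
    (mul_eq_zero.1 (f 4 (by decide))).resolve_left hp.ne'
  have f5 : comp h 0 1 (cols A, r, t) = 0 := (mul_eq_zero.1 (f 5 (by decide))).resolve_left hp.ne'
  have f3 : 1 * (invScale t * (1 * comp h 0 0 (cols A, r, t) + 1 * comp h 1 1 (cols A, r, t)))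
      + (-2) * polyFn (linPoly a) (cols A, r, t) = 0 := hv 3
  rw [polyFn_linPoly] at f3
  simp only [coord_apply] at f3
  have e0 : comp h 0 0 (cols A, r, t) = (∑ k, a k * colVec A 2 k) * (-2 * t) := by
    have hx : ∑ k, a k * (cols A).2.2 k = ∑ k, a k * colVec A 2 k := rfl
    rw [hx] at f3
    linear_combination (-t) * f3 + f4 / 2 - (comp h 0 0 (cols A, r, t) + comp h 1 1 (cols A, r, t)) / 2 * hpt
  have e1 : comp h 1 1 (cols A, r, t) = (∑ k, a k * colVec A 2 k) * (-2 * t) := by linarith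
  have g1 := comp_symm hflow 0 2 hz
  have g2 := comp_symm hflow 1 2 hz
  have g3 := comp_symm hflow 1 0 hz
  intro i j
  fin_cases i <;> fin_cases j <;> simp <;> linarith

/-- A tensor is determined by its components in an orthonormal frame. -/
theorem apply_eq_of_comp {A : O3} {r t m : ℝ}
    (hc : ∀ i j, comp h i j (cols A, r, t) = if i = j ∧ i ≠ 2 then m else 0) {v w : Amb}
    (hv : v ∈ tangent (colVec A 2, r)) (hw : w ∈ tangent (colVec A 2, r)) :
    h t (colVec A 2, r) v w = m * sphereMetric v w := by
  have hex : ∀ v : Amb, v ∈ tangent (colVec A 2, r) → v = inner ℝ (colVec A 0) v.1 • frameVec (cols A) 0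
      + inner ℝ (colVec A 1) v.1 • frameVec (cols A) 1 + v.2 • frameVec (cols A) 2 := by
    intro v hv
    have h1 := colVec_expand A v.1
    have h2 : inner ℝ (colVec A 2) v.1 = 0 := hv
    rw [h2, zero_smul, add_zero] at h1
    refine Prod.ext ?_ ?_
    · simpa [frameVec, cols] using h1
    · simp [frameVec]
  have hs : sphereMetric v w = inner ℝ (colVec A 0) v.1 * inner ℝ (colVec A 0) w.1
      + inner ℝ (colVec A 1) v.1 * inner ℝ (colVec A 1) w.1 := by
    have h1 := colVec_expand A v.1
    have h2 : inner ℝ (colVec A 2) v.1 = 0 := hv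
    rw [h2, zero_smul, add_zero] at h1
    unfold sphereMetric
    nth_rewrite 1 [h1]
    simp only [inner_add_left, inner_smul_left, conj_trivial]
  rw [hs]
  nth_rewrite 1 [hex v hv, hex w hw]
  simp only [map_add, map_smul, LinearMap.add_apply, LinearMap.smul_apply, smul_eq_mul, ← comp_cols h,
    hc]
  simp
  ring

theorem exists_eq_of_ancient (hI : I.OrdConnected) (hneg : I ⊆ Iio 0)
    (hflow : IsLinearizedRicciDeTurckFlow I h)
    (havg : ∀ t ∈ I, ∀ p ∈ cyl, ∀ v ∈ tangent p, ∀ w ∈ tangent p, o3Average (h t) p v w = 0)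
    (hunb : ¬ BddBelow I) (hbd : ∃ C : ℝ, ∀ t ∈ I, ∀ r : ℝ, fiberL2 t (h t) r ≤ C) :
    ∃ a : Fin 3 → ℝ, ∀ t ∈ I, ∀ p ∈ cyl, ∀ v ∈ tangent p, ∀ w ∈ tangent p,
      h t p v w = (∑ i, a i * p.1 i) * (2 * |t| * sphereMetric v w) := by
  obtain ⟨C, hC⟩ := hbd
  have hne : I.Nonempty := by
    by_contra hne
    rw [not_nonempty_iff_eq_empty] at hne
    exact hunb (hne ▸ bddBelow_empty)
  have hlow : ∀ x, ∃ y ∈ I, y < x := fun x => by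
    by_contra! hx
    exact hunb ⟨x, fun y hy => hx y hy⟩
  -- An interval unbounded below contains every time before its supremum; only the supremum itself
  -- may be missed, and it is treated by continuity below.
  have hT : Iio (sSup I) ⊆ interior I := by
    refine interior_maximal (fun t ht => ?_) isOpen_Iio
    obtain ⟨s, hs, hts⟩ := exists_lt_of_lt_csSup hne ht
    obtain ⟨u, hu, hut⟩ := hlow t
    exact hI.out hu hs ⟨hut.le, hts.le⟩
  have hT0 : sSup I ≤ 0 := csSup_le hne fun t ht => (hneg ht).le
  have hle : ∀ t ∈ I, t ≤ sSup I := fun t ht => le_csSup ⟨0, fun s hs => (hneg hs).le⟩ ht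
  obtain ⟨a, ha⟩ := comp_eq_of_ancient (C := C ^ 2) hneg hflow havg hT0 hT fun r t ht => by
    have htI := interior_subset (hT ht)
    have := hC t htI r
    rw [fiberL2_eq hneg hflow r htI] at this
    exact (Real.sqrt_le_iff.1 this).2
  refine ⟨a, fun t ht p hp v hv w hw => ?_⟩
  obtain ⟨A, hA⟩ := exists_colVec_two_eq (x := p.1) hp
  obtain ⟨x, r⟩ := p
  obtain rfl : colVec A 2 = x := hA
  have ht0 : t < 0 := hneg ht
  -- If t is the right endpoint of I, the formula is known only for earlier times; both sides are
  -- left-continuous at t, so it persists.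
  have hcomp : ∀ i j, comp h i j (cols A, r, t)
      = if i = j ∧ i ≠ 2 then (∑ k, a k * colVec A 2 k) * (-2 * t) else 0 := by
    intro i j
    obtain ⟨u, hu, hut⟩ := hlow t
    have hc : ContinuousOn (fun s => comp h i j (cols A, r, s)) I :=
      (contDiffOn_comp hflow i j).continuousOn.comp (by fun_prop) fun s hs => cols_mem_dom A r hs
    have hI' : I ∈ nhdsWithin t (Iio t) :=
      Filter.mem_of_superset (Ioo_mem_nhdsLT hut) (Ioo_subset_Icc_self.trans (hI.out hu ht))
    have h1 : Filter.Tendsto (fun s => comp h i j (cols A, r, s)) (nhdsWithin t (Iio t))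
        (nhds (comp h i j (cols A, r, t))) := (hc t ht).mono_of_mem_nhdsWithin hI'
    have h2 : ContinuousAt (fun s : ℝ => if i = j ∧ i ≠ 2 then (∑ k, a k * colVec A 2 k) * (-2 * s)
        else 0) t := by
      split_ifs <;> fun_prop
    refine tendsto_nhds_unique h1 ((h2.tendsto.mono_left nhdsWithin_le_nhds).congr' ?_)
    filter_upwards [self_mem_nhdsWithin] with s hs
    exact (ha A r s (lt_of_lt_of_le hs (hle t ht)) i j).symm
  rw [apply_eq_of_comp hcomp hv hw, abs_of_neg ht0]
  ring

end Rigidity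

end RoundCylinder
end

theorem mainTheorem4 (I : Set ℝ) (hI : I.OrdConnected) (hneg : I ⊆ Set.Iio 0)
    (h : ℝ → Tensor₂) (hflow : IsLinearizedRicciDeTurckFlow I h)
    (havg : ∀ t ∈ I, ∀ p ∈ cyl, ∀ v ∈ tangent p, ∀ w ∈ tangent p, o3Average (h t) p v w = 0) :
    ((∀ t₁ ∈ I, ∀ t₂ ∈ I, ∃ C : ℝ, ∀ t ∈ Set.Icc t₁ t₂, ∀ r : ℝ, fiberL2 t (h t) r ≤ C) →
      AntitoneOn (fun t => ⨆ r : ℝ, fiberL2 t (h t) r) I) ∧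
    (¬ BddBelow I → (∃ C : ℝ, ∀ t ∈ I, ∀ r : ℝ, fiberL2 t (h t) r ≤ C) →
      ∃ a : Fin 3 → ℝ, ∀ t ∈ I, ∀ p ∈ cyl, ∀ v ∈ tangent p, ∀ w ∈ tangent p,
        h t p v w = (∑ i, a i * p.1 i) * (2 * |t| * sphereMetric v w)) := by
  exact ⟨antitoneOn_iSup_fiberL2 hI hneg hflow havg, exists_eq_of_ancient hI hneg hflow havg⟩
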